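/- **Setting.** Let $G_A$ be a real smooth Banach–Lie group with Lie algebra $\mathfrak g_A=T_1G_A$, and $G_B\subseteq G_A$ a Banach–Lie subgroup (a subgroup which is a split submanifold). Let $\mathcal H_A$ be a complex Hilbert space, $\rho\colon G_A\to U(\mathcal H_A)$ a norm-continuous unitary representation, with derived representation ${\rm d}\rho\colon\mathfrak g_A\to\mathcal B(\mathcal H_A)$, and $\mathcal H_B\subseteq\mathcal H_A$ a closed subspace with $\rho(G_B)\mathcal H_B\subseteq\mathcal H_B$ and $\mathcal H_A=\overline{\rm span}\,\rho(G_A)\mathcal H_B$. Let $P\colon\mathcal H_A\to\mathcal H_B$ be the orthogonal projection, and let $\Pi_\rho\colon D=G_A\times_{G_B}\mathcal H_B\to G_A/G_B$ be the homogeneous Hermitian vector bundle, consisting of the classes $[(u,f)]=[(uw,\rho(w)^{-1}f)]$, $u\in G_A$, $f\in\mathcal H_B$, $w\in G_B$, with $([(u,f)]\mid[(u,h)])=(f\mid h)$. On it consider the reproducing kernel $$K_\rho(uG_B,vG_B)[(v,f)]=[(u,P(\rho(u^{-1})\rho(v)f))].$$ For $g\in G_A$, $X\in\mathfrak g_A$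 and $f,h\in\mathcal H_B$, let $[((g,X),(f,h))]\in TD$ be the image of the tangent vector $(T_1(\lambda_g)X,h)$ at $(g,f)$ (where $\lambda_g$ is left translation by $g$) under the tangent map of the quotient map $G_A\times\mathcal H_B\to D$. A *connection* on a vector bundle $\pi\colon D\to Z$ is a smooth map $\Phi\colon TD\to TD$ with $\Phi\circ\Phi=\Phi$ which, for each $x\in D$, restricts to a bounded linear operator on $T_xD$ with range ${\rm Ker}(T_x\pi)$. It is *linear* if it is also linear on the fibres of $T\pi\colon TD\to TZ$. If $\Theta=(\delta,\zeta)$ is a smooth morphism of vector bundles from $D\to Z$ to $\widetilde D\to\widetilde Z$ such that $\delta$ is bijective, linear and bicontinuous between fibres, and $\widetilde\Phi$ is a connection on $\widetilde D\to\widetilde Z$, then the *pull-back* $\Theta^*(\widetilde\Phi)$ is the unique connection $\Phi$ on $D\to Z$ with $T\delta\circ\Phi=\widetilde\Phi\circ T\delta$. For a complex Hilbert space $\mathcal H$ and a closed subspace $\mathcal S_0\subseteq\mathcal H$ with orthogonal projection $p$, let ${\rm Gr}_{\mathcal S_0}(\mathcal H)=\{u\mathcal S_0: u\in U(\mathcal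 H)\}\simeq U(\mathcal H)/\mathcal U(p)$, where $\mathcal U(p)=\{u: u\mathcal S_0=\mathcal S_0\}$, and let $\mathcal T_{\mathcal S_0}(\mathcal H)=\{(\mathcal S,x): \mathcal S\in{\rm Gr}_{\mathcal S_0}(\mathcal H),\ x\in\mathcal S\}\simeq U(\mathcal H)\times_{\mathcal U(p)}\mathcal S_0$ be the tautological bundle over it. With the conditional expectation $E_p(X)=pXp+(1-p)X(1-p)$, the *universal connection* $\Phi_{E_p}$ on the tautological bundle is the linear connection $$[((u,X),(x,y))]\mapsto[((u,0),(x,E_p(X)x+y))],\qquad u\in U(\mathcal H),\ X^*=-X\in\mathcal B(\mathcal H),\ x,y\in\mathcal S_0 .$$ Let $\Delta_\rho=(\delta_\rho,\zeta_\rho)$ be the morphism from $\Pi_\rho$ to the tautological bundle $\mathcal T_{\mathcal H_B}(\mathcal H_A)\to{\rm Gr}_{\mathcal H_B}(\mathcal H_A)$ given by $$\delta_\rho([(u,f)])=(\rho(u)\mathcal H_B,\rho(u)f),\qquad \zeta_\rho(uG_B)=\rho(u)\mathcal H_B .$$ Let $\mathcal H^{K_\rho}$ be the reproducing kernel Hilbert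 space of $K_\rho$, generated by the sections $K_\xi=K_\rho(\cdot,\Pi_\rho(\xi))\xi$, $\xi\in D$, with $(K_\eta\mid K_\xi)=(K_\rho(\Pi_\rho(\xi),\Pi_\rho(\eta))\eta\mid\xi)$ (scalar products being linear in the first variable). Put $\widehat K(\xi)=K_\xi$, $\zeta_K(s)=\overline{\widehat K(D_s)}$ and $\delta_K(\xi)=(\zeta_K(\Pi_\rho(\xi)),\widehat K(\xi))$. The kernel is *admissible* if it is smooth as a section of ${\rm Hom}(p_2^*\Pi_\rho,p_1^*\Pi_\rho)$ (where $p_1,p_2$ are the projections of $G_A/G_B\times G_A/G_B$ onto its factors), all the operators $K_\rho(s,s)$ are invertible, and $\zeta_K$ is smooth. If $\zeta_K$ takes its values in ${\rm Gr}_{\mathcal S_0}(\mathcal H^{K_\rho})$, the connection $\Phi_{K_\rho}$ *associated with* $K_\rho$ is the pull-back of the universal connection on $\mathcal T_{\mathcal S_0}(\mathcal H^{K_\rho})$ through $(\delta_K,\zeta_K)$. **Statement.** There is a unique map $\Phi_\rho\colon TD\to TD$ with $$\Phi_\rho\colon[((g,X),(f,h))]\mapsto[((g,0),(f,P({\rm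 d}\rho(X)f)+h))]\qquad(g\in G_A,\ X\in\mathfrak g_A,\ f,h\in\mathcal H_B),$$ and it is a linear connection on $\Pi_\rho$ (the *natural connection*). The universal connection $\Phi_{E_P}$ on $\mathcal T_{\mathcal H_B}(\mathcal H_A)\to{\rm Gr}_{\mathcal H_B}(\mathcal H_A)$ is a well-defined linear connection, its pull-back through $\Delta_\rho$ is defined, and $$\Phi_\rho=(\Delta_\rho)^*(\Phi_{E_P}).$$ Moreover, $\zeta_K$ takes its values in ${\rm Gr}_{\mathcal S_0}(\mathcal H^{K_\rho})$ for some closed subspace $\mathcal S_0\subseteq\mathcal H^{K_\rho}$, the kernel $K_\rho$ is admissible, and, for every such $\mathcal S_0$, the connection associated with $K_\rho$ coincides with the natural connection: $$\Phi_{K_\rho}=\Phi_\rho .$$ -/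

import Mathlib

open scoped Manifold ContDiff Topology
open Set Filter

theorem quadratic_bound_of_contDiffAt {E F : Type*} [NormedAddCommGroup E] [NormedSpace ℝ E]
    [NormedAddCommGroup F] [NormedSpace ℝ F] {f : E → F} {a : E} (hf : ContDiffAt ℝ 2 f a) :
    ∃ C : ℝ, 0 ≤ C ∧ ∀ᶠ x in 𝓝 a, ‖f x - f a - fderiv ℝ f a (x - a)‖ ≤ C * ‖x - a‖ ^ 2 := by
  have h1 : ContDiffAt ℝ 1 (fderiv ℝ f) a := hf.fderiv_right (by norm_num)
  obtain ⟨K, t, ht, hK⟩ := h1.exists_lipschitzOnWith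
  have hd : ∀ᶠ x in 𝓝 a, DifferentiableAt ℝ f x := by
    have := hf.eventually (by simp)
    filter_upwards [this] with x hx using hx.differentiableAt (by norm_num)
  obtain ⟨ε, hε, hball⟩ := Metric.mem_nhds_iff.1 (inter_mem ht hd)
  refine ⟨K, K.2, ?_⟩
  filter_upwards [Metric.ball_mem_nhds a hε] with x hx
  have hseg : segment ℝ a x ⊆ Metric.ball a ε :=
    (convex_ball a ε).segment_subset (Metric.mem_ball_self hε) hx
  have hder : ∀ y ∈ segment ℝ a x, HasFDerivWithinAt (fun y => f y - fderiv ℝ f a y)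
      (fderiv ℝ f y - fderiv ℝ f a) (segment ℝ a x) y := fun y hy =>
    (((hball (hseg hy)).2.hasFDerivAt).sub (fderiv ℝ f a).hasFDerivAt).hasFDerivWithinAt
  have hbound : ∀ y ∈ segment ℝ a x, ‖fderiv ℝ f y - fderiv ℝ f a‖ ≤ K * ‖x - a‖ := by
    intro y hy
    have := hK.norm_sub_le (hball (hseg hy)).1 (mem_of_mem_nhds ht)
    refine this.trans (mul_le_mul_of_nonneg_left ?_ K.2)
    obtain ⟨p, q, hp, hq, hpq, rfl⟩ := hy
    have : p • a + q • x - a = q • (x - a) := by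
      have : p = 1 - q := by linarith
      subst this; module
    rw [this, norm_smul, Real.norm_of_nonneg hq]
    exact mul_le_of_le_one_left (norm_nonneg _) (by linarith)
  have := Convex.norm_image_sub_le_of_norm_hasFDerivWithin_le hder hbound (convex_segment a x)
    (left_mem_segment ℝ a x) (right_mem_segment ℝ a x)
  simp only [map_sub]
  calc _ = ‖f x - fderiv ℝ f a x - (f a - fderiv ℝ f a a)‖ := by congr 1; abel
    _ ≤ _ := this
    _ = _ := by ring

theorem differentiableAt_of_almost_additive {E A : Type*} [NormedAddCommGroup E] [NormedSpace ℝ E]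
    [NormedAddCommGroup A] [NormedSpace ℝ A] [CompleteSpace A] {f : E → A} {K C δ : ℝ} (hC : 0 ≤ C) (hδ : 0 < δ) (h1 : ∀ x, ‖x‖ < δ → ‖f x‖ ≤ K * ‖x‖)
    (h2 : ∀ x y, ‖x‖ < δ → ‖y‖ < δ → ‖f (x + y) - f x - f y‖ ≤ C * (‖x‖ ^ 2 + ‖y‖ ^ 2)) :
    DifferentiableAt ℝ f 0 := by
  have hf0 : f 0 = 0 := by simpa using h1 0 (by simpa)
  -- the scaled sequence
  let s : E → ℕ → A := fun x n => (2 : ℝ) ^ n • f ((2 : ℝ)⁻¹ ^ n • x)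
  have hnorm : ∀ (x : E) (n : ℕ), ‖(2 : ℝ)⁻¹ ^ n • x‖ = (1 / 2) ^ n * ‖x‖ := by
    intro x n; rw [norm_smul]; simp
  have hsmall : ∀ x : E, ∀ᶠ n : ℕ in atTop, ‖(2 : ℝ)⁻¹ ^ n • x‖ < δ := by
    intro x
    have : Tendsto (fun n : ℕ => (1 / 2 : ℝ) ^ n * ‖x‖) atTop (𝓝 (0 * ‖x‖)) :=
      (tendsto_pow_atTop_nhds_zero_of_lt_one (by norm_num) (by norm_num)).mul_const _
    rw [zero_mul] at this
    simp_rw [hnorm]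
    exact this.eventually (gt_mem_nhds hδ)
  have hsmall' : ∀ (x : E) (m n : ℕ), m ≤ n → ‖(2 : ℝ)⁻¹ ^ m • x‖ < δ →
      ‖(2 : ℝ)⁻¹ ^ n • x‖ < δ := by
    intro x m n hmn h
    rw [hnorm] at *
    refine lt_of_le_of_lt (mul_le_mul_of_nonneg_right ?_ (norm_nonneg _)) h
    exact pow_le_pow_of_le_one (by norm_num) (by norm_num) hmn
  have hstep : ∀ (x : E) (n : ℕ), ‖(2 : ℝ)⁻¹ ^ (n + 1) • x‖ < δ →
      dist (s x n) (s x (n + 1)) ≤ (C * ‖x‖ ^ 2 / 2) / 2 ^ n := by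
    intro x n hn
    have e1 : (2 : ℝ)⁻¹ ^ (n + 1) • x + (2 : ℝ)⁻¹ ^ (n + 1) • x = (2 : ℝ)⁻¹ ^ n • x := by
      rw [← add_smul]; congr 1; ring
    have := h2 _ _ hn hn
    rw [e1] at this
    rw [dist_eq_norm]
    have e2 : s x n - s x (n + 1) = (2 : ℝ) ^ n •
        (f ((2 : ℝ)⁻¹ ^ n • x) - f ((2 : ℝ)⁻¹ ^ (n + 1) • x) - f ((2 : ℝ)⁻¹ ^ (n + 1) • x)) := by
      simp only [s, pow_succ, smul_sub, mul_smul, two_smul]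
      simp only [smul_add]; abel
    rw [e2, norm_smul, norm_pow, Real.norm_ofNat]
    refine (mul_le_mul_of_nonneg_left this (by positivity)).trans (le_of_eq ?_)
    rw [hnorm]
    simp only [one_div, inv_pow, pow_succ]
    field_simp
    ring
  have hconv : ∀ x : E, ∃ l, Tendsto (s x) atTop (𝓝 l) := by
    intro x
    obtain ⟨N, hN⟩ := (hsmall x).exists
    have hc : CauchySeq (fun n => s x (n + N)) := by
      refine cauchySeq_of_le_geometric_two (C := (C * ‖x‖ ^ 2 / 2) * 2) (fun n => ?_)
      have := hstep x (n + N) (hsmall' x N _ (by omega) hN)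
      rw [show n + N + 1 = n + 1 + N by ring] at this
      refine this.trans ?_
      rw [mul_div_cancel_right₀ _ (by norm_num : (2 : ℝ) ≠ 0)]
      have : (2 : ℝ) ^ n ≤ 2 ^ (n + N) := pow_le_pow_right₀ (by norm_num) (by omega)
      gcongr
    obtain ⟨l, hl⟩ := cauchySeq_tendsto_of_complete hc
    exact ⟨l, (tendsto_add_atTop_iff_nat N).1 hl⟩
  choose l hl using hconv
  have hadd : ∀ x y, l (x + y) = l x + l y := by
    intro x y
    have : Tendsto (fun n => s (x + y) n - s x n - s y n) atTop (𝓝 0) := by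
      refine squeeze_zero_norm' (a := fun n : ℕ => (1 / 2 : ℝ) ^ n * (C * (‖x‖ ^ 2 + ‖y‖ ^ 2))) ?_ ?_
      · filter_upwards [hsmall x, hsmall y] with n hx hy
        have := h2 _ _ hx hy
        have e2 : s (x + y) n - s x n - s y n = (2 : ℝ) ^ n • (f ((2 : ℝ)⁻¹ ^ n • x +
          (2 : ℝ)⁻¹ ^ n • y) - f ((2 : ℝ)⁻¹ ^ n • x) - f ((2 : ℝ)⁻¹ ^ n • y)) := by
          simp only [s, smul_sub, smul_add]
        rw [e2, norm_smul, norm_pow, Real.norm_ofNat]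
        refine (mul_le_mul_of_nonneg_left this (by positivity)).trans (le_of_eq ?_)
        rw [hnorm, hnorm]
        simp only [one_div, inv_pow]; field_simp
      · have : Tendsto (fun n : ℕ => (1 / 2 : ℝ) ^ n * (C * (‖x‖ ^ 2 + ‖y‖ ^ 2))) atTop
            (𝓝 (0 * (C * (‖x‖ ^ 2 + ‖y‖ ^ 2)))) :=
          (tendsto_pow_atTop_nhds_zero_of_lt_one (by norm_num) (by norm_num)).mul_const _
        simpa using this
    have h' := ((hl (x + y)).sub (hl x)).sub (hl y)
    have := tendsto_nhds_unique h' this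
    rw [sub_sub, sub_eq_zero] at this; exact this
  have hbd : ∀ x, ‖l x‖ ≤ K * ‖x‖ := by
    intro x
    refine le_of_tendsto (hl x).norm ?_
    filter_upwards [hsmall x] with n hn
    simp only [s]
    rw [norm_smul, norm_pow, Real.norm_ofNat]
    refine (mul_le_mul_of_nonneg_left (h1 _ hn) (by positivity)).trans (le_of_eq ?_)
    rw [hnorm]; simp only [one_div, inv_pow]; field_simp
  have happ : ∀ x, ‖x‖ < δ → ‖f x - l x‖ ≤ C * ‖x‖ ^ 2 := by
    intro x hx
    have := dist_le_of_le_geometric_two_of_tendsto₀ (C := C * ‖x‖ ^ 2) (f := s x) (a := l x) (fun n => by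
      have := hstep x n (hsmall' x 0 _ (by omega) (by simpa using hx))
      exact this) (hl x)
    simpa [s, dist_eq_norm] using this
  let lm : E →+ A := ⟨⟨l, by simpa using hbd 0⟩, hadd⟩
  have hcont : Continuous lm := AddMonoidHomClass.continuous_of_bound lm K hbd
  have : HasFDerivAt f (lm.toRealLinearMap hcont) 0 := by
    rw [hasFDerivAt_iff_isLittleO_nhds_zero]
    have hO : (fun h : E => f (0 + h) - f 0 - (lm.toRealLinearMap hcont) h) =O[𝓝 0]
        (fun h : E => ‖h‖ ^ 2) := by
      refine Asymptotics.IsBigO.of_bound C ?_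
      filter_upwards [Metric.ball_mem_nhds (0 : E) hδ] with x hx
      rw [mem_ball_zero_iff] at hx
      have := happ x hx
      rw [zero_add, hf0, sub_zero, Real.norm_of_nonneg (by positivity : 0 ≤ ‖x‖ ^ 2)]
      exact this
    exact hO.trans_isLittleO (Asymptotics.isLittleO_norm_pow_id (n := 2) (by norm_num))
  exact this.differentiableAt

set_option maxHeartbeats 1000000 in
/-- A continuous local homomorphism is differentiable at the unit. -/
theorem differentiableAt_of_local_hom {E A : Type*} [NormedAddCommGroup E] [NormedSpace ℝ E]
    [NormedRing A] [NormedAlgebra ℝ A] [CompleteSpace A] {a : E → A}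
    {m k : E × E → E}
    (hm : ContDiffAt ℝ 2 m (0, 0)) (hk : ContDiffAt ℝ 2 k (0, 0))
    (hm1 : ∀ᶠ x in 𝓝 (0 : E), m (x, 0) = x) (hm2 : ∀ᶠ x in 𝓝 (0 : E), m (0, x) = x)
    (hkk : ∀ᶠ x in 𝓝 (0 : E), k (x, x) = 0)
    (ham : ∀ᶠ p in 𝓝 ((0, 0) : E × E), a (m p) = a p.1 * a p.2)
    (hak : ∀ᶠ p in 𝓝 ((0, 0) : E × E), a p.2 = a p.1 * a (k p))
    (ha0 : a 0 = 1) (hac : ContinuousAt a 0) : DifferentiableAt ℝ a 0 := by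
  have hm0 : m (0, 0) = 0 := hm1.self_of_nhds
  have hk0 : k (0, 0) = 0 := hkk.self_of_nhds
  -- the derivative of the product at the unit is the sum
  have hmd : HasFDerivAt m (fderiv ℝ m (0, 0)) (0, 0) :=
    (hm.differentiableAt (by norm_num)).hasFDerivAt
  have hd1 : ∀ x, fderiv ℝ m (0, 0) (x, 0) = x := by
    have h1 : HasFDerivAt (fun x : E => m (x, 0)) ((fderiv ℝ m (0, 0)).comp
        (ContinuousLinearMap.inl ℝ E E)) 0 :=
      HasFDerivAt.comp (g := m) (f := fun x : E => (x, (0 : E))) 0 hmd (hasFDerivAt_prodMk_left 0 0)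
    have h2 : HasFDerivAt (fun x : E => m (x, 0)) (ContinuousLinearMap.id ℝ E) 0 :=
      (hasFDerivAt_id (0 : E)).congr_of_eventuallyEq hm1
    intro x
    simpa using congrArg (fun L => L x) (h1.unique h2)
  have hd2 : ∀ x, fderiv ℝ m (0, 0) (0, x) = x := by
    have h1 : HasFDerivAt (fun x : E => m (0, x)) ((fderiv ℝ m (0, 0)).comp
        (ContinuousLinearMap.inr ℝ E E)) 0 :=
      HasFDerivAt.comp (g := m) (f := fun x : E => ((0 : E), x)) 0 hmd (hasFDerivAt_prodMk_right 0 0)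
    have h2 : HasFDerivAt (fun x : E => m (0, x)) (ContinuousLinearMap.id ℝ E) 0 :=
      (hasFDerivAt_id (0 : E)).congr_of_eventuallyEq hm2
    intro x
    simpa using congrArg (fun L => L x) (h1.unique h2)
  have hd : ∀ x y, fderiv ℝ m (0, 0) (x, y) = x + y := by
    intro x y
    have : ((x, y) : E × E) = (x, 0) + (0, y) := by simp
    rw [this, map_add, hd1, hd2]
  obtain ⟨C, hC, hCm⟩ := quadratic_bound_of_contDiffAt hm
  obtain ⟨L, t, ht, hL⟩ := (hk.of_le (by norm_num : (1 : ℕ∞ω) ≤ 2)).exists_lipschitzOnWith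
  -- a common radius
  have hsmall : ∀ᶠ x in 𝓝 (0 : E), ‖a x - 1‖ ≤ 1 / 2 := by
    have : Tendsto (fun x => ‖a x - 1‖) (𝓝 0) (𝓝 0) := by
      have := (hac.sub_const 1).norm
      simpa [ContinuousAt, ha0] using this
    exact this.eventually (ge_mem_nhds (by norm_num))
  have hkc : Tendsto k (𝓝 (0, 0)) (𝓝 0) := by simpa [ContinuousAt, hk0] using hk.continuousAt
  have hmc : Tendsto m (𝓝 (0, 0)) (𝓝 0) := by simpa [ContinuousAt, hm0] using hm.continuousAt
  obtain ⟨r0, hr0, hr⟩ := Metric.mem_nhds_iff.1 (hCm.and (ham.and (hak.and ht)))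
  have hpair : ∀ {x y : E}, ‖x‖ < r0 → ‖y‖ < r0 → ((x, y) : E × E) ∈ Metric.ball (0, 0) r0 := by
    intro x y hx hy
    rw [← Prod.zero_eq_mk, mem_ball_zero_iff, Prod.norm_def]; exact max_lt hx hy
  obtain ⟨r1, hr1, hr'⟩ := Metric.mem_nhds_iff.1 (hsmall.and hkk)
  have hkr := hkc.eventually (Metric.ball_mem_nhds 0 hr1)
  obtain ⟨r2, hr2, hr''⟩ := Metric.mem_nhds_iff.1 hkr
  have key1 : ∀ x y : E, ‖x‖ < r0 → ‖y‖ < r0 → ‖m (x, y) - (x + y)‖ ≤ C * (‖x‖ ^ 2 + ‖y‖ ^ 2) := by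
    intro x y hx hy
    have := (hr (hpair hx hy)).1
    rw [hm0, ← Prod.zero_eq_mk, sub_zero, sub_zero, Prod.zero_eq_mk, hd] at this
    refine this.trans (mul_le_mul_of_nonneg_left ?_ hC)
    rw [Prod.norm_def]
    rcases max_choice ‖x‖ ‖y‖ with h | h <;> simp only [h] <;> nlinarith [sq_nonneg ‖x‖, sq_nonneg ‖y‖]
  set δ := min r0 (min r1 r2) with hδ
  have hδ0 : 0 < δ := by positivity
  have key2 : ∀ x, ‖x‖ < δ → ‖a x - 1‖ ≤ 1 / 2 := fun x hx =>
    (hr' (by rw [mem_ball_zero_iff]; exact hx.trans_le ((min_le_right _ _).trans (min_le_left _ _)))).1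
  -- Lipschitz bound at the unit, by repeated squaring
  set δ1 := min (δ / 4) (1 / (8 * (C + 1))) with hδ1
  have hδ10 : 0 < δ1 := by positivity
  have hδ1C : δ1 * (C + 1) ≤ 1 / 8 := by
    calc δ1 * (C + 1) ≤ 1 / (8 * (C + 1)) * (C + 1) :=
          mul_le_mul_of_nonneg_right (min_le_right _ _) (by positivity)
      _ = 1 / 8 := by field_simp
  let u : E → ℝ := fun x => -Real.log (1 - ‖a x - 1‖)
  let w : ℝ → ℝ := fun r => r / (1 + C * r)
  obtain ⟨B, hB0, hB⟩ : ∃ B : ℝ, 0 ≤ B ∧ ∀ x, ‖x‖ < δ1 → u x ≤ B * w ‖x‖ := by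
    have hwm : ∀ {r s : ℝ}, 0 ≤ r → r ≤ s → w r ≤ w s := by
      intro r s h0 h
      simp only [w]
      rw [div_le_div_iff₀ (by positivity) (by have := h0.trans h; positivity)]
      nlinarith
    have hu1 : ∀ x, ‖x‖ < δ → u x ≤ Real.log 2 := by
      intro x hx
      have := key2 x hx
      simp only [u]
      rw [neg_le, ← Real.log_inv]
      exact Real.log_le_log (by norm_num) (by norm_num; linarith)
    have hdouble : ∀ x, ‖x‖ < δ1 → 2 * u x ≤ u (m (x, x)) ∧ ‖m (x, x)‖ ≤ 2 * ‖x‖ + 2 * C * ‖x‖ ^ 2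
        ∧ 3 / 2 * ‖x‖ ≤ ‖m (x, x)‖ ∧ ‖m (x, x)‖ < δ := by
      intro x hx
      have hxδ4 : ‖x‖ < δ / 4 := hx.trans_le (min_le_left _ _)
      have hxδ : ‖x‖ < δ := by linarith
      have hxr : ‖x‖ < r0 := hxδ.trans_le (min_le_left _ _)
      have h1 := key1 x x hxr hxr
      have h2x : ‖x + x‖ = 2 * ‖x‖ := by rw [← two_smul ℝ x, norm_smul]; simp
      have hCx : C * ‖x‖ ≤ 1 / 8 := by nlinarith [norm_nonneg x]
      have hup : ‖m (x, x)‖ ≤ 2 * ‖x‖ + 2 * C * ‖x‖ ^ 2 := by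
        have := norm_le_norm_add_norm_sub' (m (x, x)) (x + x)
        rw [h2x] at this; linarith
      have hlo : 3 / 2 * ‖x‖ ≤ ‖m (x, x)‖ := by
        have := norm_le_norm_add_norm_sub' (x + x) (m (x, x))
        rw [h2x, norm_sub_rev] at this; nlinarith [norm_nonneg x]
      have hlt : ‖m (x, x)‖ < δ := by nlinarith [norm_nonneg x]
      refine ⟨?_, hup, hlo, hlt⟩
      have hmul := (hr (hpair hxr hxr)).2.1
      simp only at hmul
      have h3 := key2 x hxδ
      have h4 := key2 _ hlt
      have e : a (m (x, x)) - 1 = (2 : ℝ) • (a x - 1) + (a x - 1) * (a x - 1) := by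
        rw [hmul, two_smul]; noncomm_ring
      have h5 : 2 * ‖a x - 1‖ ≤ ‖a (m (x, x)) - 1‖ + ‖a x - 1‖ * ‖a x - 1‖ := by
        have : (2 : ℝ) • (a x - 1) = (a (m (x, x)) - 1) - (a x - 1) * (a x - 1) := by
          rw [e]; abel
        calc 2 * ‖a x - 1‖ = ‖(2 : ℝ) • (a x - 1)‖ := by rw [norm_smul]; simp
          _ ≤ _ := by rw [this]; exact (norm_sub_le _ _).trans (by gcongr; exact norm_mul_le _ _)
      have h6 : Real.log (1 - ‖a (m (x, x)) - 1‖) ≤ Real.log ((1 - ‖a x - 1‖) ^ 2) :=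
        Real.log_le_log (by linarith) (by nlinarith)
      rw [Real.log_pow] at h6
      simp only [u]; push_cast at h6; linarith
    set B := Real.log 2 / w (δ1 / 3) with hB
    have hw0 : 0 < w (δ1 / 3) := by simp only [w]; positivity
    have hB0 : 0 ≤ B := div_nonneg (Real.log_nonneg (by norm_num)) hw0.le
    refine ⟨B, hB0, ?_⟩
    have hind : ∀ n : ℕ, ∀ x, ‖x‖ < δ1 → δ1 / 3 * (2 / 3) ^ n ≤ ‖x‖ → u x ≤ B * w ‖x‖ := by
      have hlarge : ∀ x, ‖x‖ < δ1 → δ1 / 3 ≤ ‖x‖ → u x ≤ B * w ‖x‖ := by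
        intro x hx hx'
        refine (hu1 x ?_).trans ?_
        · exact hx.trans_le ((min_le_left _ _).trans (by linarith))
        · calc Real.log 2 = B * w (δ1 / 3) := by rw [hB]; field_simp
            _ ≤ _ := mul_le_mul_of_nonneg_left (hwm (by positivity) hx') hB0
      intro n
      induction n with
      | zero => intro x hx hx'; exact hlarge x hx (by simpa using hx')
      | succ n ih =>
        intro x hx hx'
        by_cases hcase : δ1 / 3 ≤ ‖x‖
        · exact hlarge x hx hcase
        push Not at hcase
        obtain ⟨hu2, hup, hlo, -⟩ := hdouble x hx
        have hCx : C * ‖x‖ ≤ 1 / 8 := by nlinarith [norm_nonneg x]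
        have h1 : ‖m (x, x)‖ < δ1 := by nlinarith [norm_nonneg x]
        have h2 : δ1 / 3 * (2 / 3) ^ n ≤ ‖m (x, x)‖ := by
          rw [pow_succ] at hx'; linarith
        have h3 := ih _ h1 h2
        have h4 : w ‖m (x, x)‖ ≤ 2 * w ‖x‖ := by
          refine (hwm (norm_nonneg _) hup).trans ?_
          simp only [w]
          rw [mul_div, div_le_div_iff₀ (by positivity) (by positivity)]
          nlinarith [norm_nonneg x, mul_nonneg hC (norm_nonneg x),
            mul_nonneg (mul_nonneg hC hC) (pow_nonneg (norm_nonneg x) 3)]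
        nlinarith
    intro x hx
    by_cases hx0 : x = 0
    · subst hx0; simp [u, w, ha0]
    · have : Tendsto (fun n : ℕ => δ1 / 3 * (2 / 3 : ℝ) ^ n) atTop (𝓝 (δ1 / 3 * 0)) :=
        (tendsto_pow_atTop_nhds_zero_of_lt_one (by norm_num) (by norm_num)).const_mul _
      rw [mul_zero] at this
      obtain ⟨n, hn⟩ := (this.eventually (ge_mem_nhds (norm_pos_iff.2 hx0))).exists
      exact hind n x hx hn
  have key3 : ∀ x, ‖x‖ < δ1 → ‖a x - 1‖ ≤ B * ‖x‖ := by
    intro x hx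
    have h1 := hB x hx
    have h2 := key2 x (hx.trans_le ((min_le_left _ _).trans (by linarith)))
    have h3 := Real.log_le_sub_one_of_pos (x := 1 - ‖a x - 1‖) (by linarith)
    have h4 : w ‖x‖ ≤ ‖x‖ := div_le_self (norm_nonneg _) (by nlinarith [norm_nonneg x])
    simp only [u] at h1
    nlinarith
  -- Lipschitz bound near the unit
  have hkr1 := hkc.eventually (Metric.ball_mem_nhds 0 hδ10)
  obtain ⟨r3, hr3, hr3'⟩ := Metric.mem_nhds_iff.1 hkr1
  set δ2 := min δ1 r3 with hδ2
  have hδ1δ : δ1 ≤ δ := (min_le_left _ _).trans (by linarith)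
  set N : ℝ := ‖(1 : A)‖ + 1 / 2 with hN
  have hN0 : 0 ≤ N := by positivity
  have key4 : ∀ x y, ‖x‖ < δ2 → ‖y‖ < δ2 → ‖a y - a x‖ ≤ N * (B * (L * ‖y - x‖)) := by
    intro x y hx hy
    have hx1 := hx.trans_le (min_le_left δ1 r3)
    have hy1 := hy.trans_le (min_le_left δ1 r3)
    have hx0 := (hx1.trans_le hδ1δ).trans_le (min_le_left _ _)
    have hy0 := (hy1.trans_le hδ1δ).trans_le (min_le_left _ _)
    have h1 := (hr (hpair hx0 hy0)).2.2.1
    simp only at h1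
    have h2 : k (x, x) = 0 := (hr' (by
      rw [mem_ball_zero_iff]
      exact (hx1.trans_le hδ1δ).trans_le ((min_le_right _ _).trans (min_le_left _ _)))).2
    have h3 := hL.norm_sub_le (hr (hpair hx0 hy0)).2.2.2 (hr (hpair hx0 hx0)).2.2.2
    rw [h2, sub_zero, Prod.mk_sub_mk, sub_self, Prod.norm_def, norm_zero,
      max_eq_right (norm_nonneg _)] at h3
    have h4 : ‖k (x, y)‖ < δ1 := by
      have : ((x, y) : E × E) ∈ Metric.ball (0, 0) r3 := by
        rw [← Prod.zero_eq_mk, mem_ball_zero_iff, Prod.norm_def]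
        exact max_lt (hx.trans_le (min_le_right _ _)) (hy.trans_le (min_le_right _ _))
      have := hr3' this
      rwa [mem_ofPred_eq, dist_zero_right] at this
    have h5 := key3 _ h4
    have h6 : ‖a x‖ ≤ N := by
      have := key2 x (hx1.trans_le hδ1δ)
      have h := norm_le_norm_add_norm_sub' (a x) 1
      simp only [hN]; linarith
    have e : a y - a x = a x * (a (k (x, y)) - 1) := by rw [h1]; noncomm_ring
    rw [e]
    refine (norm_mul_le _ _).trans (mul_le_mul h6 ?_ (norm_nonneg _) hN0)
    exact h5.trans (mul_le_mul_of_nonneg_left h3 hB0)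
  -- conclude
  have hδ20 : 0 < δ2 := by positivity
  set δ3 := min (δ2 / 4) (1 / (8 * (C + 1))) with hδ3
  have hδ30 : 0 < δ3 := by positivity
  have hδ3C : δ3 * (C + 1) ≤ 1 / 8 := by
    calc δ3 * (C + 1) ≤ 1 / (8 * (C + 1)) * (C + 1) :=
          mul_le_mul_of_nonneg_right (min_le_right _ _) (by positivity)
      _ = 1 / 8 := by field_simp
  have hδ3δ2 : δ3 ≤ δ2 / 4 := min_le_left _ _
  have hδ21 : δ2 ≤ δ1 := min_le_left _ _
  have hfin : DifferentiableAt ℝ (fun x => a x - 1) 0 := by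
    refine differentiableAt_of_almost_additive (K := B) (C := N * (B * (L * C)) + B * B) (δ := δ3)
      (by positivity) hδ30 (fun x hx => key3 x (by linarith)) ?_
    intro x y hx hy
    have hx0 : ‖x‖ < r0 := lt_of_lt_of_le (by linarith) (min_le_left r0 (min r1 r2))
    have hy0 : ‖y‖ < r0 := lt_of_lt_of_le (by linarith) (min_le_left r0 (min r1 r2))
    have h1 := key1 x y hx0 hy0
    have hmul := (hr (hpair hx0 hy0)).2.1
    simp only at hmul
    have hxy : ‖x + y‖ < δ2 := (norm_add_le _ _).trans_lt (by linarith)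
    have hCx : C * ‖x‖ ≤ 1 / 8 := by nlinarith [norm_nonneg x]
    have hCy : C * ‖y‖ ≤ 1 / 8 := by nlinarith [norm_nonneg y]
    have hmxy : ‖m (x, y)‖ < δ2 := by
      have h := norm_le_norm_add_norm_sub' (m (x, y)) (x + y)
      have h' := norm_add_le x y
      nlinarith [norm_nonneg x, norm_nonneg y]
    have h2 := key4 _ _ hmxy hxy
    rw [norm_sub_rev (x + y)] at h2
    have h3 := key3 x (by linarith)
    have h4 := key3 y (by linarith)
    have e : a (x + y) - 1 - (a x - 1) - (a y - 1) =
        (a (x + y) - a (m (x, y))) + (a x - 1) * (a y - 1) := by rw [hmul]; noncomm_ring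
    rw [e]
    refine (norm_add_le _ _).trans ?_
    have h5 : ‖(a x - 1) * (a y - 1)‖ ≤ B * B * (‖x‖ ^ 2 + ‖y‖ ^ 2) := by
      refine (norm_mul_le _ _).trans ?_
      calc ‖a x - 1‖ * ‖a y - 1‖ ≤ (B * ‖x‖) * (B * ‖y‖) :=
            mul_le_mul h3 h4 (norm_nonneg _) (by positivity)
        _ = B * B * (‖x‖ * ‖y‖) := by ring
        _ ≤ _ := mul_le_mul_of_nonneg_left (by nlinarith [sq_nonneg (‖x‖ - ‖y‖)]) (by positivity)
    have h6 : N * (B * (L * ‖m (x, y) - (x + y)‖)) ≤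
        N * (B * (L * (C * (‖x‖ ^ 2 + ‖y‖ ^ 2)))) := by gcongr
    nlinarith
  simpa using hfin.add_const 1

section ContinuousHom

variable {E : Type*} [NormedAddCommGroup E] [NormedSpace ℝ E]
  {G : Type*} [TopologicalSpace G] [ChartedSpace E G] [Group G] [LieGroup 𝓘(ℝ, E) ∞ G]
  {A : Type*} [NormedRing A] [NormedAlgebra ℝ A] [CompleteSpace A]

/-- A norm-continuous representation of a Banach-Lie group is smooth. -/
theorem contMDiff_of_continuous_hom (ρ : G →* A) (hρ : Continuous ρ) :
    ContMDiff 𝓘(ℝ, E) 𝓘(ℝ, A) ∞ ρ := by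
  set φ := chartAt E (1 : G) with hφ
  set c : E := φ 1 with hc
  have hφs : φ.source ∈ 𝓝 (1 : G) := chart_source_mem_nhds E 1
  have h1s : (1 : G) ∈ φ.source := mem_chart_source E 1
  have hct : c ∈ φ.target := mem_chart_target E 1
  have hφmax : φ ∈ IsManifold.maximalAtlas 𝓘(ℝ, E) ∞ G := IsManifold.chart_mem_maximalAtlas 1
  have hsm : ContMDiffOn 𝓘(ℝ, E) 𝓘(ℝ, E) ∞ φ φ.source := contMDiffOn_of_mem_maximalAtlas hφmax
  have hsm' : ContMDiffOn 𝓘(ℝ, E) 𝓘(ℝ, E) ∞ φ.symm φ.target :=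
    contMDiffOn_symm_of_mem_maximalAtlas hφmax
  let ψ : E → G := fun x => φ.symm (c + x)
  have hψ0 : ψ 0 = 1 := by simp [ψ, c, φ.left_inv h1s]
  have hψsm : ContMDiffAt 𝓘(ℝ, E) 𝓘(ℝ, E) ∞ ψ 0 := by
    have h1 : ContMDiffAt 𝓘(ℝ, E) 𝓘(ℝ, E) ∞ φ.symm (c + 0) := by
      rw [add_zero]; exact hsm'.contMDiffAt (φ.open_target.mem_nhds hct)
    exact h1.comp (0 : E) ((contDiff_const.add contDiff_id).contMDiff.contMDiffAt)
  have hψc : ContinuousAt ψ 0 := hψsm.continuousAt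
  have hψt : ∀ᶠ x in 𝓝 (0 : E), c + x ∈ φ.target := by
    have : Tendsto (fun x : E => c + x) (𝓝 0) (𝓝 (c + 0)) :=
      (continuous_const.add continuous_id).continuousAt
    rw [add_zero] at this
    exact this.eventually (φ.open_target.mem_nhds hct)
  have hφψ : ∀ᶠ x in 𝓝 (0 : E), φ (ψ x) - c = x := by
    filter_upwards [hψt] with x hx
    simp [ψ, φ.right_inv hx]
  let m : E × E → E := fun p => φ (ψ p.1 * ψ p.2) - c
  let k : E × E → E := fun p => φ ((ψ p.1)⁻¹ * ψ p.2) - c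
  have hφsub : ContMDiffAt 𝓘(ℝ, E) 𝓘(ℝ, E) ∞ (fun g => φ g - c) 1 := by
    have : ContMDiffAt 𝓘(ℝ, E) 𝓘(ℝ, E) ∞ φ 1 := hsm.contMDiffAt hφs
    exact ((contDiff_id.sub contDiff_const).contMDiff.contMDiffAt (x := φ 1)).comp (1 : G) this
  have hp1 : ContMDiffAt 𝓘(ℝ, E × E) 𝓘(ℝ, E) ∞ (fun p : E × E => ψ p.1) (0, 0) :=
    ContMDiffAt.comp (0, 0) (g := ψ) (f := Prod.fst) hψsm contDiff_fst.contMDiff.contMDiffAt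
  have hp2 : ContMDiffAt 𝓘(ℝ, E × E) 𝓘(ℝ, E) ∞ (fun p : E × E => ψ p.2) (0, 0) :=
    ContMDiffAt.comp (0, 0) (g := ψ) (f := Prod.snd) hψsm contDiff_snd.contMDiff.contMDiffAt
  have hmm : ContMDiffAt 𝓘(ℝ, E × E) 𝓘(ℝ, E) ∞ (fun p : E × E => ψ p.1 * ψ p.2) (0, 0) :=
    hp1.mul hp2
  have hkk' : ContMDiffAt 𝓘(ℝ, E × E) 𝓘(ℝ, E) ∞ (fun p : E × E => (ψ p.1)⁻¹ * ψ p.2) (0, 0) :=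
    hp1.inv.mul hp2
  have hm : ContDiffAt ℝ ∞ m (0, 0) := by
    rw [← contMDiffAt_iff_contDiffAt]
    refine ContMDiffAt.comp (0, 0) (g := fun g => φ g - c) (f := fun p : E × E => ψ p.1 * ψ p.2)
      ?_ hmm
    simpa [hψ0] using hφsub
  have hk : ContDiffAt ℝ ∞ k (0, 0) := by
    rw [← contMDiffAt_iff_contDiffAt]
    refine ContMDiffAt.comp (0, 0) (g := fun g => φ g - c)
      (f := fun p : E × E => (ψ p.1)⁻¹ * ψ p.2) ?_ hkk'
    simpa [hψ0] using hφsub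
  let a : E → A := fun x => ρ (ψ x)
  have hψφ : ∀ᶠ g in 𝓝 (1 : G), ψ (φ g - c) = g := by
    filter_upwards [hφs] with g hg
    simp [ψ, φ.left_inv hg]
  have ham : ∀ᶠ p in 𝓝 ((0, 0) : E × E), a (m p) = a p.1 * a p.2 := by
    have : Tendsto (fun p : E × E => ψ p.1 * ψ p.2) (𝓝 (0, 0)) (𝓝 1) := by
      simpa [ContinuousAt, hψ0] using hmm.continuousAt
    filter_upwards [this.eventually hψφ] with p hp
    simp only [a, m, hp, map_mul]
  have hak : ∀ᶠ p in 𝓝 ((0, 0) : E × E), a p.2 = a p.1 * a (k p) := by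
    have : Tendsto (fun p : E × E => (ψ p.1)⁻¹ * ψ p.2) (𝓝 (0, 0)) (𝓝 1) := by
      simpa [ContinuousAt, hψ0] using hkk'.continuousAt
    filter_upwards [this.eventually hψφ] with p hp
    simp only [a, k, hp, ← map_mul, mul_inv_cancel_left]
  have ha0 : a 0 = 1 := by simp [a, hψ0]
  have hac : ContinuousAt a 0 := hρ.continuousAt.comp hψc
  have hkx : ∀ x, k (x, x) = 0 := fun x => by simp [k, hc]
  have hdiff : DifferentiableAt ℝ a 0 :=
    differentiableAt_of_local_hom (m := m) (k := k) (hm.of_le ENat.LEInfty.out)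
      (hk.of_le ENat.LEInfty.out)
      (by simpa [m, hψ0] using hφψ) (by simpa [m, hψ0] using hφψ)
      (Eventually.of_forall hkx) ham hak ha0 hac
  -- regularity near the unit, by induction on the order
  have hk' : ∀ᶠ p in 𝓝 ((0, 0) : E × E), a p.2 = a p.1 * a (k p) := hak
  obtain ⟨r, hr, hball⟩ : ∃ r > 0, ∀ x ∈ Metric.ball (0 : E) r, ∀ y ∈ Metric.ball (0 : E) r,
      ContDiffAt ℝ ∞ k (x, y) ∧ a y = a x * a (k (x, y)) := by
    have hev : ∀ᶠ p in 𝓝 ((0, 0) : E × E), ContDiffAt ℝ ∞ k p := by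
      have h := hmm
      -- smoothness of the division map on a neighbourhood
      have hψev : ∀ᶠ x in 𝓝 (0 : E), ContMDiffAt 𝓘(ℝ, E) 𝓘(ℝ, E) ∞ ψ x := by
        filter_upwards [hψt] with x hx
        exact ContMDiffAt.comp x (g := φ.symm) (f := fun x => c + x)
          (hsm'.contMDiffAt (φ.open_target.mem_nhds hx))
          ((contDiff_const.add contDiff_id).contMDiff.contMDiffAt)
      have hsrc : ∀ᶠ p in 𝓝 ((0, 0) : E × E), (ψ p.1)⁻¹ * ψ p.2 ∈ φ.source := by
        have : Tendsto (fun p : E × E => (ψ p.1)⁻¹ * ψ p.2) (𝓝 (0, 0)) (𝓝 1) := by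
          simpa [ContinuousAt, hψ0] using hkk'.continuousAt
        exact this.eventually hφs
      have e1 : ∀ᶠ p in 𝓝 ((0, 0) : E × E), ContMDiffAt 𝓘(ℝ, E) 𝓘(ℝ, E) ∞ ψ p.1 :=
        (continuous_fst.tendsto ((0, 0) : E × E)).eventually hψev
      have e2 : ∀ᶠ p in 𝓝 ((0, 0) : E × E), ContMDiffAt 𝓘(ℝ, E) 𝓘(ℝ, E) ∞ ψ p.2 :=
        (continuous_snd.tendsto ((0, 0) : E × E)).eventually hψev
      filter_upwards [e1, e2, hsrc] with p h1 h2 h3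
      rw [← contMDiffAt_iff_contDiffAt]
      have q1 : ContMDiffAt 𝓘(ℝ, E × E) 𝓘(ℝ, E) ∞ (fun p : E × E => ψ p.1) p :=
        ContMDiffAt.comp p (g := ψ) (f := Prod.fst) h1 contDiff_fst.contMDiff.contMDiffAt
      have q2 : ContMDiffAt 𝓘(ℝ, E × E) 𝓘(ℝ, E) ∞ (fun p : E × E => ψ p.2) p :=
        ContMDiffAt.comp p (g := ψ) (f := Prod.snd) h2 contDiff_snd.contMDiff.contMDiffAt
      have q3 : ContMDiffAt 𝓘(ℝ, E) 𝓘(ℝ, E) ∞ (fun g => φ g - c) ((ψ p.1)⁻¹ * ψ p.2) :=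
        ((contDiff_id.sub contDiff_const).contMDiff.contMDiffAt (x := φ _)).comp _
          (hsm.contMDiffAt (φ.open_source.mem_nhds h3))
      exact ContMDiffAt.comp p (g := fun g => φ g - c) (f := fun p : E × E => (ψ p.1)⁻¹ * ψ p.2)
        q3 (q1.inv.mul q2)
    obtain ⟨r, hr, h⟩ := Metric.mem_nhds_iff.1 (hev.and hak)
    refine ⟨r, hr, fun x hx y hy => h ?_⟩
    rw [mem_ball_zero_iff] at hx hy
    rw [← Prod.zero_eq_mk, mem_ball_zero_iff, Prod.norm_def]; exact max_lt hx hy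
  let D : E → E →L[ℝ] A := fun x =>
    (ContinuousLinearMap.mul ℝ A (a x)).comp ((fderiv ℝ a 0).comp
      (fderiv ℝ (fun y => k (x, y)) x))
  have hD : ∀ x ∈ Metric.ball (0 : E) r, HasFDerivAt a (D x) x := by
    intro x hx
    have h1 : HasFDerivAt (fun y => k (x, y)) (fderiv ℝ (fun y => k (x, y)) x) x := by
      have : ContDiffAt ℝ ∞ (fun y => k (x, y)) x :=
        ContDiffAt.comp x (g := k) (f := fun y => (x, y)) (hball x hx x hx).1
          (contDiffAt_const.prodMk contDiffAt_id)
      exact (this.differentiableAt (by simp)).hasFDerivAt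
    have h2 : HasFDerivAt a (fderiv ℝ a 0) (k (x, x)) := by rw [hkx]; exact hdiff.hasFDerivAt
    have h3 := ((ContinuousLinearMap.mul ℝ A (a x)).hasFDerivAt).comp x
      (HasFDerivAt.comp (g := a) (f := fun y => k (x, y)) x h2 h1)
    refine h3.congr_of_eventuallyEq ?_
    filter_upwards [Metric.isOpen_ball.mem_nhds hx] with y hy
    exact (hball x hx y hy).2
  have hDk : ContDiffOn ℝ ∞ (fun x => fderiv ℝ (fun y => k (x, y)) x) (Metric.ball 0 r) := by
    intro x hx
    refine ContDiffAt.contDiffWithinAt ?_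
    exact ContDiffAt.fderiv (f := fun x y => k (x, y)) (g := fun x => x) (n := ∞) (m := ∞)
      (hball x hx x hx).1 contDiffAt_id (by simp)
  have hn : ∀ n : ℕ, ContDiffOn ℝ n a (Metric.ball 0 r) := by
    intro n
    induction n with
    | zero =>
      rw [Nat.cast_zero, contDiffOn_zero]
      exact fun x hx => (hD x hx).continuousAt.continuousWithinAt
    | succ n ih =>
      rw [Nat.cast_succ, contDiffOn_succ_iff_fderiv_of_isOpen Metric.isOpen_ball]
      refine ⟨fun x hx => (hD x hx).differentiableAt.differentiableWithinAt, by simp, ?_⟩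
      have : ContDiffOn ℝ n D (Metric.ball 0 r) := by
        refine ContDiffOn.clm_comp ?_ (contDiffOn_const.clm_comp
          (hDk.of_le (mod_cast le_top)))
        exact (ContinuousLinearMap.contDiff (ContinuousLinearMap.mul ℝ A)).comp_contDiffOn ih
      exact this.congr fun x hx => (hD x hx).fderiv
  have hinf : ContDiffOn ℝ ∞ a (Metric.ball 0 r) := contDiffOn_infty.2 hn
  -- smoothness at the unit and then everywhere
  have hone : ContMDiffAt 𝓘(ℝ, E) 𝓘(ℝ, A) ∞ ρ 1 := by
    have h1 : ContMDiffAt 𝓘(ℝ, E) 𝓘(ℝ, A) ∞ a (φ 1 - c) := by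
      rw [contMDiffAt_iff_contDiffAt, ← hc, sub_self]
      exact hinf.contDiffAt (Metric.ball_mem_nhds 0 hr)
    have h2 := ContMDiffAt.comp (1 : G) (g := a) (f := fun g => φ g - c) h1 hφsub
    refine h2.congr_of_eventuallyEq ?_
    filter_upwards [hψφ] with g hg
    simp only [Function.comp, a, hg]
  intro g
  have h1 : ContMDiffAt 𝓘(ℝ, E) 𝓘(ℝ, A) ∞ (fun h => ρ (g⁻¹ * h)) g := by
    refine ContMDiffAt.comp g (g := ρ) (f := fun h => g⁻¹ * h) ?_
      (contMDiff_mul_left (a := g⁻¹)).contMDiffAt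
    simpa using hone
  have h2 : ContMDiffAt 𝓘(ℝ, E) 𝓘(ℝ, A) ∞ (fun h => ρ g * ρ (g⁻¹ * h)) g :=
    ContMDiffAt.comp g (g := fun x => ρ g * x) (f := fun h => ρ (g⁻¹ * h))
      (contDiff_const.mul contDiff_id).contMDiff.contMDiffAt h1
  refine h2.congr_of_eventuallyEq (Eventually.of_forall fun h => ?_)
  simp [← map_mul]

end ContinuousHom

section QuotientManifold

variable {E : Type*} [NormedAddCommGroup E] [NormedSpace ℝ E]
  {G : Type*} [TopologicalSpace G] [ChartedSpace E G] [Group G]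

/-- A Banach-Lie subgroup of a Banach-Lie group: a subgroup which is a split submanifold, i.e.
in a suitable chart at the unit it is given by a complemented closed subspace (by left translation
there are then such charts at all its points). -/
class IsBanachLieSubgroup (B : Subgroup G) : Prop where
  exists_chart : ∃ F m : Submodule ℝ E, F.IsTopCompl m ∧
    ∃ φ ∈ IsManifold.maximalAtlas 𝓘(ℝ, E) ∞ G, (1 : G) ∈ φ.source ∧ φ 1 = 0 ∧
      ∀ g ∈ φ.source, g ∈ B ↔ φ g ∈ F

/-- A smooth slice at the unit for the right action of a subgroup `B`: a smooth map `σ` on an open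
neighbourhood `V` of `0` in a closed complement of the Lie algebra of `B` such that
`V × B → Ω = σ(V)B`, `(x, b) ↦ σ(x)b`, is a bijection onto an open set, with smooth first component
`r` of the inverse. -/
structure QuotientSlice (E : Type*) [NormedAddCommGroup E] [NormedSpace ℝ E]
    {G : Type*} [TopologicalSpace G] [ChartedSpace E G] [Group G] (B : Subgroup G) where
  m : Submodule ℝ E
  V : Set m
  Ω : Set G
  σ : m → G
  r : G → m
  isOpen_V : IsOpen V
  isOpen_Ω : IsOpen Ω
  one_mem : (1 : G) ∈ Ω
  contMDiffOn_σ : ContMDiffOn 𝓘(ℝ, m) 𝓘(ℝ, E) ∞ σ V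
  contMDiffOn_r : ContMDiffOn 𝓘(ℝ, E) 𝓘(ℝ, m) ∞ r Ω
  σ_mem : ∀ x ∈ V, σ x ∈ Ω
  r_mem : ∀ g ∈ Ω, r g ∈ V
  r_σ : ∀ x ∈ V, r (σ x) = x
  σ_r : ∀ g ∈ Ω, (σ (r g))⁻¹ * g ∈ B
  mul_mem : ∀ g ∈ Ω, ∀ b ∈ B, g * b ∈ Ω
  r_mul : ∀ g ∈ Ω, ∀ b ∈ B, r (g * b) = r g

theorem nonempty_quotientSlice [CompleteSpace E] [LieGroup 𝓘(ℝ, E) ∞ G] (B : Subgroup G)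
    [h : IsBanachLieSubgroup (E := E) B] : Nonempty (QuotientSlice E B) := by
  obtain ⟨F, m, hFm, φ, hφmax, h1s, hφ1, hφB⟩ := h.exists_chart
  have hsm : ContMDiffOn 𝓘(ℝ, E) 𝓘(ℝ, E) ∞ φ φ.source := contMDiffOn_of_mem_maximalAtlas hφmax
  have hsm' : ContMDiffOn 𝓘(ℝ, E) 𝓘(ℝ, E) ∞ φ.symm φ.target :=
    contMDiffOn_symm_of_mem_maximalAtlas hφmax
  have h0t : (0 : E) ∈ φ.target := hφ1 ▸ φ.map_source h1s
  have hφ0 : φ.symm 0 = 1 := by rw [← hφ1, φ.left_inv h1s]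
  have : CompleteSpace F := hFm.symm.isClosed'.completeSpace_coe
  have : CompleteSpace m := hFm.isClosed'.completeSpace_coe
  let e : (m × F) ≃L[ℝ] E := m.prodEquivOfIsTopCompl F hFm.symm
  have he : ∀ x y, e (x, y) = (x : E) + y := fun x y => rfl
  -- the product map in the chart
  let ψ : m × F → G := fun p => φ.symm p.1 * φ.symm p.2
  let Ψ : m × F → E := fun p => φ (ψ p)
  have hψ0 : ψ 0 = 1 := by simp [ψ, hφ0]
  have hψat : ∀ p : m × F, (p.1 : E) ∈ φ.target → (p.2 : E) ∈ φ.target →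
      ContMDiffAt 𝓘(ℝ, m × F) 𝓘(ℝ, E) ∞ ψ p := by
    intro p h1 h2
    have c1 : ContMDiffAt 𝓘(ℝ, m × F) 𝓘(ℝ, E) ∞ (fun p : m × F => (p.1 : E)) p :=
      (m.subtypeL.contDiff.comp contDiff_fst).contMDiff.contMDiffAt
    have c2 : ContMDiffAt 𝓘(ℝ, m × F) 𝓘(ℝ, E) ∞ (fun p : m × F => (p.2 : E)) p :=
      (F.subtypeL.contDiff.comp contDiff_snd).contMDiff.contMDiffAt
    exact (ContMDiffAt.comp p (g := φ.symm) (hsm'.contMDiffAt (φ.open_target.mem_nhds h1)) c1).mul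
      (ContMDiffAt.comp p (g := φ.symm) (hsm'.contMDiffAt (φ.open_target.mem_nhds h2)) c2)
  have hΨat : ∀ p : m × F, (p.1 : E) ∈ φ.target → (p.2 : E) ∈ φ.target → ψ p ∈ φ.source →
      ContDiffAt ℝ ∞ Ψ p := by
    intro p h1 h2 h3
    rw [← contMDiffAt_iff_contDiffAt]
    exact ContMDiffAt.comp p (g := φ) (f := ψ) (hsm.contMDiffAt (φ.open_source.mem_nhds h3))
      (hψat p h1 h2)
  have hΨ0 : ContDiffAt ℝ ∞ Ψ 0 := hΨat 0 (by simpa) (by simpa) (by rwa [hψ0])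
  have hΨd : HasFDerivAt Ψ (e : (m × F) →L[ℝ] E) 0 := by
    have hd : HasFDerivAt Ψ (fderiv ℝ Ψ 0) 0 := (hΨ0.differentiableAt (by simp)).hasFDerivAt
    convert hd using 1
    have t1 : ∀ᶠ x : m in 𝓝 0, (x : E) ∈ φ.target :=
      (continuous_subtype_val.tendsto' (0 : m) (0 : E) rfl).eventually (φ.open_target.mem_nhds h0t)
    have t2 : ∀ᶠ x : F in 𝓝 0, (x : E) ∈ φ.target :=
      (continuous_subtype_val.tendsto' (0 : F) (0 : E) rfl).eventually (φ.open_target.mem_nhds h0t)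
    have d1 : (fderiv ℝ Ψ 0).comp (ContinuousLinearMap.inl ℝ m F) = m.subtypeL := by
      have a1 : HasFDerivAt (fun x : m => Ψ (x, 0))
          ((fderiv ℝ Ψ 0).comp (ContinuousLinearMap.inl ℝ m F)) 0 :=
        HasFDerivAt.comp (g := Ψ) (f := fun x : m => (x, (0 : F))) 0 hd (hasFDerivAt_prodMk_left 0 0)
      refine a1.unique (m.subtypeL.hasFDerivAt.congr_of_eventuallyEq ?_)
      filter_upwards [t1] with x hx
      simp [Ψ, ψ, hφ0, φ.right_inv hx]
    have d2 : (fderiv ℝ Ψ 0).comp (ContinuousLinearMap.inr ℝ m F) = F.subtypeL := by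
      have a1 : HasFDerivAt (fun x : F => Ψ (0, x))
          ((fderiv ℝ Ψ 0).comp (ContinuousLinearMap.inr ℝ m F)) 0 :=
        HasFDerivAt.comp (g := Ψ) (f := fun x : F => ((0 : m), x)) 0 hd
          (hasFDerivAt_prodMk_right 0 0)
      refine a1.unique (F.subtypeL.hasFDerivAt.congr_of_eventuallyEq ?_)
      filter_upwards [t2] with x hx
      simp [Ψ, ψ, hφ0, φ.right_inv hx]
    ext p
    · simpa [he] using (congrArg (fun L => L p) d1).symm
    · simpa [he] using (congrArg (fun L => L p) d2).symm
  -- the local inverse, and a neighbourhood on which everything is smooth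
  let T := hΨ0.toOpenPartialHomeomorph Ψ hΨd (by simp)
  have hT0 : (0 : m × F) ∈ T.source := hΨ0.mem_toOpenPartialHomeomorph_source hΨd (by simp)
  have hTΨ : ∀ p, T p = Ψ p := fun p => rfl
  have hgood : ∀ᶠ p in 𝓝 (0 : m × F), p ∈ T.source ∧ (p.1 : E) ∈ φ.target ∧
      (p.2 : E) ∈ φ.target ∧ ψ p ∈ φ.source ∧ ContDiffAt ℝ ∞ T.symm (T p) := by
    have t1 : ∀ᶠ p in 𝓝 (0 : m × F), (p.1 : E) ∈ φ.target :=
      ((continuous_subtype_val.comp continuous_fst).tendsto' (0 : m × F) (0 : E) rfl).eventually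
        (φ.open_target.mem_nhds h0t)
    have t2 : ∀ᶠ p in 𝓝 (0 : m × F), (p.2 : E) ∈ φ.target :=
      ((continuous_subtype_val.comp continuous_snd).tendsto' (0 : m × F) (0 : E) rfl).eventually
        (φ.open_target.mem_nhds h0t)
    have t3 : ∀ᶠ p in 𝓝 (0 : m × F), ψ p ∈ φ.source := by
      have : ContinuousAt ψ 0 := (hψat 0 (by simpa) (by simpa)).continuousAt
      refine this.eventually ?_
      rw [hψ0]; exact φ.open_source.mem_nhds h1s
    have t4 : ∀ᶠ p in 𝓝 (0 : m × F), fderiv ℝ Ψ p ∈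
        range ((↑) : ((m × F) ≃L[ℝ] E) → ((m × F) →L[ℝ] E)) := by
      have hc : ContinuousAt (fderiv ℝ Ψ) 0 := (hΨ0.fderiv_right (m := 0) (by simp)).continuousAt
      refine hc.eventually (ContinuousLinearEquiv.isOpen.mem_nhds ?_)
      rw [hΨd.fderiv]; exact ⟨e, rfl⟩
    filter_upwards [t1, t2, t3, t4, T.open_source.mem_nhds hT0] with p h1 h2 h3 h4 h5
    refine ⟨h5, h1, h2, h3, ?_⟩
    obtain ⟨e', he'⟩ := h4
    have hsmp := hΨat p h1 h2 h3
    refine T.contDiffAt_symm (f₀' := e') (T.map_source h5) ?_ ?_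
    · rw [T.left_inv h5, he']; exact (hsmp.differentiableAt (by simp)).hasFDerivAt
    · rw [T.left_inv h5]; exact hsmp
  obtain ⟨ε, hε, hball⟩ := Metric.mem_nhds_iff.1 hgood
  have hball' : ∀ (x : m) (y : F), ‖x‖ < ε → ‖y‖ < ε → (x, y) ∈ T.source ∧ (x : E) ∈ φ.target ∧
      (y : E) ∈ φ.target ∧ ψ (x, y) ∈ φ.source ∧ ContDiffAt ℝ ∞ T.symm (T (x, y)) := by
    intro x y hx hy
    refine hball ?_
    rw [mem_ball_zero_iff, Prod.norm_def]; exact max_lt hx hy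
  -- elements of `B` close to the unit
  have hNB : ∀ᶠ p in 𝓝 ((0, 0) : m × m), φ ((φ.symm p.1)⁻¹ * φ.symm p.2) ∈ Metric.ball (0 : E) ε ∧
      (φ.symm p.1)⁻¹ * φ.symm p.2 ∈ φ.source := by
    have c0 : ContinuousAt φ.symm (0 : E) := φ.continuousAt_symm h0t
    have c1 : ContinuousAt (fun p : m × m => φ.symm (p.1 : E)) (0, 0) :=
      ContinuousAt.comp (g := φ.symm) (f := fun p : m × m => (p.1 : E)) (by simpa using c0)
        (continuous_subtype_val.comp continuous_fst).continuousAt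
    have c2 : ContinuousAt (fun p : m × m => φ.symm (p.2 : E)) (0, 0) :=
      ContinuousAt.comp (g := φ.symm) (f := fun p : m × m => (p.2 : E)) (by simpa using c0)
        (continuous_subtype_val.comp continuous_snd).continuousAt
    have : IsTopologicalGroup G := topologicalGroup_of_lieGroup 𝓘(ℝ, E) ∞
    have c3 : ContinuousAt (fun p : m × m => (φ.symm (p.1 : E))⁻¹ * φ.symm (p.2 : E)) (0, 0) :=
      c1.inv.mul c2
    have c4 : Tendsto (fun p : m × m => (φ.symm (p.1 : E))⁻¹ * φ.symm (p.2 : E)) (𝓝 (0, 0))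
        (𝓝 1) := by simpa [ContinuousAt, hφ0] using c3
    have c5 : Tendsto φ (𝓝 1) (𝓝 0) := by
      have := φ.continuousAt h1s; rwa [ContinuousAt, hφ1] at this
    exact ((c5.comp c4).eventually (Metric.ball_mem_nhds 0 hε)).and
      (c4.eventually (φ.open_source.mem_nhds h1s))
  obtain ⟨η, hη, hηball⟩ := Metric.mem_nhds_iff.1 hNB
  have hηball' : ∀ (x x' : m), ‖x‖ < η → ‖x'‖ < η →
      φ ((φ.symm x)⁻¹ * φ.symm x') ∈ Metric.ball (0 : E) ε ∧
      (φ.symm x)⁻¹ * φ.symm x' ∈ φ.source := by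
    intro x y hx hy
    have : ((x, y) : m × m) ∈ Metric.ball (0, 0) η := by
      rw [← Prod.zero_eq_mk, mem_ball_zero_iff, Prod.norm_def]; exact max_lt hx hy
    exact hηball this
  set ε' := min ε η with hε'
  have hε'0 : 0 < ε' := lt_min hε hη
  -- uniqueness of the slice coordinate
  have huniq : ∀ x x' : m, ‖x‖ < ε' → ‖x'‖ < ε' → (φ.symm x)⁻¹ * φ.symm x' ∈ B → x = x' := by
    intro x x' hx hx' hb
    obtain ⟨h1, h2⟩ := hηball' x x' (hx.trans_le (min_le_right _ _)) (hx'.trans_le (min_le_right _ _))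
    set b := (φ.symm (x : E))⁻¹ * φ.symm (x' : E) with hbdef
    have hyF : φ b ∈ F := (hφB b h2).1 hb
    let y : F := ⟨φ b, hyF⟩
    have hy : ‖y‖ < ε := by simpa using h1
    have hxε := hx.trans_le (min_le_left ε η)
    have hxε' := hx'.trans_le (min_le_left ε η)
    have e1 : ψ (x, y) = φ.symm x' := by
      change φ.symm x * φ.symm (φ b) = _
      rw [φ.left_inv h2, hbdef, mul_inv_cancel_left]
    have e2 : ψ (x', 0) = φ.symm x' := by simp [ψ, hφ0]
    have e3 : T (x, y) = T (x', 0) := by rw [hTΨ, hTΨ]; simp only [Ψ, e1, e2]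
    have := T.injOn (hball' x y hxε hy).1 (hball' x' 0 hxε' (by simpa)).1 e3
    exact congrArg Prod.fst this
  have hF_B : ∀ y : F, (y : E) ∈ φ.target → φ.symm y ∈ B := by
    intro y hy
    rw [hφB _ (φ.map_target hy), φ.right_inv hy]; exact y.2
  let V : Set m := Metric.ball 0 ε'
  let σ : m → G := fun x => φ.symm x
  let Ω : Set G := {g | ∃ x ∈ V, (σ x)⁻¹ * g ∈ B}
  have hVt : ∀ x ∈ V, (x : E) ∈ φ.target := fun x hx =>
    (hball' x 0 ((mem_ball_zero_iff.1 hx).trans_le (min_le_left _ _)) (by simpa)).2.1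
  classical
  let r : G → m := fun g => if hg : ∃ x ∈ V, (σ x)⁻¹ * g ∈ B then hg.choose else 0
  have hr : ∀ (g : G) (x : m), x ∈ V → (σ x)⁻¹ * g ∈ B → r g = x := by
    intro g x hx hxg
    have hg : ∃ x ∈ V, (σ x)⁻¹ * g ∈ B := ⟨x, hx, hxg⟩
    simp only [r, dif_pos hg]
    refine huniq _ _ (mem_ball_zero_iff.1 hg.choose_spec.1) (mem_ball_zero_iff.1 hx) ?_
    have := B.mul_mem hg.choose_spec.2 (B.inv_mem hxg)
    simpa [mul_assoc, σ] using this
  -- local description near a point of `Ω`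
  have hloc : ∀ (x : m) (b : G), x ∈ V → b ∈ B → ∃ N ∈ 𝓝 (σ x * b), N ⊆ Ω ∧
      ContMDiffAt 𝓘(ℝ, E) 𝓘(ℝ, m) ∞ r (σ x * b) := by
    intro x b hx hb
    have hxε : ‖x‖ < ε := (mem_ball_zero_iff.1 hx).trans_le (min_le_left _ _)
    obtain ⟨g1, g2, g3, g4, g5⟩ := hball' x 0 hxε (by simpa)
    have hψx : ψ (x, 0) = σ x := by simp [ψ, hφ0, σ]
    -- the coordinate map
    let q : G → m × F := fun g => T.symm (φ (g * b⁻¹))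
    have hmulsm : ContMDiffAt 𝓘(ℝ, E) 𝓘(ℝ, E) ∞ (fun g : G => g * b⁻¹) (σ x * b) :=
      (contMDiff_mul_right (a := b⁻¹)).contMDiffAt
    have hval : (σ x * b) * b⁻¹ = ψ (x, 0) := by rw [hψx]; simp
    have hφsm : ContMDiffAt 𝓘(ℝ, E) 𝓘(ℝ, E) ∞ (fun g : G => φ (g * b⁻¹)) (σ x * b) := by
      refine ContMDiffAt.comp (σ x * b) (g := φ) (f := fun g : G => g * b⁻¹) ?_ hmulsm
      rw [hval]; exact hsm.contMDiffAt (φ.open_source.mem_nhds g4)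
    have hqsm : ContMDiffAt 𝓘(ℝ, E) 𝓘(ℝ, m × F) ∞ q (σ x * b) := by
      refine ContMDiffAt.comp (σ x * b) (g := T.symm) (f := fun g : G => φ (g * b⁻¹)) ?_ hφsm
      rw [hval, contMDiffAt_iff_contDiffAt]; exact g5
    have hq0 : q (σ x * b) = (x, 0) := by
      simp only [q, hval]; exact T.left_inv g1
    have ev1 : ∀ᶠ g in 𝓝 (σ x * b), ‖(q g).1‖ < ε' ∧ ‖(q g).2‖ < ε := by
      have hc := hqsm.continuousAt
      have c1 : ∀ᶠ p in 𝓝 (q (σ x * b)), ‖p.1‖ < ε' ∧ ‖p.2‖ < ε := by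
        rw [hq0]
        refine IsOpen.mem_nhds ?_ ⟨mem_ball_zero_iff.1 hx, by simpa⟩
        exact (isOpen_lt continuous_fst.norm continuous_const).inter
          (isOpen_lt continuous_snd.norm continuous_const)
      exact hc.eventually c1
    have ev2 : ∀ᶠ g in 𝓝 (σ x * b), g * b⁻¹ ∈ φ.source := by
      refine hmulsm.continuousAt.eventually (φ.open_source.mem_nhds ?_)
      change (σ x * b) * b⁻¹ ∈ φ.source
      rw [hval]; exact g4
    have ev3 : ∀ᶠ g in 𝓝 (σ x * b), φ (g * b⁻¹) ∈ T.target := by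
      refine hφsm.continuousAt.eventually (T.open_target.mem_nhds ?_)
      change φ ((σ x * b) * b⁻¹) ∈ T.target
      rw [hval]; exact T.map_source g1
    have ev : ∀ᶠ g in 𝓝 (σ x * b), (q g).1 ∈ V ∧ (σ (q g).1)⁻¹ * g ∈ B := by
      filter_upwards [ev1, ev2, ev3] with g h1 h2 h3
      refine ⟨mem_ball_zero_iff.2 h1.1, ?_⟩
      obtain ⟨k1, k2, k3, k4, -⟩ := hball' (q g).1 (q g).2 (h1.1.trans_le (min_le_left _ _)) h1.2
      have e1 : φ (ψ (q g)) = φ (g * b⁻¹) := T.right_inv h3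
      have e2 : ψ (q g) = g * b⁻¹ := φ.injOn k4 h2 e1
      have e3 : g = σ (q g).1 * (φ.symm (q g).2 * b) := by
        rw [← mul_assoc]; exact eq_mul_of_mul_inv_eq e2.symm
      have e4 : (σ (q g).1)⁻¹ * g = φ.symm (q g).2 * b := by
        rw [inv_mul_eq_iff_eq_mul]; exact e3
      rw [e4]; exact B.mul_mem (hF_B _ k3) hb
    refine ⟨_, ev, fun g hg => ⟨_, hg.1, hg.2⟩, ?_⟩
    have : ContMDiffAt 𝓘(ℝ, E) 𝓘(ℝ, m) ∞ (fun g => (q g).1) (σ x * b) :=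
      ContMDiffAt.comp (σ x * b) (g := Prod.fst) (f := q) contDiff_fst.contMDiff.contMDiffAt hqsm
    refine this.congr_of_eventuallyEq ?_
    filter_upwards [ev] with g hg using hr g _ hg.1 hg.2
  have hmem : ∀ g ∈ Ω, ∃ x ∈ V, ∃ b ∈ B, σ x * b = g := by
    rintro g ⟨x, hx, hg⟩
    exact ⟨x, hx, _, hg, by simp⟩
  refine ⟨⟨m, V, Ω, σ, r, Metric.isOpen_ball, ?_, ?_, ?_, ?_, ?_, ?_, ?_, ?_, ?_, ?_⟩⟩
  · rw [isOpen_iff_mem_nhds]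
    intro g hg
    obtain ⟨x, hx, b, hb, rfl⟩ := hmem g hg
    obtain ⟨N, hN, hsub, -⟩ := hloc x b hx hb
    exact mem_of_superset hN hsub
  · exact ⟨0, Metric.mem_ball_self hε'0, by simp [σ, hφ0, B.one_mem]⟩
  · intro x hx
    refine ContMDiffAt.contMDiffWithinAt ?_
    exact ContMDiffAt.comp x (g := φ.symm) (f := fun x : m => (x : E))
      (hsm'.contMDiffAt (φ.open_target.mem_nhds (hVt x hx))) m.subtypeL.contDiff.contMDiff.contMDiffAt
  · intro g hg
    obtain ⟨x, hx, b, hb, rfl⟩ := hmem g hg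
    obtain ⟨N, hN, -, h⟩ := hloc x b hx hb
    exact h.contMDiffWithinAt
  · exact fun x hx => ⟨x, hx, by simp [B.one_mem]⟩
  · rintro g ⟨x, hx, hg⟩
    rw [hr g x hx hg]; exact hx
  · exact fun x hx => hr _ x hx (by simp [B.one_mem])
  · rintro g ⟨x, hx, hg⟩
    rw [hr g x hx hg]; exact hg
  · rintro g ⟨x, hx, hg⟩ b hb
    exact ⟨x, hx, by rw [← mul_assoc]; exact B.mul_mem hg hb⟩
  · rintro g ⟨x, hx, hg⟩ b hb
    rw [hr g x hx hg]
    exact hr _ x hx (by rw [← mul_assoc]; exact B.mul_mem hg hb)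

namespace QuotientSlice

variable {B : Subgroup G} (S : QuotientSlice E B)

theorem out_mem_iff (g₀ g : G) : g₀⁻¹ * (g : G ⧸ B).out ∈ S.Ω ↔ g₀⁻¹ * g ∈ S.Ω := by
  obtain ⟨b, hb⟩ := QuotientGroup.mk_out_eq_mul B g
  rw [hb, ← mul_assoc]
  refine ⟨fun h => ?_, fun h => S.mul_mem _ h _ b.2⟩
  have := S.mul_mem _ h _ (B.inv_mem b.2)
  simpa using this

theorem r_out (g₀ g : G) (h : g₀⁻¹ * g ∈ S.Ω) : S.r (g₀⁻¹ * (g : G ⧸ B).out) = S.r (g₀⁻¹ * g) := by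
  obtain ⟨b, hb⟩ := QuotientGroup.mk_out_eq_mul B g
  rw [hb, ← mul_assoc, S.r_mul _ h _ b.2]

theorem mk_σ (g₀ g : G) (h : g₀⁻¹ * g ∈ S.Ω) : ((g₀ * S.σ (S.r (g₀⁻¹ * g)) : G) : G ⧸ B) = g := by
  rw [QuotientGroup.eq]
  have := S.σ_r _ h
  simpa [mul_assoc] using this

variable [CompleteSpace E] [LieGroup 𝓘(ℝ, E) ∞ G]

/-- The chart of `G ⧸ B` at the class of `g₀` given by the translated slice. -/
noncomputable def chart (g₀ : G) : OpenPartialHomeomorph (G ⧸ B) S.m where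
  toFun s := S.r (g₀⁻¹ * s.out)
  invFun x := ((g₀ * S.σ x : G) : G ⧸ B)
  source := {s | g₀⁻¹ * s.out ∈ S.Ω}
  target := S.V
  map_source' s hs := S.r_mem _ hs
  map_target' x hx := by
    change g₀⁻¹ * ((g₀ * S.σ x : G) : G ⧸ B).out ∈ S.Ω
    rw [S.out_mem_iff]; simpa using S.σ_mem x hx
  left_inv' s hs := by
    change g₀⁻¹ * s.out ∈ S.Ω at hs
    rw [S.mk_σ _ _ hs]; simp
  right_inv' x hx := by
    have : g₀⁻¹ * (g₀ * S.σ x) ∈ S.Ω := by simpa using S.σ_mem x hx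
    rw [S.r_out _ _ this]; simpa using S.r_σ x hx
  open_source := by
    have : IsTopologicalGroup G := topologicalGroup_of_lieGroup 𝓘(ℝ, E) ∞
    rw [← (QuotientGroup.isQuotientMap_mk B).isOpen_preimage]
    have : (QuotientGroup.mk : G → G ⧸ B) ⁻¹' {s | g₀⁻¹ * s.out ∈ S.Ω} =
        (fun g => g₀⁻¹ * g) ⁻¹' S.Ω := by
      ext g; exact S.out_mem_iff g₀ g
    rw [this]
    exact S.isOpen_Ω.preimage (continuous_const_mul _)
  open_target := S.isOpen_V
  continuousOn_toFun := by
    have : IsTopologicalGroup G := topologicalGroup_of_lieGroup 𝓘(ℝ, E) ∞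
    have ho : IsOpen {s : G ⧸ B | g₀⁻¹ * s.out ∈ S.Ω} := by
      rw [← (QuotientGroup.isQuotientMap_mk B).isOpen_preimage]
      have : (QuotientGroup.mk : G → G ⧸ B) ⁻¹' {s | g₀⁻¹ * s.out ∈ S.Ω} =
          (fun g => g₀⁻¹ * g) ⁻¹' S.Ω := by
        ext g; exact S.out_mem_iff g₀ g
      rw [this]
      exact S.isOpen_Ω.preimage (continuous_const_mul _)
    rw [(QuotientGroup.isQuotientMap_mk B).continuousOn_isOpen_iff ho]
    have h1 : ContinuousOn (fun g : G => S.r (g₀⁻¹ * g)) ((fun g => g₀⁻¹ * g) ⁻¹' S.Ω) :=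
      S.contMDiffOn_r.continuousOn.comp (continuous_const_mul _).continuousOn (fun _ h => h)
    refine (h1.mono ?_).congr ?_
    · intro g hg; exact (S.out_mem_iff g₀ g).1 hg
    · intro g hg; exact S.r_out g₀ g ((S.out_mem_iff g₀ g).1 hg)
  continuousOn_invFun := by
    have : IsTopologicalGroup G := topologicalGroup_of_lieGroup 𝓘(ℝ, E) ∞
    exact QuotientGroup.continuous_mk.comp_continuousOn
      (S.contMDiffOn_σ.continuousOn.const_mul g₀)

end QuotientSlice

variable [CompleteSpace E] [LieGroup 𝓘(ℝ, E) ∞ G]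

variable (E) in
/-- A chosen slice at the unit. -/
noncomputable def quotientSlice (B : Subgroup G) [IsBanachLieSubgroup (E := E) B] :
    QuotientSlice E B :=
  Classical.choice (nonempty_quotientSlice B)

variable (E) in
/-- The model space of the manifold `G ⧸ B`: a closed complement of the Lie algebra of `B`. -/
abbrev QuotientModel (B : Subgroup G) [IsBanachLieSubgroup (E := E) B] : Type _ :=
  (quotientSlice E B).m

/-- The manifold structure of the homogeneous space `G ⧸ B`. -/
noncomputable instance instChartedSpaceQuotient (B : Subgroup G) [IsBanachLieSubgroup (E := E) B] :
    ChartedSpace (QuotientModel E B) (G ⧸ B) where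
  atlas := range fun g₀ : G => (quotientSlice E B).chart g₀
  chartAt s := (quotientSlice E B).chart s.out
  mem_chart_source s := by
    change s.out⁻¹ * s.out ∈ (quotientSlice E B).Ω
    rw [inv_mul_cancel]; exact (quotientSlice E B).one_mem
  chart_mem_atlas s := mem_range_self _

instance instIsManifoldQuotient (B : Subgroup G) [IsBanachLieSubgroup (E := E) B] :
    IsManifold 𝓘(ℝ, QuotientModel E B) ∞ (G ⧸ B) := by
  refine isManifold_of_contDiffOn _ _ _ ?_
  rintro _ _ ⟨g₀, rfl⟩ ⟨g₁, rfl⟩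
  set S := quotientSlice E B
  simp only [modelWithCornersSelf_coe, modelWithCornersSelf_coe_symm, Function.id_comp,
    Function.comp_id, range_id, inter_univ, preimage_id]
  rw [← contMDiffOn_iff_contDiffOn]
  have key : ∀ x ∈ ((S.chart g₀).symm.trans (S.chart g₁)).source,
      x ∈ S.V ∧ g₁⁻¹ * (g₀ * S.σ x) ∈ S.Ω := by
    rintro x hx
    rw [OpenPartialHomeomorph.trans_source] at hx
    exact ⟨hx.1, (S.out_mem_iff g₁ _).1 hx.2⟩
  have h1 : ContMDiffOn 𝓘(ℝ, S.m) 𝓘(ℝ, S.m) ∞ (fun x => S.r (g₁⁻¹ * (g₀ * S.σ x)))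
      ((S.chart g₀).symm.trans (S.chart g₁)).source := by
    refine ContMDiffOn.comp S.contMDiffOn_r (f := fun x => g₁⁻¹ * (g₀ * S.σ x)) (t := S.Ω) ?_ ?_
    · exact contMDiffOn_const.mul (contMDiffOn_const.mul
        (S.contMDiffOn_σ.mono fun x hx => (key x hx).1))
    · exact fun x hx => (key x hx).2
  refine h1.congr fun x hx => ?_
  exact S.r_out g₁ _ (key x hx).2

end QuotientManifold

section Frames

open Bundle

variable {EB : Type*} [NormedAddCommGroup EB] [NormedSpace ℝ EB]
  {M : Type*} [TopologicalSpace M] [ChartedSpace EB M]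

/-- A smooth atlas of local frames for a family of complex normed spaces `E b` over a manifold:
linear homeomorphisms of the typical fibre `F` onto the fibres, depending smoothly on the base
point, in the sense that the transition functions between any two frames are smooth. -/
structure FrameAtlas (EB : Type*) [NormedAddCommGroup EB] [NormedSpace ℝ EB] (M : Type*) [TopologicalSpace M] [ChartedSpace EB M]
    (F : Type*) [NormedAddCommGroup F] [NormedSpace ℂ F]
    (E : M → Type*) [∀ b, NormedAddCommGroup (E b)] [∀ b, NormedSpace ℂ (E b)] where
  ι : Type*
  U : ι → Set M
  isOpen_U : ∀ i, IsOpen (U i)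
  idx : M → ι
  mem_idx : ∀ b, b ∈ U (idx b)
  τ : ∀ i, ∀ b ∈ U i, F ≃L[ℂ] E b
  c : ι → ι → M → F →L[ℂ] F
  contMDiffOn_c : ∀ i j, ContMDiffOn 𝓘(ℝ, EB) 𝓘(ℝ, F →L[ℂ] F) ∞ (c i j) (U i ∩ U j)
  τ_c : ∀ i j b (hi : b ∈ U i) (hj : b ∈ U j) v, τ j b hj (c i j b v) = τ i b hi v

namespace FrameAtlas

variable {F : Type*} [NormedAddCommGroup F] [NormedSpace ℂ F]
  {E : M → Type*} [∀ b, NormedAddCommGroup (E b)] [∀ b, NormedSpace ℂ (E b)]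
  (A : FrameAtlas EB M F E)

open Classical in
/-- The pretrivialization given by a local frame. -/
noncomputable def pretriv (i : A.ι) : Pretrivialization F (π F E) where
  toFun p := (p.1, if h : p.1 ∈ A.U i then (A.τ i p.1 h).symm p.2 else 0)
  invFun p := ⟨p.1, if h : p.1 ∈ A.U i then A.τ i p.1 h p.2 else 0⟩
  source := π F E ⁻¹' A.U i
  target := A.U i ×ˢ univ
  map_source' p hp := ⟨hp, trivial⟩
  map_target' p hp := hp.1
  left_inv' := by
    rintro ⟨b, x⟩ (hb : b ∈ A.U i)
    simp [hb]
  right_inv' := by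
    rintro ⟨b, x⟩ ⟨hb, -⟩
    change b ∈ A.U i at hb
    simp [hb]
  open_target := (A.isOpen_U i).prod isOpen_univ
  baseSet := A.U i
  open_baseSet := A.isOpen_U i
  source_eq := rfl
  target_eq := rfl
  proj_toFun p hp := rfl

theorem pretriv_apply (i : A.ι) (b : M) (hb : b ∈ A.U i) (x : E b) :
    A.pretriv i ⟨b, x⟩ = (b, (A.τ i b hb).symm x) := by
  change (b, _) = _
  simp [hb]

open Classical in
theorem pretriv_symm (i : A.ι) (b : M) (hb : b ∈ A.U i) (v : F) :
    (A.pretriv i).symm b v = A.τ i b hb v := by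
  rw [Pretrivialization.symm_apply _ hb]
  change cast _ (if h : b ∈ A.U i then A.τ i b h v else 0) = _
  simp only [hb, dite_true]
  rfl

theorem coord_eq (i j : A.ι) (b : M) (hb : b ∈ A.U i ∩ A.U j) (v : F) :
    A.c i j b v = (A.pretriv j ⟨b, (A.pretriv i).symm b v⟩).2 := by
  rw [pretriv_symm A i b hb.1, pretriv_apply A j b hb.2, ← A.τ_c i j b hb.1 hb.2 v]
  simp

theorem contMDiffOn_real (i j : A.ι) : ContMDiffOn 𝓘(ℝ, EB) 𝓘(ℝ, F →L[ℝ] F) ∞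
    (fun b => (A.c i j b).restrictScalars ℝ) (A.U i ∩ A.U j) :=
  ContMDiff.comp_contMDiffOn
    (ContinuousLinearMap.restrictScalarsL ℂ F F ℝ ℝ).contDiff.contMDiff (A.contMDiffOn_c i j)

/-- The vector prebundle given by an atlas of local frames. -/
noncomputable def toPrebundle : VectorPrebundle ℝ F E where
  pretrivializationAtlas := range A.pretriv
  pretrivialization_linear' := by
    rintro _ ⟨i, rfl⟩
    refine ⟨fun b (hb : b ∈ A.U i) => ⟨fun x y => ?_, fun c x => ?_⟩⟩
    · simp only [pretriv_apply A i b hb, map_add]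
    · simp only [pretriv_apply A i b hb]
      exact LinearMap.map_smul_of_tower (A.τ i b hb).symm.toLinearEquiv.toLinearMap c x
  pretrivializationAt b := A.pretriv (A.idx b)
  mem_base_pretrivializationAt := A.mem_idx
  pretrivialization_mem_atlas b := mem_range_self _
  exists_coordChange := by
    rintro _ ⟨i, rfl⟩ _ ⟨j, rfl⟩
    exact ⟨fun b => (A.c i j b).restrictScalars ℝ, (A.contMDiffOn_real i j).continuousOn, fun b hb v => A.coord_eq i j b hb v⟩
  totalSpaceMk_isInducing b := by
    have : (A.pretriv (A.idx b) ∘ TotalSpace.mk b : E b → M × F) =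
        (fun v => (b, v)) ∘ (A.τ (A.idx b) b (A.mem_idx b)).symm := by
      funext x; exact A.pretriv_apply _ b (A.mem_idx b) x
    rw [this]
    exact Topology.isInducing_const_prod.2
      (A.τ (A.idx b) b (A.mem_idx b)).symm.toHomeomorph.isInducing

theorem isContMDiff : A.toPrebundle.IsContMDiff 𝓘(ℝ, EB) ∞ where
  exists_contMDiffCoordChange := by
    rintro _ ⟨i, rfl⟩ _ ⟨j, rfl⟩
    exact ⟨fun b => (A.c i j b).restrictScalars ℝ, A.contMDiffOn_real i j, fun b hb v => A.coord_eq i j b hb v⟩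

end FrameAtlas

end Frames

section Homogeneous

open Bundle

/-- The map `A ↦ P A j` on operators. -/
noncomputable def sandwich {H F F' : Type*} [NormedAddCommGroup H] [NormedSpace ℂ H]
    [NormedAddCommGroup F] [NormedSpace ℂ F] [NormedAddCommGroup F'] [NormedSpace ℂ F']
    (P : H →L[ℂ] F') (j : F →L[ℂ] H) : (H →L[ℂ] H) →L[ℂ] (F →L[ℂ] F') :=
  (ContinuousLinearMap.compL ℂ F H F' P).comp ((ContinuousLinearMap.compL ℂ F H H).flip j)

theorem contDiff_sandwich {H F F' : Type*} [NormedAddCommGroup H] [NormedSpace ℂ H]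
    [NormedAddCommGroup F] [NormedSpace ℂ F] [NormedAddCommGroup F'] [NormedSpace ℂ F']
    (P : H →L[ℂ] F') (j : F →L[ℂ] H) : ContDiff ℝ ∞ (sandwich P j) :=
  (ContinuousLinearMap.contDiff (𝕜 := ℂ) (sandwich P j)).restrict_scalars ℝ

/-- The data of a homogeneous Hermitian bundle: a norm-continuous unitary representation `ρ` of
`G` on `HA` and a closed subspace `HB` of `HA` which is invariant under the subgroup `B` (so that
`ρ` restricts to a representation of `B` on `HB`) and whose translates span a dense subspace. (The model space of `G` is
recorded in the type.) -/
structure HomogeneousData (_E : Type*) {G : Type*} [TopologicalSpace G] [Group G] (B : Subgroup G)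
    (HA : Type*) [NormedAddCommGroup HA] [InnerProductSpace ℂ HA] [CompleteSpace HA] where
  ρ : G →* unitary (HA →L[ℂ] HA)
  continuous_ρ : Continuous ρ
  HB : Submodule ℂ HA
  isClosed_HB : IsClosed (HB : Set HA)
  invariant : ∀ b ∈ B, ∀ f ∈ HB, (ρ b : HA →L[ℂ] HA) f ∈ HB
  dense_span : (Submodule.span ℂ {x : HA | ∃ g, ∃ f ∈ HB, x = (ρ g : HA →L[ℂ] HA) f}).topologicalClosure = ⊤

namespace HomogeneousData

variable {E : Type*} {G : Type*} [TopologicalSpace G] [Group G] {B : Subgroup G}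
  {HA : Type*} [NormedAddCommGroup HA] [InnerProductSpace ℂ HA] [CompleteSpace HA]
  (R : HomogeneousData E B HA)

instance : CompleteSpace R.HB := R.isClosed_HB.completeSpace_coe

/-- The representation, with values in the bounded operators. -/
noncomputable def op : G →* (HA →L[ℂ] HA) := (unitary (HA →L[ℂ] HA)).subtype.comp R.ρ

theorem op_mul_apply (g h : G) (x : HA) : R.op (g * h) x = R.op g (R.op h x) := by
  rw [map_mul]; rfl

theorem op_one_apply (x : HA) : R.op 1 x = x := by rw [map_one]; rfl

theorem norm_op (g : G) (x : HA) : ‖R.op g x‖ = ‖x‖ :=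
  (Unitary.linearIsometryEquiv (R.ρ g)).norm_map x

theorem inner_op (g : G) (x y : HA) : inner ℂ (R.op g x) (R.op g y) = inner ℂ x y :=
  (Unitary.linearIsometryEquiv (R.ρ g)).inner_map_map x y

/-- The representation of the subgroup `B` on `HB`. -/
noncomputable def opB (b : G) (hb : b ∈ B) : R.HB ≃ₗᵢ[ℂ] R.HB where
  toFun f := ⟨R.op b f, R.invariant b hb f f.2⟩
  invFun f := ⟨R.op b⁻¹ f, R.invariant b⁻¹ (B.inv_mem hb) f f.2⟩
  map_add' x y := by ext; simp
  map_smul' c x := by ext; simp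
  left_inv x := by ext; simp [← op_mul_apply]
  right_inv x := by ext; simp [← op_mul_apply]
  norm_map' x := R.norm_op b x

/-- The equivalence relation on `G × HB` defining `G ×_B HB`. -/
def setoid : Setoid (G × R.HB) where
  r p q := ∃ w ∈ B, q.1 = p.1 * w ∧ (q.2 : HA) = R.op w⁻¹ p.2
  iseqv := by
    refine ⟨fun p => ⟨1, B.one_mem, by simp, by simp⟩, ?_, ?_⟩
    · rintro ⟨g, f⟩ ⟨g', f'⟩ ⟨w, hw, h1, h2⟩
      refine ⟨w⁻¹, B.inv_mem hw, ?_, ?_⟩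
      · simp only at h1; simp [h1]
      · simp only at h2; simp [h2, ← op_mul_apply]
    · rintro ⟨g, f⟩ ⟨g', f'⟩ ⟨g'', f''⟩ ⟨w, hw, h1, h2⟩ ⟨v, hv, h3, h4⟩
      simp only at h1 h2 h3 h4
      refine ⟨w * v, B.mul_mem hw hv, ?_, ?_⟩
      · simp [h1, h3, mul_assoc]
      · simp only [h4, h2, ← op_mul_apply, mul_inv_rev]

/-- The set `G ×_B HB`. -/
def Balanced : Type _ := Quotient R.setoid

/-- The class `[(g, f)]` in `G ×_B HB`. -/
def cls (g : G) (f : R.HB) : R.Balanced := Quotient.mk R.setoid (g, f)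

theorem cls_mul (g w : G) (hw : w ∈ B) (f : R.HB) :
    R.cls (g * w) f = R.cls g (R.opB w hw f) := by
  refine Quotient.sound (s := R.setoid) (R.setoid.iseqv.symm ⟨w, hw, rfl, ?_⟩)
  change (f : HA) = R.op w⁻¹ (R.op w f)
  rw [← op_mul_apply, inv_mul_cancel, op_one_apply]

/-- The projection `[(g, f)] ↦ gB`. -/
def proj : R.Balanced → G ⧸ B :=
  Quotient.lift (fun p : G × R.HB => (p.1 : G ⧸ B)) (by
    rintro ⟨g, f⟩ ⟨g', f'⟩ ⟨w, hw, h1, -⟩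
    simp only at h1
    rw [QuotientGroup.eq]; simpa [h1] using hw)

/-- The fibre of `G ×_B HB` over a point of `G ⧸ B`. -/
def Fiber (s : G ⧸ B) : Type _ := {ξ : R.Balanced // R.proj ξ = s}

theorem cls_bijective (g : G) :
    Function.Bijective (fun f : R.HB => (⟨R.cls g f, rfl⟩ : R.Fiber (g : G ⧸ B))) := by
  constructor
  · intro f f' h
    obtain ⟨w, -, h1, h2⟩ := Quotient.exact (s := R.setoid) (congrArg Subtype.val h)
    simp only [left_eq_mul] at h1
    simp only [h1, inv_one, op_one_apply] at h2
    exact Subtype.ext h2.symm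
  · rintro ⟨ξ, hξ⟩
    obtain ⟨⟨g', f⟩, rfl⟩ := Quotient.exists_rep ξ
    have hw : g⁻¹ * g' ∈ B := QuotientGroup.eq.1 (hξ : ((g' : G) : G ⧸ B) = g).symm
    refine ⟨R.opB _ hw f, Subtype.ext ?_⟩
    change R.cls g (R.opB _ hw f) = R.cls g' f
    rw [← cls_mul, mul_inv_cancel_left]

/-- The identification of a fibre with the typical fibre by means of the chosen representative. -/
noncomputable def fiberEquiv (s : G ⧸ B) : R.Fiber s ≃ R.HB :=
  (((Equiv.ofBijective _ (R.cls_bijective s.out))).trans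
    (Equiv.cast (congrArg R.Fiber (Quotient.out_eq' s)))).symm

theorem fiberEquiv_symm_apply (s : G ⧸ B) (f : R.HB) :
    ((R.fiberEquiv s).symm f).1 = R.cls s.out f := by
  have : ∀ (t : G ⧸ B) (h : t = s) (x : R.Fiber t) (h' : R.Fiber t = R.Fiber s),
      (cast h' x).1 = x.1 := by rintro t rfl x h'; rfl
  exact this _ (Quotient.out_eq' s) _ _

noncomputable instance (s : G ⧸ B) : AddCommGroup (R.Fiber s) := (R.fiberEquiv s).addCommGroup

noncomputable instance (s : G ⧸ B) : Module ℂ (R.Fiber s) := (R.fiberEquiv s).module ℂ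

noncomputable instance (s : G ⧸ B) : NormedAddCommGroup (R.Fiber s) :=
  NormedAddCommGroup.induced (R.Fiber s) R.HB ((R.fiberEquiv s).linearEquiv ℂ)
    ((R.fiberEquiv s).linearEquiv ℂ).injective

noncomputable instance (s : G ⧸ B) : InnerProductSpace ℂ (R.Fiber s) where
  toNormedSpace := NormedSpace.induced ℂ (R.Fiber s) R.HB ((R.fiberEquiv s).linearEquiv ℂ)
  inner x y := inner ℂ (R.fiberEquiv s x) (R.fiberEquiv s y)
  norm_sq_eq_re_inner x := norm_sq_eq_re_inner (𝕜 := ℂ) (R.fiberEquiv s x)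
  conj_inner_symm x y := inner_conj_symm _ _
  add_left x y z := by
    have : R.fiberEquiv s (x + y) = R.fiberEquiv s x + R.fiberEquiv s y :=
      map_add ((R.fiberEquiv s).linearEquiv ℂ) x y
    rw [this, inner_add_left]
  smul_left x y c := by
    have : R.fiberEquiv s (c • x) = c • R.fiberEquiv s x :=
      map_smul ((R.fiberEquiv s).linearEquiv ℂ) c x
    rw [this, inner_smul_left]

/-- The fibre over `s` is isometric to `HB` through `f ↦ [(g, f)]`, for every `g` in the coset
`s`. -/
noncomputable def frame (s : G ⧸ B) (g : G) (hg : (g : G ⧸ B) = s) : R.HB ≃ₗᵢ[ℂ] R.Fiber s :=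
  (R.opB (s.out⁻¹ * g) (QuotientGroup.eq.1 (by rw [hg]; exact Quotient.out_eq' s))).trans
    { ((R.fiberEquiv s).linearEquiv ℂ).symm with
      norm_map' := fun f => congrArg norm ((R.fiberEquiv s).apply_symm_apply f) }

theorem frame_apply (s : G ⧸ B) (g : G) (hg : (g : G ⧸ B) = s) (f : R.HB) :
    (R.frame s g hg f).1 = R.cls g f := by
  refine (R.fiberEquiv_symm_apply s _).trans ?_
  refine (R.cls_mul s.out (s.out⁻¹ * g) _ f).symm.trans ?_
  rw [mul_inv_cancel_left]

variable [NormedAddCommGroup E] [NormedSpace ℝ E] [ChartedSpace E G] [LieGroup 𝓘(ℝ, E) ∞ G]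

theorem contMDiff_op : ContMDiff 𝓘(ℝ, E) 𝓘(ℝ, HA →L[ℂ] HA) ∞ R.op :=
  contMDiff_of_continuous_hom R.op (continuous_subtype_val.comp R.continuous_ρ)

variable [CompleteSpace E] [IsBanachLieSubgroup (E := E) B]

variable (E) in
/-- The local section of `G → G ⧸ B` over the domain of the chart at the class of `g₀`. -/
noncomputable def sec (_R : HomogeneousData E B HA) (g₀ : G) (s : G ⧸ B) : G :=
  g₀ * (quotientSlice E B).σ ((quotientSlice E B).chart g₀ s)

variable (E) in
theorem mk_sec (g₀ : G) (s : G ⧸ B) (hs : s ∈ ((quotientSlice E B).chart g₀).source) :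
    ((R.sec E g₀ s : G) : G ⧸ B) = s :=
  ((quotientSlice E B).chart g₀).left_inv hs

theorem contMDiffOn_sec (g₀ : G) : ContMDiffOn 𝓘(ℝ, QuotientModel E B) 𝓘(ℝ, E) ∞ (R.sec E g₀)
    ((quotientSlice E B).chart g₀).source := by
  have h1 : ContMDiffOn 𝓘(ℝ, QuotientModel E B) 𝓘(ℝ, QuotientModel E B) ∞
      ((quotientSlice E B).chart g₀) ((quotientSlice E B).chart g₀).source :=
    contMDiffOn_of_mem_maximalAtlas (IsManifold.subset_maximalAtlas (mem_range_self g₀))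
  exact contMDiffOn_const.mul ((quotientSlice E B).contMDiffOn_σ.comp h1
    fun s hs => ((quotientSlice E B).chart g₀).map_source hs)

variable (E) in
/-- The frames of the homogeneous bundle given by the local sections of `G → G ⧸ B`. -/
noncomputable def frames : FrameAtlas (QuotientModel E B) (G ⧸ B) R.HB R.Fiber where
  ι := G
  U g₀ := ((quotientSlice E B).chart g₀).source
  isOpen_U g₀ := ((quotientSlice E B).chart g₀).open_source
  idx s := s.out
  mem_idx s := mem_chart_source (QuotientModel E B) s
  τ g₀ s hs := (R.frame s (R.sec E g₀ s) (R.mk_sec E g₀ s hs)).toContinuousLinearEquiv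
  c g₀ g₁ s := sandwich R.HB.orthogonalProjectionOnto R.HB.subtypeL
    (R.op ((R.sec E g₁ s)⁻¹ * R.sec E g₀ s))
  contMDiffOn_c g₀ g₁ := by
    refine (contDiff_sandwich _ _).contMDiff.comp_contMDiffOn ((R.contMDiff_op (E := E)).comp_contMDiffOn ?_)
    exact ((R.contMDiffOn_sec g₁).mono inter_subset_right).inv.mul
      ((R.contMDiffOn_sec g₀).mono inter_subset_left)
  τ_c g₀ g₁ s h0 h1 f := by
    have hw : (R.sec E g₁ s)⁻¹ * R.sec E g₀ s ∈ B :=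
      QuotientGroup.eq.1 ((R.mk_sec E g₁ s h1).trans (R.mk_sec E g₀ s h0).symm)
    have : sandwich R.HB.orthogonalProjectionOnto R.HB.subtypeL
        (R.op ((R.sec E g₁ s)⁻¹ * R.sec E g₀ s)) f = R.opB _ hw f :=
      Submodule.orthogonalProjectionOnto_mem_subspace_eq_self (K := R.HB) (R.opB _ hw f)
    rw [this]
    refine Subtype.ext ?_
    refine (R.frame_apply s _ (R.mk_sec E g₁ s h1) _).trans
      (Eq.trans ?_ (R.frame_apply s _ (R.mk_sec E g₀ s h0) _).symm)
    rw [← cls_mul, mul_inv_cancel_left]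

noncomputable instance : TopologicalSpace (TotalSpace R.HB R.Fiber) :=
  (R.frames E).toPrebundle.totalSpaceTopology

noncomputable instance : FiberBundle R.HB R.Fiber := (R.frames E).toPrebundle.toFiberBundle

instance : VectorBundle ℝ R.HB R.Fiber := (R.frames E).toPrebundle.toVectorBundle

instance : ContMDiffVectorBundle ∞ R.HB R.Fiber 𝓘(ℝ, QuotientModel E B) :=
  letI := (R.frames E).isContMDiff
  (R.frames E).toPrebundle.contMDiffVectorBundle 𝓘(ℝ, QuotientModel E B)

/-- The quotient map `G × HB → D = G ×_B HB`, onto the total space of the homogeneous bundle. -/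
def quot (p : G × R.HB) : TotalSpace R.HB R.Fiber := ⟨(p.1 : G ⧸ B), ⟨R.cls p.1 p.2, rfl⟩⟩

end HomogeneousData

end Homogeneous

section UnitaryGroup

variable (A : Type*) [CStarAlgebra A]

/-- The Lie algebra of the unitary group: the skew-adjoint elements. -/
noncomputable abbrev Skew : Submodule ℝ A := skewAdjoint.submodule ℝ A

namespace Skew

theorem isClosed : IsClosed (Skew A : Set A) :=
  isClosed_eq continuous_star continuous_neg

instance : CompleteSpace (Skew A) := (isClosed A).completeSpace_coe

/-- The skew-adjoint part of an element. -/
noncomputable def part : A →L[ℝ] Skew A :=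
  ((2 : ℝ)⁻¹ • (ContinuousLinearMap.id ℝ A - (starL' ℝ : A ≃L[ℝ] A))).codRestrict _ fun a => by
    change star ((2 : ℝ)⁻¹ • (a - star a)) = -((2 : ℝ)⁻¹ • (a - star a))
    rw [star_smul, star_sub, star_star, ← smul_neg, neg_sub]; simp

variable {A}

theorem part_of_mem {a : A} (ha : star a = -a) : (part A a : A) = a := by
  change (2 : ℝ)⁻¹ • (a - star a) = a
  rw [ha, sub_neg_eq_add, ← two_smul ℝ, smul_smul]; norm_num

theorem star_coe (x : Skew A) : star (x : A) = -x := x.2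

theorem isUnit_one_sub (x : Skew A) : IsUnit (1 - (x : A)) := by
  have hsa : IsSelfAdjoint (Complex.I • (x : A)) := by
    rw [IsSelfAdjoint, star_smul, star_coe]; simp
  have h : Complex.I ∉ spectrum ℂ (Complex.I • (x : A)) := by
    intro h
    have := congrArg Complex.im (hsa.mem_spectrum_eq_re h)
    simp at this
  rw [spectrum.notMem_iff, Algebra.algebraMap_eq_smul_one, ← smul_sub] at h
  have h2 := h.smul (Units.mk0 Complex.I Complex.I_ne_zero)⁻¹
  have e : ((Units.mk0 Complex.I Complex.I_ne_zero)⁻¹ : ℂˣ) • (Complex.I • (1 - (x : A))) =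
      1 - (x : A) := by
    rw [Units.smul_def, smul_smul]; simp
  rwa [e] at h2

theorem isUnit_one_add (x : Skew A) : IsUnit (1 + (x : A)) := by
  simpa using isUnit_one_sub (-x)

/-- The Cayley transform. -/
noncomputable def cayley (x : Skew A) : unitary A :=
  ⟨(1 + (x : A)) * Ring.inverse (1 - (x : A)), by
    obtain ⟨v, hv⟩ := isUnit_one_sub x
    obtain ⟨w, hw⟩ := isUnit_one_add x
    have hvw : star v = w := by
      ext; rw [Units.coe_star, hv, hw, star_sub, star_coe]; simp
    have hcomm : v * w = w * v := by
      ext; push_cast; rw [hv, hw]; noncomm_ring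
    rw [← hv, ← hw, Ring.inverse_unit]
    have e : (w : A) * ↑v⁻¹ = ↑(w * v⁻¹) := rfl
    have hst : star (w * v⁻¹) = w⁻¹ * v := by
      rw [star_mul, star_inv, hvw, ← hvw, star_star]
    rw [e, Unitary.mem_iff, ← Units.coe_star, hst, ← Units.val_mul, ← Units.val_mul]
    have hc : Commute v w := hcomm
    constructor
    · rw [show w⁻¹ * v * (w * v⁻¹) = 1 by
        rw [mul_assoc, ← mul_assoc v w, hcomm]; group]
      rfl
    · rw [show w * v⁻¹ * (w⁻¹ * v) = 1 by
        rw [mul_assoc, ← mul_assoc v⁻¹, hc.inv_inv.eq]; group]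
      rfl⟩

theorem coe_cayley (x : Skew A) :
    (cayley x : A) = (1 + (x : A)) * Ring.inverse (1 - (x : A)) := rfl

/-- The inverse of the Cayley transform. -/
noncomputable def cayleyInv (a : A) : Skew A := part A ((a - 1) * Ring.inverse (1 + a))

theorem isUnit_one_add_cayley (x : Skew A) : IsUnit (1 + (cayley x : A)) := by
  obtain ⟨v, hv⟩ := isUnit_one_sub x
  have h2 : IsUnit (2 : A) := by
    have := (IsUnit.mk0 (2 : ℂ) two_ne_zero).map (algebraMap ℂ A)
    rwa [map_ofNat] at this
  have : 1 + (cayley x : A) = 2 * (↑v⁻¹ : A) := by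
    rw [coe_cayley, ← hv, Ring.inverse_unit]
    have : (1 : A) = v * (↑v⁻¹ : A) := by simp
    nth_rewrite 1 [this]
    rw [← add_mul, hv]; congr 1; noncomm_ring; norm_num
  rw [this]; exact h2.mul v⁻¹.isUnit

theorem cayleyInv_cayley (x : Skew A) : cayleyInv (cayley x : A) = x := by
  obtain ⟨v, hv⟩ := isUnit_one_sub x
  obtain ⟨w, hw⟩ := isUnit_one_add_cayley x
  have e1 : (cayley x : A) * v = 1 + x := by
    rw [coe_cayley, ← hv, Ring.inverse_unit]; simp
  have e : (cayley x : A) - 1 = x * w := by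
    rw [hw, ← v.isUnit.mul_left_inj, sub_mul, e1, mul_assoc, add_mul, e1, hv]; noncomm_ring
  refine Subtype.ext ?_
  rw [cayleyInv, ← hw, Ring.inverse_unit, e, mul_assoc, Units.mul_inv, mul_one, part_of_mem x.2]

theorem coe_cayleyInv (u : unitary A) (hu : IsUnit (1 + (u : A))) :
    (cayleyInv (u : A) : A) = ((u : A) - 1) * Ring.inverse (1 + (u : A)) := by
  obtain ⟨w, hw⟩ := hu
  refine part_of_mem ?_
  rw [← hw, Ring.inverse_unit]
  have h1 : star ((↑w⁻¹ : A)) = ↑(star w)⁻¹ := by rw [← Units.coe_star, star_inv]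
  have h2 : star (w : A) = star (u : A) * w := by rw [hw]; simp [mul_add, add_comm]
  have h3 : star (w : A) * (u : A) = w := by
    rw [hw]; simp [add_mul, add_comm]
  have h4 : star ((u : A) - 1) = -(star (u : A) * (u - 1)) := by simp [mul_sub]
  have h5 : ((u : A) - 1) * w = w * (u - 1) := by rw [hw]; noncomm_ring
  have h6 : (u : A) * w = w * u := by rw [hw]; noncomm_ring
  rw [star_mul, h1, h4]
  have h7 : (↑(star w)⁻¹ : A) = ↑w⁻¹ * (u : A) := by
    have h8 : (↑w⁻¹ : A) * (u : A) = u * ↑w⁻¹ := by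
      rw [Units.inv_mul_eq_iff_eq_mul, ← mul_assoc, ← h6, mul_assoc]; simp
    refine Units.inv_eq_of_mul_eq_one_right ?_
    rw [h8, ← mul_assoc, Units.coe_star, h3]; simp
  rw [h7, mul_neg, mul_assoc, ← mul_assoc (u : A), Unitary.mul_star_self_of_mem u.2, one_mul]
  congr 1
  rw [Units.inv_mul_eq_iff_eq_mul, ← mul_assoc, ← h5, mul_assoc]; simp

theorem cayley_cayleyInv (u : unitary A) (hu : IsUnit (1 + (u : A))) :
    cayley (cayleyInv (u : A)) = u := by
  have hc := coe_cayleyInv u hu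
  obtain ⟨v, hv⟩ := isUnit_one_sub (cayleyInv (u : A))
  obtain ⟨w, hw⟩ := hu
  rw [← hw, Ring.inverse_unit] at hc
  refine Subtype.ext ?_
  have e : (1 + (cayleyInv (u : A) : A)) = u * v := by
    rw [hv, hc]
    have : ((1 : A) + (u - 1) * ↑w⁻¹) * w = (u * (1 - (u - 1) * ↑w⁻¹)) * w := by
      simp only [add_mul, sub_mul, mul_sub, mul_assoc, Units.inv_mul, mul_one, one_mul]
      rw [hw]; noncomm_ring
    simpa [Units.mul_left_inj] using this
  rw [coe_cayley, e, ← hv, Ring.inverse_unit, mul_assoc, Units.mul_inv, mul_one]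

theorem contDiffAt_cayleyInv {a : A} (ha : IsUnit (1 + a)) : ContDiffAt ℝ ∞ (cayleyInv (A := A)) a := by
  obtain ⟨w, hw⟩ := ha
  refine (part A).contDiff.contDiffAt.comp a (ContDiffAt.mul ?_ ?_)
  · exact contDiffAt_id.sub contDiffAt_const
  · refine ContDiffAt.comp a (g := Ring.inverse) ?_ (contDiffAt_const.add contDiffAt_id)
    change ContDiffAt ℝ ∞ Ring.inverse (1 + a)
    rw [← hw]; exact contDiffAt_ringInverse ℝ w

theorem contDiff_cayley : ContDiff ℝ ∞ (fun x : Skew A => (cayley x : A)) := by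
  rw [contDiff_iff_contDiffAt]
  intro x
  have hsub : ContDiffAt ℝ ∞ (fun x : Skew A => (x : A)) x :=
    (Skew A).subtypeL.contDiff.contDiffAt
  obtain ⟨w, hw⟩ := isUnit_one_sub x
  refine ContDiffAt.mul (contDiffAt_const.add hsub) ?_
  refine ContDiffAt.comp x (g := Ring.inverse) (f := fun x : Skew A => 1 - (x : A)) ?_
    (contDiffAt_const.sub hsub)
  rw [← hw]; exact contDiffAt_ringInverse ℝ w

end Skew
end UnitaryGroup

section UnitaryLieGroup

variable (A : Type*) [CStarAlgebra A]

namespace Skew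

variable {A}

/-- The Cayley chart of the unitary group at `v`. -/
noncomputable def chart (v : unitary A) : OpenPartialHomeomorph (unitary A) (Skew A) where
  toFun u := cayleyInv ((v⁻¹ * u : unitary A) : A)
  invFun x := v * cayley x
  source := {u | IsUnit (1 + ((v⁻¹ * u : unitary A) : A))}
  target := univ
  map_source' _ _ := trivial
  map_target' x _ := by
    change IsUnit (1 + ((v⁻¹ * (v * cayley x) : unitary A) : A))
    rw [inv_mul_cancel_left]; exact isUnit_one_add_cayley x
  left_inv' u hu := by rw [cayley_cayleyInv _ hu, mul_inv_cancel_left]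
  right_inv' x _ := by rw [inv_mul_cancel_left, cayleyInv_cayley]
  open_source := Units.isOpen.preimage
    (continuous_const.add (continuous_subtype_val.comp (continuous_const_mul v⁻¹)))
  open_target := isOpen_univ
  continuousOn_toFun u hu :=
    ContinuousAt.continuousWithinAt (ContinuousAt.comp (g := cayleyInv)
      (f := fun u : unitary A => ((v⁻¹ * u : unitary A) : A)) (contDiffAt_cayleyInv hu).continuousAt
      (continuous_subtype_val.comp (continuous_const_mul v⁻¹)).continuousAt)
  continuousOn_invFun := by
    refine Continuous.continuousOn (continuous_const.mul ?_)
    exact contDiff_cayley.continuous.subtype_mk _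

end Skew

noncomputable instance instChartedSpaceUnitary : ChartedSpace (Skew A) (unitary A) where
  atlas := range Skew.chart
  chartAt v := Skew.chart v
  mem_chart_source v := by
    change IsUnit (1 + ((v⁻¹ * v : unitary A) : A))
    have := (IsUnit.mk0 (2 : ℂ) two_ne_zero).map (algebraMap ℂ A)
    rw [map_ofNat] at this
    rw [inv_mul_cancel, OneMemClass.coe_one, one_add_one_eq_two]; exact this
  chart_mem_atlas v := mem_range_self v

instance instIsManifoldUnitary : IsManifold 𝓘(ℝ, Skew A) ∞ (unitary A) := by
  refine isManifold_of_contDiffOn _ _ _ ?_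
  rintro _ _ ⟨v, rfl⟩ ⟨w, rfl⟩
  simp only [modelWithCornersSelf_coe, modelWithCornersSelf_coe_symm, Function.id_comp,
    Function.comp_id, range_id, inter_univ, preimage_id]
  intro x hx
  rw [OpenPartialHomeomorph.trans_source] at hx
  have hx2 : IsUnit (1 + ((w⁻¹ * (v * Skew.cayley x) : unitary A) : A)) := hx.2
  refine ContDiffAt.contDiffWithinAt ?_
  refine ContDiffAt.comp x (g := Skew.cayleyInv)
    (f := fun x => ((w⁻¹ * (v * Skew.cayley x) : unitary A) : A))
    (Skew.contDiffAt_cayleyInv hx2) ?_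
  exact contDiffAt_const.mul (contDiffAt_const.mul Skew.contDiff_cayley.contDiffAt)

theorem contMDiff_coe_unitary :
    ContMDiff 𝓘(ℝ, Skew A) 𝓘(ℝ, A) ∞ (fun u : unitary A => (u : A)) := by
  intro v
  rw [contMDiffAt_iff]
  refine ⟨continuous_subtype_val.continuousAt, ContDiffAt.contDiffWithinAt ?_⟩
  exact contDiffAt_const.mul Skew.contDiff_cayley.contDiffAt

variable {A} in
theorem contMDiff_of_coe_unitary {F : Type*} [NormedAddCommGroup F] [NormedSpace ℝ F]
    {K : Type*} [TopologicalSpace K] {I : ModelWithCorners ℝ F K}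
    {M : Type*} [TopologicalSpace M] [ChartedSpace K M] {f : M → unitary A}
    (hf : ContMDiff I 𝓘(ℝ, A) ∞ fun x => (f x : A)) : ContMDiff I 𝓘(ℝ, Skew A) ∞ f := by
  intro x
  rw [contMDiffAt_iff_target]
  have hcont : Continuous f := Continuous.subtype_mk hf.continuous _
  refine ⟨hcont.continuousAt, ?_⟩
  have h2 : IsUnit (1 + ((f x)⁻¹ * f x : unitary A) : A) := mem_chart_source (Skew A) (f x)
  refine ContMDiffAt.comp x (g := Skew.cayleyInv)
    (f := fun y => (((f x)⁻¹ * f y : unitary A) : A)) (I' := 𝓘(ℝ, A))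
    (Skew.contDiffAt_cayleyInv h2).contMDiffAt ?_
  exact ((contDiff_const.mul contDiff_id :
    ContDiff ℝ ∞ fun a : A => (((f x)⁻¹ : unitary A) : A) * a).contMDiff _).comp x (hf x)

instance instLieGroupUnitary : LieGroup 𝓘(ℝ, Skew A) ∞ (unitary A) where
  contMDiff_mul := by
    refine contMDiff_of_coe_unitary ?_
    exact (contDiff_mul (𝕜 := ℝ) (𝔸 := A)).contMDiff.comp
      (((contMDiff_coe_unitary A).comp contMDiff_fst).prodMk_space
        ((contMDiff_coe_unitary A).comp contMDiff_snd))
  contMDiff_inv := by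
    refine contMDiff_of_coe_unitary ?_
    exact (starL' ℝ : A ≃L[ℝ] A).contDiff.contMDiff.comp (contMDiff_coe_unitary A)

end UnitaryLieGroup

section Grassmannian

open Bundle

theorem commute_inverse {A : Type*} [Ring A] {a b : A} (h : Commute a b) :
    Commute (Ring.inverse a) b := by
  by_cases ha : IsUnit a
  · obtain ⟨v, rfl⟩ := ha
    rw [Ring.inverse_unit]; exact h.units_inv_left
  · rw [Ring.inverse_non_unit a ha]; exact Commute.zero_left b

/-- The conditional expectation `X ↦ pXp + (1-p)X(1-p)` on the skew-adjoint elements. -/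
noncomputable def skewExpectation {A : Type*} [CStarAlgebra A] (p : A) : Skew A →L[ℝ] Skew A :=
  (Skew.part A).comp
    (((ContinuousLinearMap.mul ℝ A p).comp ((ContinuousLinearMap.mul ℝ A).flip p) +
      (ContinuousLinearMap.mul ℝ A (1 - p)).comp ((ContinuousLinearMap.mul ℝ A).flip (1 - p))).comp
      (Skew A).subtypeL)

theorem coe_skewExpectation {A : Type*} [CStarAlgebra A] {p : A} (hp : star p = p) (X : Skew A) :
    (skewExpectation p X : A) = p * (X * p) + (1 - p) * (X * (1 - p)) := by
  refine Skew.part_of_mem ?_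
  change star (p * (X * p) + (1 - p) * (X * (1 - p))) = -(p * (X * p) + (1 - p) * (X * (1 - p)))
  simp only [star_add, star_mul, star_sub, star_one, hp, Skew.star_coe]
  noncomm_ring

theorem isBanachLieSubgroup_of_commute {A : Type*} [CStarAlgebra A] (B : Subgroup (unitary A))
    {p : A} (hp : p * p = p) (hs : star p = p) (hB : ∀ u, u ∈ B ↔ Commute (u : A) p) :
    IsBanachLieSubgroup (E := Skew A) B := by
  have hcomm : ∀ X : Skew A, skewExpectation p X = X ↔ Commute (X : A) p := by
    intro X
    rw [Subtype.ext_iff, coe_skewExpectation hs]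
    constructor
    · intro h
      have h1 : p * (X : A) = p * (X * p) := by
        conv_lhs => rw [← h]
        simp only [mul_add, ← mul_assoc, hp, mul_sub, mul_one, sub_self, zero_mul, add_zero]
      have h2 : (X : A) * p = p * (X * p) := by
        conv_lhs => rw [← h]
        simp only [add_mul, mul_assoc, hp, sub_mul, one_mul, sub_self, mul_zero, add_zero]
      exact h2.trans h1.symm
    · intro h
      have h' : (X : A) * p = p * X := h
      simp only [mul_sub, sub_mul, mul_one, one_mul, h', ← mul_assoc, hp]
      noncomm_ring
  have hidem : IsIdempotentElem (skewExpectation p) := by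
    ext X
    change ((skewExpectation p (skewExpectation p X) : Skew A) : A) = _
    rw [(hcomm _).2]
    rw [coe_skewExpectation hs]
    change _ * p = p * _
    simp only [add_mul, mul_add, ← mul_assoc, hp, mul_sub, sub_mul, mul_one, one_mul]
    simp only [mul_assoc, hp]
    noncomm_ring
  refine ⟨_, _, ContinuousLinearMap.IsIdempotentElem.isTopCompl hidem, Skew.chart 1,
    IsManifold.subset_maximalAtlas (mem_range_self 1), mem_chart_source (Skew A) (1 : unitary A),
    ?_, ?_⟩
  · change Skew.cayleyInv (((1 : unitary A)⁻¹ * 1 : unitary A) : A) = 0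
    refine Subtype.ext ?_
    rw [inv_one, one_mul, Skew.coe_cayleyInv]
    · simp
    · have := mem_chart_source (Skew A) (1 : unitary A)
      have h2 : IsUnit (1 + (((1 : unitary A)⁻¹ * 1 : unitary A) : A)) := this
      rwa [inv_one, one_mul] at h2
  · intro u hu
    have hu' : IsUnit (1 + (((1 : unitary A)⁻¹ * u : unitary A) : A)) := hu
    rw [inv_one, one_mul] at hu'
    have hφ : Skew.chart 1 u = Skew.cayleyInv (u : A) := by
      change Skew.cayleyInv (((1 : unitary A)⁻¹ * u : unitary A) : A) = _
      rw [inv_one, one_mul]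
    have hrange : Skew.chart 1 u ∈ (↑(skewExpectation p) : Skew A →ₗ[ℝ] Skew A).range ↔
        skewExpectation p (Skew.chart 1 u) = Skew.chart 1 u := by
      constructor
      · rintro ⟨Y, hY⟩
        rw [← hY]
        exact congrArg (fun L : Skew A →L[ℝ] Skew A => L Y) hidem
      · intro h; exact ⟨_, h⟩
    rw [hB, hrange, hcomm, hφ]
    constructor
    · intro h
      rw [Skew.coe_cayleyInv u hu']
      exact (h.sub_left (Commute.one_left p)).mul_left
        (commute_inverse ((Commute.one_left p).add_left h))
    · intro h
      rw [← Skew.cayley_cayleyInv u hu', Skew.coe_cayley]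
      exact ((Commute.one_left p).add_left h).mul_left
        (commute_inverse ((Commute.one_left p).sub_left h))

variable {H : Type*} [NormedAddCommGroup H] [InnerProductSpace ℂ H] [CompleteSpace H]

/-- The image of a subspace under a unitary operator. -/
def unitaryImage (u : unitary (H →L[ℂ] H)) (S : Submodule ℂ H) : Submodule ℂ H :=
  S.map ((u : H →L[ℂ] H) : H →ₗ[ℂ] H)

theorem unitaryImage_one (S : Submodule ℂ H) : unitaryImage 1 S = S := by
  ext x; simp [unitaryImage]

theorem unitaryImage_mul (u v : unitary (H →L[ℂ] H)) (S : Submodule ℂ H) :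
    unitaryImage (u * v) S = unitaryImage u (unitaryImage v S) := by
  ext x; simp [unitaryImage]

/-- The isotropy group `U(p) = {u | uS₀ = S₀}`. -/
def isotropy (S₀ : Submodule ℂ H) : Subgroup (unitary (H →L[ℂ] H)) where
  carrier := {u | unitaryImage u S₀ = S₀}
  one_mem' := unitaryImage_one S₀
  mul_mem' {u v} hu hv := by
    change unitaryImage (u * v) S₀ = S₀
    rw [unitaryImage_mul, hv, hu]
  inv_mem' {u} hu := by
    change unitaryImage u⁻¹ S₀ = S₀
    have hu' : unitaryImage u S₀ = S₀ := hu
    conv_lhs => rw [← hu']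
    rw [← unitaryImage_mul, inv_mul_cancel, unitaryImage_one]

theorem mem_isotropy_iff (S₀ : Submodule ℂ H) [CompleteSpace S₀] (u : unitary (H →L[ℂ] H)) :
    u ∈ isotropy S₀ ↔ Commute (u : H →L[ℂ] H) S₀.starProjection := by
  have hle : ∀ v : unitary (H →L[ℂ] H), Commute (v : H →L[ℂ] H) S₀.starProjection →
      unitaryImage v S₀ ≤ S₀ := by
    rintro v h _ ⟨x, hx, rfl⟩
    have h1 : (v : H →L[ℂ] H) (S₀.starProjection x) = S₀.starProjection ((v : H →L[ℂ] H) x) :=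
      congrArg (fun L : H →L[ℂ] H => L x) h
    rw [Submodule.starProjection_eq_self_iff.2 hx] at h1
    change (v : H →L[ℂ] H) x ∈ S₀
    rw [h1]; exact Submodule.starProjection_apply_mem _ _
  constructor
  · intro h
    have : (unitaryImage u S₀).HasOrthogonalProjection :=
      inferInstanceAs (S₀.map ((Unitary.linearIsometryEquiv u).toLinearEquiv : H →ₗ[ℂ] H)
        ).HasOrthogonalProjection
    have key : ∀ x, (unitaryImage u S₀).starProjection x = (u : H →L[ℂ] H) (S₀.starProjection
        ((Unitary.linearIsometryEquiv u).symm x)) := fun x =>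
      Submodule.starProjection_map_apply (Unitary.linearIsometryEquiv u) S₀ x
    have heq : ∀ (K : Submodule ℂ H) [K.HasOrthogonalProjection], K = S₀ →
        K.starProjection = S₀.starProjection := by rintro K hK rfl; rfl
    ext x
    have h2 := key ((u : H →L[ℂ] H) x)
    rw [heq _ h] at h2
    have h3 : (Unitary.linearIsometryEquiv u).symm ((u : H →L[ℂ] H) x) = x :=
      (Unitary.linearIsometryEquiv u).symm_apply_apply x
    rw [h3] at h2
    exact h2.symm
  · intro h
    refine le_antisymm (hle u h) ?_
    have h2 : Commute ((u⁻¹ : unitary (H →L[ℂ] H)) : H →L[ℂ] H) S₀.starProjection := by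
      have := h.star_star
      rwa [(isSelfAdjoint_starProjection S₀).star_eq] at this
    have := Submodule.map_mono (f := ((u : H →L[ℂ] H) : H →ₗ[ℂ] H)) (hle _ h2)
    change unitaryImage u (unitaryImage u⁻¹ S₀) ≤ unitaryImage u S₀ at this
    rwa [← unitaryImage_mul, mul_inv_cancel, unitaryImage_one] at this

instance (S₀ : Submodule ℂ H) [CompleteSpace S₀] :
    IsBanachLieSubgroup (E := Skew (H →L[ℂ] H)) (isotropy S₀) :=
  isBanachLieSubgroup_of_commute _ S₀.isIdempotentElem_starProjection
    (isSelfAdjoint_starProjection S₀).star_eq (mem_isotropy_iff S₀)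

/-- The unitary orbit `Gr_{S₀}(H) = {uS₀ | u ∈ U(H)}` of a closed subspace, i.e. the connected
component of `S₀` in the Grassmann manifold of `H`. -/
def Gr (S₀ : Submodule ℂ H) : Type _ := {S : Submodule ℂ H // ∃ u, unitaryImage u S₀ = S}

namespace Gr

variable (S₀ : Submodule ℂ H)

/-- The point `uS₀` of the Grassmannian. -/
def mk (u : unitary (H →L[ℂ] H)) : Gr S₀ := ⟨unitaryImage u S₀, u, rfl⟩

theorem mk_eq_iff (u v : unitary (H →L[ℂ] H)) : mk S₀ u = mk S₀ v ↔ u⁻¹ * v ∈ isotropy S₀ := by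
  have h0 : mk S₀ u = mk S₀ v ↔ unitaryImage u S₀ = unitaryImage v S₀ := Subtype.ext_iff
  rw [h0]
  change _ ↔ unitaryImage (u⁻¹ * v) S₀ = S₀
  constructor
  · intro h
    rw [unitaryImage_mul, ← h, ← unitaryImage_mul, inv_mul_cancel, unitaryImage_one]
  · intro h
    conv_lhs => rw [← h]
    rw [← unitaryImage_mul, mul_inv_cancel_left]

/-- The bijection `U(H) ⧸ U(p) ≃ Gr_{S₀}(H)`, `uU(p) ↦ uS₀`. -/
noncomputable def equiv : (unitary (H →L[ℂ] H) ⧸ isotropy S₀) ≃ Gr S₀ :=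
  Equiv.ofBijective (Quotient.lift (mk S₀) fun u v h =>
      (mk_eq_iff S₀ u v).2 (QuotientGroup.leftRel_apply.1 h)) <| by
    constructor
    · rintro ⟨u⟩ ⟨v⟩ h
      exact Quotient.sound (s := QuotientGroup.leftRel (isotropy S₀))
        (QuotientGroup.leftRel_apply.2 ((mk_eq_iff S₀ u v).1 h))
    · rintro ⟨_, u, rfl⟩
      exact ⟨(u : unitary (H →L[ℂ] H) ⧸ isotropy S₀), rfl⟩

noncomputable instance : TopologicalSpace (Gr S₀) :=
  TopologicalSpace.induced (equiv S₀).symm inferInstance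

/-- The Grassmannian carries the topology of `U(H) ⧸ U(p)`. -/
noncomputable def homeo : Gr S₀ ≃ₜ (unitary (H →L[ℂ] H) ⧸ isotropy S₀) :=
  (equiv S₀).symm.toHomeomorphOfIsInducing ⟨rfl⟩

variable [CompleteSpace S₀]

/-- The chart of the Grassmannian at `uS₀` which corresponds to the chart of `U(H) ⧸ U(p)`. -/
noncomputable def chart (u : unitary (H →L[ℂ] H)) :
    OpenPartialHomeomorph (Gr S₀) (QuotientModel (Skew (H →L[ℂ] H)) (isotropy S₀)) :=
  (homeo S₀).transOpenPartialHomeomorph ((quotientSlice (Skew (H →L[ℂ] H)) (isotropy S₀)).chart u)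

/-- The manifold structure of the Grassmannian, which makes `U(H) ⧸ U(p) ≃ Gr_{S₀}(H)` a
diffeomorphism. -/
noncomputable instance :
    ChartedSpace (QuotientModel (Skew (H →L[ℂ] H)) (isotropy S₀)) (Gr S₀) where
  atlas := range (chart S₀)
  chartAt S := chart S₀ (homeo S₀ S).out
  mem_chart_source S := mem_chart_source (QuotientModel (Skew (H →L[ℂ] H)) (isotropy S₀))
    (homeo S₀ S)
  chart_mem_atlas _ := mem_range_self _

instance : IsManifold 𝓘(ℝ, QuotientModel (Skew (H →L[ℂ] H)) (isotropy S₀)) ∞ (Gr S₀) where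
  compatible := by
    rintro _ _ ⟨u, rfl⟩ ⟨v, rfl⟩
    have h : ((quotientSlice (Skew (H →L[ℂ] H)) (isotropy S₀)).chart u).symm.trans
        ((quotientSlice (Skew (H →L[ℂ] H)) (isotropy S₀)).chart v) ∈
        contDiffGroupoid ∞ 𝓘(ℝ, QuotientModel (Skew (H →L[ℂ] H)) (isotropy S₀)) :=
      HasGroupoid.compatible (mem_range_self u) (mem_range_self v)
    convert h using 1
    refine OpenPartialHomeomorph.ext _ _ (fun x => ?_) (fun x => ?_) ?_
    · change (quotientSlice (Skew (H →L[ℂ] H)) (isotropy S₀)).chart v _ = _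
      exact congrArg _ ((homeo S₀).apply_symm_apply _)
    · change (quotientSlice (Skew (H →L[ℂ] H)) (isotropy S₀)).chart u _ = _
      exact congrArg _ ((homeo S₀).apply_symm_apply _)
    · ext x; simp [chart]

/-- The fibre of the tautological bundle at a point `S` of the Grassmannian is `S` itself. -/
abbrev Fiber (S : Gr S₀) : Type _ := S.1

/-- A unitary operator `u` with `uS₀ = S` identifies `S₀` with the fibre over `S`. -/
noncomputable def frame (S : Gr S₀) (u : unitary (H →L[ℂ] H)) (hu : unitaryImage u S₀ = S.1) :
    S₀ ≃ₗᵢ[ℂ] Fiber S₀ S where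
  toFun x := ⟨(u : H →L[ℂ] H) x, hu ▸ ⟨x, x.2, rfl⟩⟩
  invFun y := ⟨((u⁻¹ : unitary (H →L[ℂ] H)) : H →L[ℂ] H) y, by
    have h : unitaryImage u⁻¹ S.1 = S₀ := by
      rw [← hu, ← unitaryImage_mul, inv_mul_cancel, unitaryImage_one]
    exact h.le ⟨y, y.2, rfl⟩⟩
  map_add' x y := by ext; simp
  map_smul' c x := by ext; simp
  left_inv x := Subtype.ext (congrArg (fun w : unitary (H →L[ℂ] H) => (w : H →L[ℂ] H) x)
    (inv_mul_cancel u))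
  right_inv x := Subtype.ext (congrArg (fun w : unitary (H →L[ℂ] H) => (w : H →L[ℂ] H) x)
    (mul_inv_cancel u))
  norm_map' x := (Unitary.linearIsometryEquiv u).norm_map x

/-- The local section of `u ↦ uS₀` over the domain of a chart. -/
noncomputable def sec (u : unitary (H →L[ℂ] H)) (S : Gr S₀) : unitary (H →L[ℂ] H) :=
  u * (quotientSlice (Skew (H →L[ℂ] H)) (isotropy S₀)).σ (chart S₀ u S)

theorem unitaryImage_sec (u : unitary (H →L[ℂ] H)) (S : Gr S₀) (hS : S ∈ (chart S₀ u).source) :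
    unitaryImage (sec S₀ u S) S₀ = S.1 :=
  congrArg Subtype.val ((chart S₀ u).left_inv hS)

theorem contMDiffOn_sec (u : unitary (H →L[ℂ] H)) :
    ContMDiffOn 𝓘(ℝ, QuotientModel (Skew (H →L[ℂ] H)) (isotropy S₀)) 𝓘(ℝ, Skew (H →L[ℂ] H)) ∞
      (sec S₀ u) (chart S₀ u).source := by
  have h1 : ContMDiffOn 𝓘(ℝ, QuotientModel (Skew (H →L[ℂ] H)) (isotropy S₀))
      𝓘(ℝ, QuotientModel (Skew (H →L[ℂ] H)) (isotropy S₀)) ∞ (chart S₀ u) (chart S₀ u).source :=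
    contMDiffOn_of_mem_maximalAtlas (IsManifold.subset_maximalAtlas (mem_range_self u))
  exact contMDiffOn_const.mul
    ((quotientSlice (Skew (H →L[ℂ] H)) (isotropy S₀)).contMDiffOn_σ.comp h1
      fun s hs => (chart S₀ u).map_source hs)

/-- The frames of the tautological bundle given by the local sections of `u ↦ uS₀`. -/
noncomputable def frames :
    FrameAtlas (QuotientModel (Skew (H →L[ℂ] H)) (isotropy S₀)) (Gr S₀) S₀ (Fiber S₀) where
  ι := unitary (H →L[ℂ] H)
  U u := (chart S₀ u).source
  isOpen_U u := (chart S₀ u).open_source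
  idx S := (homeo S₀ S).out
  mem_idx S := mem_chart_source (QuotientModel (Skew (H →L[ℂ] H)) (isotropy S₀)) S
  τ u S hS := (frame S₀ S (sec S₀ u S) (unitaryImage_sec S₀ u S hS)).toContinuousLinearEquiv
  c u v S := sandwich S₀.orthogonalProjectionOnto S₀.subtypeL
    (((sec S₀ v S)⁻¹ * sec S₀ u S : unitary (H →L[ℂ] H)) : H →L[ℂ] H)
  contMDiffOn_c u v := by
    refine (contDiff_sandwich _ _).contMDiff.comp_contMDiffOn
      ((contMDiff_coe_unitary (H →L[ℂ] H)).comp_contMDiffOn ?_)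
    exact ((contMDiffOn_sec S₀ v).mono inter_subset_right).inv.mul
      ((contMDiffOn_sec S₀ u).mono inter_subset_left)
  τ_c u v S hu hv x := by
    have hw : unitaryImage ((sec S₀ v S)⁻¹ * sec S₀ u S) S₀ = S₀ := by
      rw [unitaryImage_mul, unitaryImage_sec S₀ u S hu, ← unitaryImage_sec S₀ v S hv,
        ← unitaryImage_mul, inv_mul_cancel, unitaryImage_one]
    have hx : (((sec S₀ v S)⁻¹ * sec S₀ u S : unitary (H →L[ℂ] H)) : H →L[ℂ] H) x ∈ S₀ :=
      hw.le ⟨x, x.2, rfl⟩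
    have h1 : sandwich S₀.orthogonalProjectionOnto S₀.subtypeL
        (((sec S₀ v S)⁻¹ * sec S₀ u S : unitary (H →L[ℂ] H)) : H →L[ℂ] H) x = ⟨_, hx⟩ :=
      Submodule.orthogonalProjectionOnto_mem_subspace_eq_self (K := S₀) ⟨_, hx⟩
    rw [h1]
    exact Subtype.ext (congrArg (fun w : unitary (H →L[ℂ] H) => (w : H →L[ℂ] H) x)
      (mul_inv_cancel_left (sec S₀ v S) (sec S₀ u S)))

noncomputable instance : TopologicalSpace (TotalSpace S₀ (Fiber S₀)) :=
  (frames S₀).toPrebundle.totalSpaceTopology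

noncomputable instance : FiberBundle S₀ (Fiber S₀) := (frames S₀).toPrebundle.toFiberBundle

instance : VectorBundle ℝ S₀ (Fiber S₀) := (frames S₀).toPrebundle.toVectorBundle

instance : ContMDiffVectorBundle ∞ S₀ (Fiber S₀)
    𝓘(ℝ, QuotientModel (Skew (H →L[ℂ] H)) (isotropy S₀)) :=
  letI := (frames S₀).isContMDiff
  (frames S₀).toPrebundle.contMDiffVectorBundle
    𝓘(ℝ, QuotientModel (Skew (H →L[ℂ] H)) (isotropy S₀))

/-- The map `U(H) × S₀ → 𝒯_{S₀}(H)`, `(u, x) ↦ (uS₀, ux)`, onto the total space of the tautological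
bundle. -/
noncomputable def quot (p : unitary (H →L[ℂ] H) × S₀) : TotalSpace S₀ (Fiber S₀) :=
  ⟨mk S₀ p.1, ⟨(p.1 : H →L[ℂ] H) p.2, p.2, p.2.2, rfl⟩⟩

/-- Smoothness of a map from a manifold modelled on `EB` to the component `Gr_{S₀}(H)` of the
Grassmannian. -/
def IsSmooth (EB : Type*) [NormedAddCommGroup EB] [NormedSpace ℝ EB] {M : Type*} [TopologicalSpace M]
    [ChartedSpace EB M] (f : M → Gr S₀) : Prop :=
  ContMDiff 𝓘(ℝ, EB) 𝓘(ℝ, QuotientModel (Skew (H →L[ℂ] H)) (isotropy S₀)) ∞ f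

end Gr

end Grassmannian

section Kernels

open Bundle
open scoped ComplexOrder

/-- A positive definite kernel on a family of Hermitian fibres `E s`, `s ∈ M`: bounded operators
`K(s, t) : E t → E s` with `∑ (K(t_l, t_j) η_j | η_l) ≥ 0` for all finite families `η_j ∈ E (t_j)`. -/
structure PosDefKernel {M : Type*} (E : M → Type*) [∀ s, NormedAddCommGroup (E s)]
    [∀ s, InnerProductSpace ℂ (E s)] where
  K : ∀ s t, E t →L[ℂ] E s
  pos : ∀ (n : ℕ) (t : Fin n → M) (η : ∀ j, E (t j)),
    0 ≤ ∑ j, ∑ l, inner ℂ (η l) (K (t l) (t j) (η j))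

namespace PosDefKernel

variable {M : Type*} {E : M → Type*} [∀ s, NormedAddCommGroup (E s)]
  [∀ s, InnerProductSpace ℂ (E s)] (k : PosDefKernel E)

theorem conj_symm (s t : M) (ξ : E s) (η : E t) :
    (starRingEnd ℂ) (inner ℂ ξ (k.K s t η)) = inner ℂ η (k.K t s ξ) := by
  have single : ∀ (r : M) (x : E r), (inner ℂ x (k.K r r x)).im = 0 := by
    intro r x
    have h := k.pos 1 (fun _ => r) (fun _ => x)
    simp only [Fin.sum_univ_one] at h
    exact (Complex.le_def.1 h).2.symm
  have key : ∀ c : ℂ, (c * inner ℂ ξ (k.K s t η) +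
      (starRingEnd ℂ) c * inner ℂ η (k.K t s ξ)).im = 0 := by
    intro c
    have h := k.pos 2 (Fin.cons s (fun _ => t))
      (Fin.cons (α := fun j => E (Fin.cons (α := fun _ => M) s (fun _ => t) j)) ξ
        (fun _ => (c • η : E t)))
    simp only [Fin.sum_univ_two] at h
    have h' : 0 ≤ inner ℂ ξ (k.K s s ξ) + inner ℂ (c • η) (k.K t s ξ) +
      (inner ℂ ξ (k.K s t (c • η)) + inner ℂ (c • η) (k.K t t (c • η))) := h
    have him := (Complex.le_def.1 h').2
    simp only [Complex.add_im, single, map_smul, inner_smul_right, inner_smul_left,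
      Complex.zero_im] at him
    have h4 := single t (c • η)
    simp only [map_smul, inner_smul_right, inner_smul_left] at h4
    simp only [Complex.add_im]
    rw [h4] at him
    linarith
  have k1 := key 1
  have k2 := key Complex.I
  simp at k1 k2
  apply Complex.ext
  · rw [Complex.conj_re]; linarith
  · rw [Complex.conj_im]; linarith

/-- The sesquilinear form on formal linear combinations `∑ c_ξ K_ξ` of the sections
`K_ξ = K(·, Π(ξ))ξ` which is determined by `⟪K_ξ, K_η⟫ = ⟪ξ, K(Π(ξ), Π(η))η⟫`. -/
noncomputable def form (f g : (Σ s, E s) →₀ ℂ) : ℂ :=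
  f.sum fun ξ c => g.sum fun η d => (starRingEnd ℂ) c * d * inner ℂ ξ.2 (k.K ξ.1 η.1 η.2)

theorem form_symm (f g : (Σ s, E s) →₀ ℂ) : (starRingEnd ℂ) (k.form g f) = k.form f g := by
  rw [form, form, Finsupp.sum_comm]
  simp only [map_finsuppSum, map_mul, Complex.conj_conj, k.conj_symm]
  exact Finsupp.sum_congr fun ξ _ => Finsupp.sum_congr fun η _ => by ring

theorem form_add (f g h : (Σ s, E s) →₀ ℂ) : k.form (f + g) h = k.form f h + k.form g h := by
  rw [form, Finsupp.sum_add_index'] <;> simp [form, ← Finsupp.sum_add, add_mul]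

theorem form_smul (f g : (Σ s, E s) →₀ ℂ) (c : ℂ) :
    k.form (c • f) g = (starRingEnd ℂ) c * k.form f g := by
  rw [form, Finsupp.sum_smul_index] <;> simp [form, Finsupp.mul_sum, ← mul_assoc]

theorem form_nonneg (f : (Σ s, E s) →₀ ℂ) : 0 ≤ (k.form f f).re := by
  let e := f.support.equivFin
  have h := k.pos f.support.card (fun j => (e.symm j).1.1)
    (fun j => f (e.symm j).1 • (e.symm j).1.2)
  have h2 : ∑ j, ∑ l, inner ℂ (f (e.symm l).1 • (e.symm l).1.2)
      (k.K (e.symm l).1.1 (e.symm j).1.1 (f (e.symm j).1 • (e.symm j).1.2)) = k.form f f := by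
    rw [Finset.sum_comm, form, Finsupp.sum, ← Finset.sum_coe_sort f.support]
    refine Fintype.sum_equiv e.symm _ _ fun l => ?_
    rw [Finsupp.sum, ← Finset.sum_coe_sort f.support]
    refine Fintype.sum_equiv e.symm _ _ fun j => ?_
    rw [map_smul, inner_smul_right, inner_smul_left]; ring
  rw [h2] at h
  exact (Complex.le_def.1 h).1

/-- The space of formal linear combinations of the sections `K_ξ`, with the scalar product given by
the kernel. -/
def Span {M : Type*} {E : M → Type*} [∀ s, NormedAddCommGroup (E s)]
    [∀ s, InnerProductSpace ℂ (E s)] (_k : PosDefKernel E) : Type _ := (Σ s, E s) →₀ ℂ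

noncomputable instance : AddCommGroup k.Span := inferInstanceAs (AddCommGroup ((Σ s, E s) →₀ ℂ))

noncomputable instance : Module ℂ k.Span := inferInstanceAs (Module ℂ ((Σ s, E s) →₀ ℂ))

noncomputable instance core : PreInnerProductSpace.Core ℂ k.Span where
  inner f g := k.form f g
  conj_inner_symm f g := k.form_symm f g
  add_left f g h := k.form_add f g h
  smul_left f g c := k.form_smul f g c
  re_inner_nonneg f := k.form_nonneg f

noncomputable instance : SeminormedAddCommGroup k.Span :=
  InnerProductSpace.Core.toSeminormedAddCommGroup (𝕜 := ℂ)

noncomputable instance : InnerProductSpace ℂ k.Span := .ofCore _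

/-- The reproducing kernel Hilbert space `H^K`: the completion of the span of the `K_ξ`. -/
abbrev Space : Type _ := UniformSpace.Completion k.Span

/-- The element `K_ξ` of the space of formal linear combinations. -/
noncomputable def single (s : M) (ξ : E s) : k.Span := Finsupp.single (⟨s, ξ⟩ : Σ s, E s) (1 : ℂ)

/-- The map `K̂ : ξ ↦ K_ξ`. -/
noncomputable def hat (s : M) (ξ : E s) : k.Space := UniformSpace.Completion.coe' (k.single s ξ)

theorem inner_hat (s t : M) (ξ : E s) (η : E t) :
    inner ℂ (k.hat s ξ) (k.hat t η) = inner ℂ ξ (k.K s t η) := by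
  rw [hat, hat, UniformSpace.Completion.inner_coe]
  change k.form (Finsupp.single _ 1) (Finsupp.single _ 1) = _
  simp [form]

/-- The map `ζ_K`, `s ↦ closure of K̂(E s)`. (As `K̂` is linear on the fibre `E s`, the set `K̂(E s)` is
a linear subspace.) -/
noncomputable def ζ (s : M) : Submodule ℂ k.Space :=
  (Submodule.span ℂ (range (k.hat s))).topologicalClosure

theorem hat_mem_ζ (s : M) (ξ : E s) : k.hat s ξ ∈ k.ζ s :=
  Submodule.le_topologicalClosure _ (Submodule.subset_span (mem_range_self ξ))

/-- The map `ζ_K` with values in a component of the Grassmannian of `H^K`. -/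
noncomputable def ζGr (S₀ : Submodule ℂ k.Space) (h : ∀ s, ∃ u, unitaryImage u S₀ = k.ζ s) (s : M) :
    Gr S₀ := ⟨k.ζ s, h s⟩

/-- The map `δ_K = (ζ_K ∘ Π, K̂)` of the total spaces. -/
noncomputable def δ {F : Type*} (S₀ : Submodule ℂ k.Space)
    (h : ∀ s, ∃ u, unitaryImage u S₀ = k.ζ s) (ξ : TotalSpace F E) :
    TotalSpace S₀ (Gr.Fiber S₀) := ⟨k.ζGr S₀ h ξ.1, ⟨k.hat ξ.1 ξ.2, k.hat_mem_ζ ξ.1 ξ.2⟩⟩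

end PosDefKernel

end Kernels

section Connections

open Bundle

variable (EB : Type*) [NormedAddCommGroup EB] [NormedSpace ℝ EB]
  {M : Type*} [TopologicalSpace M] [ChartedSpace EB M]
  (F : Type*) [NormedAddCommGroup F] [NormedSpace ℂ F]
  (E : M → Type*) [∀ s, NormedAddCommGroup (E s)] [∀ s, NormedSpace ℂ (E s)]
  [TopologicalSpace (TotalSpace F E)] [FiberBundle F E] [VectorBundle ℝ F E]
  [IsManifold 𝓘(ℝ, EB) ∞ M] [ContMDiffVectorBundle ∞ F E 𝓘(ℝ, EB)]

/-- The tangent manifold `TD` of the total space `D` of a vector bundle. -/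
abbrev TangentTotal : Type _ := TangentBundle (𝓘(ℝ, EB).prod 𝓘(ℝ, F)) (TotalSpace F E)

/-- A connection on the bundle `π : D → Z` (`D = TotalSpace F E`): a smooth map `Φ : TD → TD` with
`Φ ∘ Φ = Φ` which restricts, for every `x ∈ D`, to a bounded linear operator on `T_x D` with range
`Ker (T_x π)`. -/
structure IsConnection (Φ : TangentTotal EB F E → TangentTotal EB F E) : Prop where
  contMDiff : ContMDiff (𝓘(ℝ, EB).prod 𝓘(ℝ, F)).tangent (𝓘(ℝ, EB).prod 𝓘(ℝ, F)).tangent ∞ Φ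
  idempotent : ∀ w, Φ (Φ w) = Φ w
  fibrewise : ∀ x : TotalSpace F E,
    ∃ L : TangentSpace (𝓘(ℝ, EB).prod 𝓘(ℝ, F)) x →L[ℝ] TangentSpace (𝓘(ℝ, EB).prod 𝓘(ℝ, F)) x,
      (∀ v, Φ ⟨x, v⟩ = ⟨x, L v⟩) ∧ (range L : Set _) = {v | mfderiv (𝓘(ℝ, EB).prod 𝓘(ℝ, F)) 𝓘(ℝ, EB)
        (TotalSpace.proj : TotalSpace F E → M) x v = 0}

variable {F E} in
/-- Multiplication by a scalar in the fibres of a vector bundle. -/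
def fibreSMul (c : ℂ) (ξ : TotalSpace F E) : TotalSpace F E := ⟨ξ.1, c • ξ.2⟩

variable {F E} in
/-- Addition in the fibres of a vector bundle, as a map on the Whitney sum `D ⊕ D`. -/
def fibreAdd (ξ : TotalSpace (F × F) (E ×ᵇ E)) : TotalSpace F E := ⟨ξ.1, ξ.2.1 + ξ.2.2⟩

variable {F E} in
/-- The projections of the Whitney sum `D ⊕ D`. -/
def fibreFst (ξ : TotalSpace (F × F) (E ×ᵇ E)) : TotalSpace F E := ⟨ξ.1, ξ.2.1⟩

variable {F E} in
/-- The projections of the Whitney sum `D ⊕ D`. -/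
def fibreSnd (ξ : TotalSpace (F × F) (E ×ᵇ E)) : TotalSpace F E := ⟨ξ.1, ξ.2.2⟩

/-- A linear connection on a complex vector bundle `D → Z`: a connection which is linear on the
fibres of the vector bundle `Tπ : TD → TZ`. The linear structure of these fibres is given by the
tangent maps of the scalar multiplications of `D` and of the addition `D ⊕ D → D`, where `T(D ⊕ D)`
is the fibre product of `TD` with itself over `TZ`. -/
structure IsLinearConnection (Φ : TangentTotal EB F E → TangentTotal EB F E) : Prop
    extends IsConnection EB F E Φ where
  smul : ∀ (c : ℂ) (w : TangentTotal EB F E),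
    Φ (tangentMap (𝓘(ℝ, EB).prod 𝓘(ℝ, F)) (𝓘(ℝ, EB).prod 𝓘(ℝ, F)) (fibreSMul c) w) =
      tangentMap (𝓘(ℝ, EB).prod 𝓘(ℝ, F)) (𝓘(ℝ, EB).prod 𝓘(ℝ, F)) (fibreSMul c) (Φ w)
  add : ∀ w w' : TangentBundle (𝓘(ℝ, EB).prod 𝓘(ℝ, F × F)) (TotalSpace (F × F) (E ×ᵇ E)),
    Φ (tangentMap (𝓘(ℝ, EB).prod 𝓘(ℝ, F × F)) (𝓘(ℝ, EB).prod 𝓘(ℝ, F)) fibreFst w) =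
      tangentMap (𝓘(ℝ, EB).prod 𝓘(ℝ, F × F)) (𝓘(ℝ, EB).prod 𝓘(ℝ, F)) fibreFst w' →
    Φ (tangentMap (𝓘(ℝ, EB).prod 𝓘(ℝ, F × F)) (𝓘(ℝ, EB).prod 𝓘(ℝ, F)) fibreSnd w) =
      tangentMap (𝓘(ℝ, EB).prod 𝓘(ℝ, F × F)) (𝓘(ℝ, EB).prod 𝓘(ℝ, F)) fibreSnd w' →
    Φ (tangentMap (𝓘(ℝ, EB).prod 𝓘(ℝ, F × F)) (𝓘(ℝ, EB).prod 𝓘(ℝ, F)) fibreAdd w) =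
      tangentMap (𝓘(ℝ, EB).prod 𝓘(ℝ, F × F)) (𝓘(ℝ, EB).prod 𝓘(ℝ, F)) fibreAdd w'

variable (EB' : Type*) [NormedAddCommGroup EB'] [NormedSpace ℝ EB']
  {M' : Type*} [TopologicalSpace M'] [ChartedSpace EB' M']
  (F' : Type*) [NormedAddCommGroup F'] [NormedSpace ℂ F']
  (E' : M' → Type*) [∀ s, NormedAddCommGroup (E' s)] [∀ s, NormedSpace ℂ (E' s)]
  [TopologicalSpace (TotalSpace F' E')] [FiberBundle F' E'] [VectorBundle ℝ F' E']
  [IsManifold 𝓘(ℝ, EB') ∞ M'] [ContMDiffVectorBundle ∞ F' E' 𝓘(ℝ, EB')]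

/-- `Φ` is the pull-back `Θ^*(Φ')` of the connection `Φ'` through the morphism of vector bundles
`Θ = (δ, ζ)`, which is smooth and fibrewise a linear homeomorphism: `Φ` is the unique connection with
`Tδ ∘ Φ = Φ' ∘ Tδ`. -/
structure IsPullbackConnection (δ : TotalSpace F E → TotalSpace F' E') (ζ : M → M')
    (Φ' : TangentTotal EB' F' E' → TangentTotal EB' F' E')
    (Φ : TangentTotal EB F E → TangentTotal EB F E) : Prop where
  contMDiff_δ : ContMDiff (𝓘(ℝ, EB).prod 𝓘(ℝ, F)) (𝓘(ℝ, EB').prod 𝓘(ℝ, F')) ∞ δ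
  contMDiff_ζ : ContMDiff 𝓘(ℝ, EB) 𝓘(ℝ, EB') ∞ ζ
  fibrewise_iso : ∀ s, ∃ A : E s ≃L[ℂ] E' (ζ s), ∀ x, δ ⟨s, x⟩ = ⟨ζ s, A x⟩
  isConnection : IsConnection EB F E Φ
  isConnection' : IsConnection EB' F' E' Φ'
  comm : ∀ w, tangentMap (𝓘(ℝ, EB).prod 𝓘(ℝ, F)) (𝓘(ℝ, EB').prod 𝓘(ℝ, F')) δ (Φ w) =
    Φ' (tangentMap (𝓘(ℝ, EB).prod 𝓘(ℝ, F)) (𝓘(ℝ, EB').prod 𝓘(ℝ, F')) δ w)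
  unique : ∀ Ψ, IsConnection EB F E Ψ →
    (∀ w, tangentMap (𝓘(ℝ, EB).prod 𝓘(ℝ, F)) (𝓘(ℝ, EB').prod 𝓘(ℝ, F')) δ (Ψ w) =
      Φ' (tangentMap (𝓘(ℝ, EB).prod 𝓘(ℝ, F)) (𝓘(ℝ, EB').prod 𝓘(ℝ, F')) δ w)) → Ψ = Φ

end Connections

section Universal

open Bundle

variable {H : Type*} [NormedAddCommGroup H] [InnerProductSpace ℂ H] [CompleteSpace H]

/-- The conditional expectation `E_p(X) = pXp + (1-p)X(1-p)` of the orthogonal projection `p` onto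
`S₀`. -/
noncomputable def expectation (S₀ : Submodule ℂ H) [CompleteSpace S₀] (X : H →L[ℂ] H) : H →L[ℂ] H :=
  S₀.starProjection * X * S₀.starProjection +
    (1 - S₀.starProjection) * X * (1 - S₀.starProjection)

theorem expectation_apply_mem (S₀ : Submodule ℂ H) [CompleteSpace S₀] (X : H →L[ℂ] H) (x : S₀) :
    expectation S₀ X x ∈ S₀ := by
  have h : (1 - S₀.starProjection) (x : H) = 0 := by
    rw [sub_apply, Submodule.starProjection_eq_self_iff.2 x.2]
    exact sub_self _
  have h2 : expectation S₀ X x = S₀.starProjection (X (S₀.starProjection x)) +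
      (1 - S₀.starProjection) (X ((1 - S₀.starProjection) x)) := rfl
  rw [h2, h, map_zero, map_zero, add_zero]
  exact Submodule.starProjection_apply_mem _ _

/-- The element of `u(H) ⊆ B(H)` which corresponds to an element of the Lie algebra `T_1 U(H)`. -/
noncomputable def unitaryLieOp (X : GroupLieAlgebra 𝓘(ℝ, Skew (H →L[ℂ] H)) (unitary (H →L[ℂ] H))) :
    H →L[ℂ] H :=
  mfderiv 𝓘(ℝ, Skew (H →L[ℂ] H)) 𝓘(ℝ, H →L[ℂ] H)
    (fun u : unitary (H →L[ℂ] H) => (u : H →L[ℂ] H)) 1 X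

/-- The tangent vector `[((u, X), (x, y))]` of the total space of the tautological bundle: the image
of `(u, X) = T_1(λ_u)X` and `(x, y)` under the tangent map of `(u, x) ↦ (uS₀, ux)`. -/
noncomputable def Gr.tangentCls (S₀ : Submodule ℂ H) [CompleteSpace S₀] (u : unitary (H →L[ℂ] H))
    (X : GroupLieAlgebra 𝓘(ℝ, Skew (H →L[ℂ] H)) (unitary (H →L[ℂ] H))) (x y : S₀) :
    TangentTotal (QuotientModel (Skew (H →L[ℂ] H)) (isotropy S₀)) S₀ (Gr.Fiber S₀) :=
  tangentMap (𝓘(ℝ, Skew (H →L[ℂ] H)).prod 𝓘(ℝ, S₀))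
    (𝓘(ℝ, QuotientModel (Skew (H →L[ℂ] H)) (isotropy S₀)).prod 𝓘(ℝ, S₀)) (Gr.quot S₀)
    ⟨(u, x), (mulInvariantVectorField X u, y)⟩

/-- The universal connection on the tautological bundle over `Gr_{S₀}(H)`:
`[((u, X), (x, y))] ↦ [((u, 0), (x, E_p(X)x + y))]`. -/
def IsUniversalConnection (S₀ : Submodule ℂ H) [CompleteSpace S₀]
    (Φ : TangentTotal (QuotientModel (Skew (H →L[ℂ] H)) (isotropy S₀)) S₀ (Gr.Fiber S₀) →
      TangentTotal (QuotientModel (Skew (H →L[ℂ] H)) (isotropy S₀)) S₀ (Gr.Fiber S₀)) : Prop :=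
  ∀ u X x y, Φ (Gr.tangentCls S₀ u X x y) = Gr.tangentCls S₀ u 0 x
    (⟨expectation S₀ (unitaryLieOp X) x, expectation_apply_mem S₀ _ x⟩ + y)

end Universal

namespace HomogeneousData

open Bundle
open scoped ComplexOrder

variable {E : Type*} {G : Type*} [TopologicalSpace G] [Group G] {B : Subgroup G}
  {HA : Type*} [NormedAddCommGroup HA] [InnerProductSpace ℂ HA] [CompleteSpace HA]
  (R : HomogeneousData E B HA)

theorem opB_proj (b : G) (hb : b ∈ B) (x : HA) :
    R.opB b hb (R.HB.orthogonalProjectionOnto x) = R.HB.orthogonalProjectionOnto (R.op b x) := by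
  refine ext_inner_left ℂ fun f => ?_
  obtain ⟨f, rfl⟩ := (R.opB b hb).surjective f
  rw [LinearIsometryEquiv.inner_map_map, Submodule.inner_orthogonalProjectionOnto_eq_of_mem_left,
    Submodule.inner_orthogonalProjectionOnto_eq_of_mem_left]
  exact (R.inner_op b f x).symm

/-- The kernel `K_ρ` for chosen representatives of the cosets. -/
noncomputable def kernelOp (s t : G ⧸ B) : R.Fiber t →L[ℂ] R.Fiber s :=
  ((R.frame s s.out (Quotient.out_eq' s)).toContinuousLinearEquiv : R.HB →L[ℂ] R.Fiber s) ∘L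
    sandwich R.HB.orthogonalProjectionOnto R.HB.subtypeL (R.op s.out⁻¹ * R.op t.out) ∘L
      ((R.frame t t.out (Quotient.out_eq' t)).symm.toContinuousLinearEquiv :
        R.Fiber t →L[ℂ] R.HB)

theorem inner_kernelOp (s t : G ⧸ B) (ξ : R.Fiber s) (η : R.Fiber t) :
    inner ℂ ξ (R.kernelOp s t η) =
      inner ℂ (R.op s.out ((R.frame s s.out (Quotient.out_eq' s)).symm ξ : HA))
        (R.op t.out ((R.frame t t.out (Quotient.out_eq' t)).symm η : HA)) := by
  obtain ⟨f, rfl⟩ := (R.frame s s.out (Quotient.out_eq' s)).surjective ξ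
  obtain ⟨f', rfl⟩ := (R.frame t t.out (Quotient.out_eq' t)).surjective η
  rw [LinearIsometryEquiv.symm_apply_apply, LinearIsometryEquiv.symm_apply_apply]
  have h1 : R.kernelOp s t (R.frame t t.out (Quotient.out_eq' t) f') =
      R.frame s s.out (Quotient.out_eq' s) (R.HB.orthogonalProjectionOnto
        (R.op s.out⁻¹ (R.op t.out f'))) := by
    change R.frame s s.out (Quotient.out_eq' s) (R.HB.orthogonalProjectionOnto (R.op s.out⁻¹ (R.op t.out
      (((R.frame t t.out (Quotient.out_eq' t)).symm
        (R.frame t t.out (Quotient.out_eq' t) f') : R.HB) : HA)))) = _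
    rw [LinearIsometryEquiv.symm_apply_apply]
  rw [h1, LinearIsometryEquiv.inner_map_map, ← R.inner_op s.out⁻¹ (R.op s.out f), ← op_mul_apply,
    ← op_mul_apply, inv_mul_cancel, op_one_apply]
  exact Submodule.inner_orthogonalProjectionOnto_eq_of_mem_left f _

/-- The reproducing kernel `K_ρ` of the homogeneous bundle,
`K_ρ(uB, vB)[(v, f)] = [(u, P(ρ(u⁻¹)ρ(v)f))]`. -/
noncomputable def kernel : PosDefKernel R.Fiber where
  K := R.kernelOp
  pos n t η := by
    simp only [inner_kernelOp, ← inner_sum, ← sum_inner]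
    rw [inner_self_eq_norm_sq_to_K]
    norm_cast
    exact Complex.zero_le_real.2 (sq_nonneg _)

/-- The defining formula of `K_ρ` holds for all representatives of the cosets. -/
theorem kernel_apply (s t : G ⧸ B) (u v : G) (hu : (u : G ⧸ B) = s) (hv : (v : G ⧸ B) = t)
    (f : R.HB) : R.kernel.K s t (R.frame t v hv f) =
      R.frame s u hu (R.HB.orthogonalProjectionOnto (R.op u⁻¹ (R.op v f))) := by
  have h1 : R.frame t v hv f = R.frame t t.out (Quotient.out_eq' t)
      (R.opB (t.out⁻¹ * v) (QuotientGroup.eq.1 (by rw [hv]; exact Quotient.out_eq' t)) f) := by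
    refine Subtype.ext ?_
    rw [frame_apply, frame_apply, ← cls_mul, mul_inv_cancel_left]
  have h2 : ∀ f', R.frame s u hu f' = R.frame s s.out (Quotient.out_eq' s)
      (R.opB (s.out⁻¹ * u) (QuotientGroup.eq.1 (by rw [hu]; exact Quotient.out_eq' s)) f') := by
    intro f'
    refine Subtype.ext ?_
    rw [frame_apply, frame_apply, ← cls_mul, mul_inv_cancel_left]
  rw [h1, h2, R.opB_proj]
  change R.frame s s.out (Quotient.out_eq' s) (R.HB.orthogonalProjectionOnto (R.op s.out⁻¹ (R.op t.out
    (((R.frame t t.out (Quotient.out_eq' t)).symm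
      (R.frame t t.out (Quotient.out_eq' t) _) : R.HB) : HA)))) = _
  rw [LinearIsometryEquiv.symm_apply_apply]
  change R.frame s s.out _ (R.HB.orthogonalProjectionOnto
    (R.op s.out⁻¹ (R.op t.out (R.op (t.out⁻¹ * v) f)))) = _
  simp only [← op_mul_apply]
  congr 4
  group

/-- The map `[(u, f)] ↦ ρ(u)f`. -/
noncomputable def toHA : R.Balanced → HA :=
  Quotient.lift (fun p : G × R.HB => R.op p.1 p.2) (by
    rintro ⟨g, f⟩ ⟨g', f'⟩ ⟨w, hw, h1, h2⟩
    simp only at h1 h2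
    simp only [h1, h2, ← op_mul_apply, mul_inv_cancel_right])

/-- The map `ζ_ρ : uB ↦ ρ(u)HB`. -/
noncomputable def ζ : G ⧸ B → Gr R.HB :=
  Quotient.lift (fun u => Gr.mk R.HB (R.ρ u)) (by
    intro u v h
    rw [Gr.mk_eq_iff, ← map_inv, ← map_mul]
    have hw : u⁻¹ * v ∈ B := QuotientGroup.leftRel_apply.1 h
    refine le_antisymm ?_ ?_
    · rintro _ ⟨f, hf, rfl⟩
      exact R.invariant _ hw f hf
    · intro f hf
      refine ⟨R.op (u⁻¹ * v)⁻¹ f, R.invariant _ (B.inv_mem hw) f hf, ?_⟩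
      change R.op (u⁻¹ * v) (R.op (u⁻¹ * v)⁻¹ f) = f
      rw [← op_mul_apply, mul_inv_cancel, op_one_apply])

theorem toHA_mem (s : G ⧸ B) (ξ : R.Fiber s) : R.toHA ξ.1 ∈ (R.ζ s).1 := by
  obtain ⟨ξ, rfl⟩ := ξ
  obtain ⟨⟨u, f⟩, rfl⟩ := Quotient.exists_rep ξ
  exact ⟨f, f.2, rfl⟩

/-- The map `δ_ρ : [(u, f)] ↦ (ρ(u)HB, ρ(u)f)`. -/
noncomputable def δ (ξ : TotalSpace R.HB R.Fiber) : TotalSpace R.HB (Gr.Fiber R.HB) :=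
  ⟨R.ζ ξ.1, ⟨R.toHA ξ.2.1, R.toHA_mem ξ.1 ξ.2⟩⟩

variable [NormedAddCommGroup E] [NormedSpace ℝ E] [CompleteSpace E] [ChartedSpace E G]
  [LieGroup 𝓘(ℝ, E) ∞ G] [IsBanachLieSubgroup (E := E) B]

/-- The derived representation `dρ` of the Lie algebra of `G`. -/
noncomputable def dρ (X : GroupLieAlgebra 𝓘(ℝ, E) G) : HA →L[ℂ] HA :=
  mfderiv 𝓘(ℝ, E) 𝓘(ℝ, HA →L[ℂ] HA) R.op 1 X

/-- The tangent vector `[((g, X), (f, h))]` of the total space `D = G ×_B HB`: the image of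
`(g, X) = T_1(λ_g)X` and `(f, h)` under the tangent map of the quotient map `G × HB → D`. -/
noncomputable def tangentCls (g : G) (X : GroupLieAlgebra 𝓘(ℝ, E) G) (f h : R.HB) :
    TangentTotal (QuotientModel E B) R.HB R.Fiber :=
  tangentMap (𝓘(ℝ, E).prod 𝓘(ℝ, R.HB)) (𝓘(ℝ, QuotientModel E B).prod 𝓘(ℝ, R.HB)) R.quot
    ⟨(g, f), (mulInvariantVectorField X g, h)⟩

/-- The natural connection on the homogeneous bundle:
`[((g, X), (f, h))] ↦ [((g, 0), (f, P(dρ(X)f) + h))]`. -/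
def IsNaturalConnection (Φ : TangentTotal (QuotientModel E B) R.HB R.Fiber →
    TangentTotal (QuotientModel E B) R.HB R.Fiber) : Prop :=
  ∀ g X f h, Φ (R.tangentCls g X f h) =
    R.tangentCls g 0 f (R.HB.orthogonalProjectionOnto (R.dρ X f) + h)

end HomogeneousData

section Admissible

open Bundle

/-- Admissibility of a positive definite kernel `K` on a Hermitian bundle (for which `ζ_K` takes its
values in the component `Gr_{S₀}(H^K)` of the Grassmannian): `K` is a smooth section of the bundle
`Hom(p₂^*Π, p₁^*Π)`, the operators `K(s, s)` are invertible, and `ζ_K` is smooth. -/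
structure PosDefKernel.IsAdmissible (EB : Type*) [NormedAddCommGroup EB] [NormedSpace ℝ EB]
    {M : Type*} [TopologicalSpace M] [ChartedSpace EB M]
    (F : Type*) [NormedAddCommGroup F] [NormedSpace ℂ F]
    {E : M → Type*} [∀ s, NormedAddCommGroup (E s)] [∀ s, InnerProductSpace ℂ (E s)]
    [TopologicalSpace (TotalSpace F E)] [FiberBundle F E] [VectorBundle ℝ F E]
    (k : PosDefKernel E) (S₀ : Submodule ℂ k.Space) [CompleteSpace S₀]
    (h : ∀ s, ∃ u, unitaryImage u S₀ = k.ζ s) : Prop where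
  smooth : ∀ s₀ t₀ : M, ContMDiffAt (𝓘(ℝ, EB).prod 𝓘(ℝ, EB)) 𝓘(ℝ, F →L[ℝ] F) ∞
    (fun p : M × M => ContinuousLinearMap.inCoordinates F E F E t₀ p.2 s₀ p.1
      ((k.K p.1 p.2).restrictScalars ℝ)) (s₀, t₀)
  isUnit : ∀ s, IsUnit (k.K s s)
  isSmooth_ζ : Gr.IsSmooth S₀ EB (k.ζGr S₀ h)

end Admissible

set_option linter.unusedSectionVars false

/-! ### Homogeneous bundles evaluated in a Hilbert space: points and smoothness. -/

section HomogeneousBundles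

open Bundle

variable {E : Type*} [NormedAddCommGroup E] [NormedSpace ℝ E]
  {G : Type*} [TopologicalSpace G] [ChartedSpace E G] [Group G] [LieGroup 𝓘(ℝ, E) ∞ G]
  {EB : Type*} [NormedAddCommGroup EB] [NormedSpace ℝ EB]
  {Z : Type*} [TopologicalSpace Z] [ChartedSpace EB Z] [IsManifold 𝓘(ℝ, EB) ∞ Z]
  {H : Type*} [NormedAddCommGroup H] [InnerProductSpace ℂ H] [CompleteSpace H]
  {S : Submodule ℂ H} [CompleteSpace S]
  {D : Z → Type*} [∀ z, NormedAddCommGroup (D z)] [∀ z, NormedSpace ℂ (D z)]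
  [TopologicalSpace (TotalSpace S D)] [FiberBundle S D] [VectorBundle ℝ S D]
  [ContMDiffVectorBundle ∞ S D 𝓘(ℝ, EB)]

/-! The natural and the universal connection are two cases of one construction, and that
construction is natural under isometries.

Both bundles come with an evaluation of their fibres in a Hilbert space `H`: `[(g, f)] ↦ ρ(g)f` for
`G ×_B HB`, the inclusion `S ⊆ H` for the tautological bundle. Both are homogeneous: the fibre over
`p g` is evaluated bijectively onto `U(g)S`. This common situation is `IsHomogeneousBundle`.
Differentiating the evaluation sends a tangent vector `w` at `ξ` to a vector of `H`. Project that
vector orthogonally onto the evaluated fibre through `ξ`; there is exactly one vertical vector at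
`ξ` whose image is the projection. Calling it the vertical part of `w` defines `verticalPart`, with
no reference to representatives of classes.

On classes the Leibniz rule gives the image `U(g)(dU(X)f + y)` for `[((g, X), (f, y))]`, and its
projection onto `U(g)S` is `U(g)(P dU(X)f + y)`. Hence the vertical part is `[((g, 0), (f, P dU(X)f
+ y))]`, which is the formula of the natural connection. It is also that of the universal
connection, because `E_p(X)x = pXx` for `x ∈ S₀`. Since classes exhaust the tangent bundle, the
formulas have exactly one solution (`eq_verticalPart_iff`). Vertical vectors are their own vertical
parts, local sections of `p` give a smooth expression, and the defining conditions are compatible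
with sums and scalar multiples in the fibres. So `verticalPart` is a linear connection
(`isLinearConnection_verticalPart`).

If a bundle morphism `(δ, ζ)`, bijective on the fibres, satisfies `ev' ∘ δ = V ∘ ev` with an
isometry `V`, then `V` preserves orthogonality to the fibres, so `Tδ` takes vertical parts to
vertical parts. This is the pull-back identity, and it determines the connection because `V` is
injective and vertical vectors are determined by their base point and image
(`isPullbackConnection`).

For `Δ_ρ` one takes `V = id`. For the kernel, `(K_ρ(s, t)η | ξ)` is the scalar product of the
evaluations of `η` and `ξ`; thus `K_ξ ↦ ev ξ` extends to an isometry of `H^K` into `HA`, which is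
onto because the translates of `HB` span a dense subspace. Its inverse `W` satisfies `W(ρ(g)HB) =
ζ_K(gB)` and `W ∘ ev = K̂`, so `δ_K` is again a morphism of the above kind. If `vS₀ = W(HB)`, then
`g ↦ Wρ(g)W⁻¹v` is a smooth lift of `ζ_K` to the unitary group, which yields the smoothness of `ζ_K`
and `δ_K`. Finally `K_ρ(s, s) = 1`, and in local frames `K_ρ` is a compression of `ρ(σ(s)⁻¹σ'(t))`,
hence smooth. -/

variable (E EB) in
/-- A vector bundle `D → Z` with typical fibre `S ⊆ H` which is homogeneous under `G`, embedded
fibrewise in the Hilbert space `H` through linear maps `ev`, and associated with a unitary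
representation `U` of `G` on `H`: the class `q (g, f)` over `p g` is sent to `U(g)f`. -/
structure IsHomogeneousBundle (U : G →* unitary (H →L[ℂ] H)) (p : G → Z)
    (q : G × S → TotalSpace S D) (ev : ∀ z, D z →ₗ[ℂ] H) : Prop where
  contMDiff_U : ContMDiff 𝓘(ℝ, E) 𝓘(ℝ, H →L[ℂ] H) ∞ fun g => (U g : H →L[ℂ] H)
  contMDiff_p : ContMDiff 𝓘(ℝ, E) 𝓘(ℝ, EB) ∞ p
  proj_q : ∀ x, (q x).1 = p x.1
  ev_q : ∀ g f, ev _ (q (g, f)).2 = (U g : H →L[ℂ] H) f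
  ev_injective : ∀ z, Function.Injective (ev z)
  exists_ev : ∀ g (η : D (p g)), ∃ f : S, ev _ η = (U g : H →L[ℂ] H) f
  -- The link between the group and the given bundle structure: the preferred trivialization at `z₀`
  -- is the one induced by a local section `σ` of `p`, so that `(σ z, y)` has fibre coordinate `y`.
  exists_section : ∀ z₀, ∃ σ : Z → G,
    ContMDiffOn 𝓘(ℝ, EB) 𝓘(ℝ, E) ∞ σ (trivializationAt S D z₀).baseSet ∧
    ∀ z ∈ (trivializationAt S D z₀).baseSet, p (σ z) = z ∧
      ∀ y, trivializationAt S D z₀ (q (σ z, y)) = (z, y)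

/-- The evaluation map on the total space. -/
def totalEval (ev : ∀ z, D z →ₗ[ℂ] H) (ξ : TotalSpace S D) : H := ev ξ.1 ξ.2

variable (EB) in
/-- The derivative of the evaluation map. -/
noncomputable def evalDeriv (ev : ∀ z, D z →ₗ[ℂ] H) (w : TangentTotal EB S D) : H :=
  mfderiv (𝓘(ℝ, EB).prod 𝓘(ℝ, S)) 𝓘(ℝ, H) (totalEval ev) w.1 w.2

variable (EB) in
/-- A tangent vector of the total space is vertical if it is annihilated by the tangent map of the
projection. -/
def IsVertical (w : TangentTotal EB S D) : Prop :=
  mfderiv (𝓘(ℝ, EB).prod 𝓘(ℝ, S)) 𝓘(ℝ, EB) (TotalSpace.proj : TotalSpace S D → Z) w.1 w.2 = 0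

variable (EB) in
/-- `w'` is the vertical tangent vector whose image under the derivative of the evaluation map is
the orthogonal projection of that of `w` to the fibre. -/
structure IsVerticalPart (ev : ∀ z, D z →ₗ[ℂ] H) (w w' : TangentTotal EB S D) : Prop where
  base : w'.1 = w.1
  vertical : IsVertical EB w'
  orthogonal : ∀ η : D w.1.1, inner ℂ (ev _ η) (evalDeriv EB ev w' - evalDeriv EB ev w) = 0

/-- The product of two tangent vectors. -/
abbrev prodTangent {EM : Type*} [NormedAddCommGroup EM] [NormedSpace ℝ EM] {M : Type*}
    [TopologicalSpace M] [ChartedSpace EM M] {F : Type*} [NormedAddCommGroup F] [NormedSpace ℝ F]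
    (g : M) (f : F) (X : TangentSpace 𝓘(ℝ, EM) g) (h : F) :
    TangentBundle (𝓘(ℝ, EM).prod 𝓘(ℝ, F)) (M × F) := ⟨(g, f), (X, h)⟩

namespace Unitary

theorem coe_inv_apply_apply (u : unitary (H →L[ℂ] H)) (x : H) :
    ((u⁻¹ : unitary (H →L[ℂ] H)) : H →L[ℂ] H) ((u : H →L[ℂ] H) x) = x :=
  congrArg (fun w : unitary (H →L[ℂ] H) => (w : H →L[ℂ] H) x) (inv_mul_cancel u)

theorem coe_apply_inv_apply (u : unitary (H →L[ℂ] H)) (x : H) :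
    (u : H →L[ℂ] H) (((u⁻¹ : unitary (H →L[ℂ] H)) : H →L[ℂ] H) x) = x :=
  congrArg (fun w : unitary (H →L[ℂ] H) => (w : H →L[ℂ] H) x) (mul_inv_cancel u)

theorem inner_coe_apply (u : unitary (H →L[ℂ] H)) (x y : H) :
    inner ℂ ((u : H →L[ℂ] H) x) ((u : H →L[ℂ] H) y) = inner ℂ x y :=
  (Unitary.linearIsometryEquiv u).inner_map_map x y

end Unitary

namespace IsHomogeneousBundle

variable {U : G →* unitary (H →L[ℂ] H)} {p : G → Z} {q : G × S → TotalSpace S D}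
  {ev : ∀ z, D z →ₗ[ℂ] H} (h : IsHomogeneousBundle E EB U p q ev)

include h

theorem totalEval_q (x : G × S) : totalEval ev (q x) = (U x.1 : H →L[ℂ] H) x.2 := h.ev_q x.1 x.2

/-- Evaluation is injective on each fibre, so identities between points of the bundle can be checked
in `H`. -/
theorem ext {ξ ξ' : TotalSpace S D} (h1 : ξ.1 = ξ'.1) (h2 : totalEval ev ξ = totalEval ev ξ') :
    ξ = ξ' := by
  obtain ⟨z, x⟩ := ξ
  obtain ⟨z', x'⟩ := ξ'
  obtain rfl : z = z' := h1
  exact congrArg (TotalSpace.mk z) (h.ev_injective z h2)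

/-- The fibre over `p g` is evaluated into `U(g)S`, so `U(g)⁻¹ ev ξ` already lies in `S`. The
projection changes nothing there; it turns the coordinate of `ξ` in the frame `g` into an expression
that is defined and smooth for all arguments. -/
theorem q_coord (g : G) (ξ : TotalSpace S D) (hg : p g = ξ.1) :
    q (g, S.orthogonalProjectionOnto ((U g⁻¹ : H →L[ℂ] H) (totalEval ev ξ))) = ξ := by
  obtain ⟨z, x⟩ := ξ
  obtain rfl : p g = z := hg
  refine h.ext (h.proj_q _) ?_
  obtain ⟨f, hf⟩ := h.exists_ev g x
  rw [h.totalEval_q]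
  change (U g : H →L[ℂ] H) _ = ev _ x
  have : totalEval ev (⟨p g, x⟩ : TotalSpace S D) = (U g : H →L[ℂ] H) f := hf
  rw [this, hf, map_inv, Unitary.coe_inv_apply_apply,
    Submodule.orthogonalProjectionOnto_mem_subspace_eq_self]

theorem coord_q (g : G) (f : S) :
    S.orthogonalProjectionOnto ((U g⁻¹ : H →L[ℂ] H) (totalEval ev (q (g, f)))) = f := by
  rw [h.totalEval_q, map_inv, Unitary.coe_inv_apply_apply,
    Submodule.orthogonalProjectionOnto_mem_subspace_eq_self]

theorem contMDiff_U_inv :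
    ContMDiff 𝓘(ℝ, E) 𝓘(ℝ, H →L[ℂ] H) ∞ fun g => (U g⁻¹ : H →L[ℂ] H) :=
  h.contMDiff_U.comp (contMDiff_inv 𝓘(ℝ, E) ∞)

omit h in
-- Restriction of scalars embeds the complex-linear operators continuously into the real-linear
-- ones, where the evaluation of operators is known to be smooth over `ℝ`.
theorem _root_.ContMDiffAt.complex_clm_apply {EM : Type*} [NormedAddCommGroup EM] [NormedSpace ℝ EM]
    {HM : Type*} [TopologicalSpace HM] {I : ModelWithCorners ℝ EM HM}
    {M : Type*} [TopologicalSpace M] [ChartedSpace HM M]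
    {F F' : Type*} [NormedAddCommGroup F] [NormedSpace ℂ F] [NormedAddCommGroup F']
    [NormedSpace ℂ F'] {A : M → F →L[ℂ] F'} {f : M → F} {x : M}
    (hA : ContMDiffAt I 𝓘(ℝ, F →L[ℂ] F') ∞ A x) (hf : ContMDiffAt I 𝓘(ℝ, F) ∞ f x) :
    ContMDiffAt I 𝓘(ℝ, F') ∞ (fun y => A y (f y)) x :=
  ContMDiffAt.clm_apply (g := fun y => (A y).restrictScalars ℝ)
    ((ContinuousLinearMap.restrictScalarsL ℂ F F' ℝ ℝ).contDiff.contMDiff.contMDiffAt.comp x hA) hf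

omit h in
theorem contMDiffAt_proj {EM : Type*} [NormedAddCommGroup EM] [NormedSpace ℝ EM]
    {HM : Type*} [TopologicalSpace HM] {I : ModelWithCorners ℝ EM HM}
    {M : Type*} [TopologicalSpace M] [ChartedSpace HM M] {f : M → H} {x : M}
    (hf : ContMDiffAt I 𝓘(ℝ, H) ∞ f x) :
    ContMDiffAt I 𝓘(ℝ, S) ∞ (fun y => S.orthogonalProjectionOnto (f y)) x :=
  (S.orthogonalProjectionOnto.restrictScalars ℝ).contDiff.contMDiff.contMDiffAt.comp x hf

/-- Near a point, `ξ = q(σ(πξ), y)` with `y` the fibre coordinate in the preferred trivialization,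
so the evaluation is `U(σ(πξ))y`. -/
theorem contMDiff_totalEval :
    ContMDiff (𝓘(ℝ, EB).prod 𝓘(ℝ, S)) 𝓘(ℝ, H) ∞ (totalEval (S := S) ev) := by
  intro ξ₀
  obtain ⟨σ, hσ, hσ'⟩ := h.exists_section ξ₀.1
  set e := trivializationAt S D ξ₀.1
  have hmem : ξ₀.1 ∈ e.baseSet := mem_baseSet_trivializationAt S D ξ₀.1
  have hsrc : ξ₀ ∈ e.source := e.mem_source.2 hmem
  have h1 : ContMDiffAt (𝓘(ℝ, EB).prod 𝓘(ℝ, S)) 𝓘(ℝ, E) ∞ (fun ξ : TotalSpace S D => σ ξ.1) ξ₀ :=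
    (hσ.contMDiffAt (e.open_baseSet.mem_nhds hmem)).comp ξ₀ (Bundle.contMDiffAt_proj D)
  have h2 : ContMDiffAt (𝓘(ℝ, EB).prod 𝓘(ℝ, S)) 𝓘(ℝ, S) ∞ (fun ξ : TotalSpace S D => (e ξ).2) ξ₀ :=
    contMDiffAt_snd.comp ξ₀ (e.contMDiffOn.contMDiffAt (e.open_source.mem_nhds hsrc))
  have h3 : ContMDiffAt (𝓘(ℝ, EB).prod 𝓘(ℝ, S)) 𝓘(ℝ, H) ∞
      (fun ξ : TotalSpace S D => (U (σ ξ.1) : H →L[ℂ] H) (e ξ).2) ξ₀ :=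
    ContMDiffAt.complex_clm_apply ((h.contMDiff_U _).comp ξ₀ h1)
      ((S.subtypeL.restrictScalars ℝ).contDiff.contMDiff.contMDiffAt.comp ξ₀ h2)
  refine h3.congr_of_eventuallyEq ?_
  filter_upwards [e.open_source.mem_nhds hsrc] with ξ hξ
  have hξ' := e.mem_source.1 hξ
  -- Both sides have the same image under `e`, by the choice of `σ`, and `e` is injective on its
  -- source.
  have hq : q (σ ξ.1, (e ξ).2) = ξ := by
    refine e.injOn (e.mem_source.2 ?_) hξ ?_
    · rw [h.proj_q, (hσ' _ hξ').1]; exact hξ'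
    · exact ((hσ' _ hξ').2 _).trans (e.mk_proj_snd hξ)
  conv_lhs => rw [← hq]
  rw [h.totalEval_q]

/-- Smooth local sections of `q`. -/
theorem exists_local_section (z₀ : Z) : ∃ σ : Z → G, ∃ u ∈ 𝓝 z₀,
    ContMDiffOn 𝓘(ℝ, EB) 𝓘(ℝ, E) ∞ σ u ∧ ∀ z ∈ u, p (σ z) = z := by
  obtain ⟨σ, hσ, hσ'⟩ := h.exists_section z₀
  exact ⟨σ, _, (trivializationAt S D z₀).open_baseSet.mem_nhds
    (mem_baseSet_trivializationAt S D z₀), hσ, fun z hz => (hσ' z hz).1⟩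

theorem surjective_p : Function.Surjective p := fun z => by
  obtain ⟨σ, u, hu, -, h2⟩ := h.exists_local_section z
  exact ⟨σ z, h2 z (mem_of_mem_nhds hu)⟩

/-- In the preferred trivialization the fibre coordinate of `q(g, f)` is `P U(σ(p g))⁻¹U(g)f`, a
smooth function of `(g, f)`. -/
theorem contMDiff_q : ContMDiff (𝓘(ℝ, E).prod 𝓘(ℝ, S)) (𝓘(ℝ, EB).prod 𝓘(ℝ, S)) ∞ q := by
  intro x₀
  rw [contMDiffAt_totalSpace]
  have hp : ContMDiff (𝓘(ℝ, E).prod 𝓘(ℝ, S)) 𝓘(ℝ, EB) ∞ (fun x : G × S => p x.1) :=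
    h.contMDiff_p.comp contMDiff_fst
  refine ⟨(hp x₀).congr_of_eventuallyEq (Eventually.of_forall h.proj_q), ?_⟩
  obtain ⟨σ, hσ, hσ'⟩ := h.exists_section (q x₀).1
  set e := trivializationAt S D (q x₀).1
  have hmem : p x₀.1 ∈ e.baseSet := by
    rw [← h.proj_q]; exact mem_baseSet_trivializationAt S D _
  have h1 : ContMDiffAt (𝓘(ℝ, E).prod 𝓘(ℝ, S)) 𝓘(ℝ, E) ∞ (fun x : G × S => σ (p x.1)) x₀ :=
    ContMDiffAt.comp x₀ (g := σ) (f := fun x : G × S => p x.1)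
      (hσ.contMDiffAt (e.open_baseSet.mem_nhds hmem)) (hp x₀)
  have h2 : ContMDiffAt (𝓘(ℝ, E).prod 𝓘(ℝ, S)) 𝓘(ℝ, S) ∞ (fun x : G × S =>
      S.orthogonalProjectionOnto ((U (σ (p x.1))⁻¹ : H →L[ℂ] H) ((U x.1 : H →L[ℂ] H) x.2))) x₀ := by
    refine contMDiffAt_proj (ContMDiffAt.complex_clm_apply ?_ (ContMDiffAt.complex_clm_apply ?_ ?_))
    · exact (h.contMDiff_U_inv _).comp x₀ h1
    · exact (h.contMDiff_U _).comp x₀ contMDiffAt_fst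
    · exact (S.subtypeL.restrictScalars ℝ).contDiff.contMDiff.contMDiffAt.comp x₀ contMDiffAt_snd
  refine h2.congr_of_eventuallyEq ?_
  filter_upwards [(hp x₀).continuousAt.preimage_mem_nhds (e.open_baseSet.mem_nhds hmem)] with x hx
  have hx' := hσ' _ hx
  -- `q x` is rewritten as the class of a point of the section `σ`, since the trivialization is
  -- explicit only on such classes.
  have hq := h.q_coord (σ (p x.1)) (q x) (by rw [h.proj_q, hx'.1])
  conv_lhs => rw [← hq]
  rw [hx'.2, h.totalEval_q]

/-- Smoothness can be tested after composition with the quotient map. -/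
theorem contMDiff_of_comp_q {EN HN N : Type*} [NormedAddCommGroup EN] [NormedSpace ℝ EN]
    [TopologicalSpace HN] {I : ModelWithCorners ℝ EN HN} [TopologicalSpace N] [ChartedSpace HN N]
    {f : TotalSpace S D → N} (hf : ContMDiff (𝓘(ℝ, E).prod 𝓘(ℝ, S)) I ∞ (f ∘ q)) :
    ContMDiff (𝓘(ℝ, EB).prod 𝓘(ℝ, S)) I ∞ f := by
  intro ξ₀
  obtain ⟨σ, u, hu, hσ, hσ'⟩ := h.exists_local_section ξ₀.1
  have hπ : ContMDiffAt (𝓘(ℝ, EB).prod 𝓘(ℝ, S)) 𝓘(ℝ, EB) ∞ (TotalSpace.proj : TotalSpace S D → Z)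
    ξ₀ := Bundle.contMDiffAt_proj D
  have h1 : ContMDiffAt (𝓘(ℝ, EB).prod 𝓘(ℝ, S)) 𝓘(ℝ, E) ∞ (fun ξ : TotalSpace S D => σ ξ.1) ξ₀ :=
    (hσ.contMDiffAt hu).comp ξ₀ hπ
  -- With this second component, `ξ ↦ (σ(πξ), P U(σ(πξ))⁻¹ev ξ)` is a smooth local section of `q`,
  -- and `f` is locally `f ∘ q` composed with it.
  have h2 := contMDiffAt_proj (S := S) (ContMDiffAt.complex_clm_apply
    ((h.contMDiff_U_inv _).comp ξ₀ h1) (h.contMDiff_totalEval ξ₀))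
  refine ((hf _).comp ξ₀ (h1.prodMk h2)).congr_of_eventuallyEq ?_
  filter_upwards [hπ.continuousAt.preimage_mem_nhds hu] with ξ hξ
  exact (congrArg f (h.q_coord (σ ξ.1) ξ (hσ' _ hξ))).symm

theorem contMDiff_of_comp_p {EN HN N : Type*} [NormedAddCommGroup EN] [NormedSpace ℝ EN]
    [TopologicalSpace HN] {I : ModelWithCorners ℝ EN HN} [TopologicalSpace N] [ChartedSpace HN N]
    {f : Z → N} (hf : ContMDiff 𝓘(ℝ, E) I ∞ (f ∘ p)) : ContMDiff 𝓘(ℝ, EB) I ∞ f := by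
  intro z₀
  obtain ⟨σ, u, hu, hσ, hσ'⟩ := h.exists_local_section z₀
  refine ((hf _).comp z₀ (hσ.contMDiffAt hu)).congr_of_eventuallyEq ?_
  filter_upwards [hu] with z hz
  exact (congrArg f (hσ' z hz)).symm

end IsHomogeneousBundle

end HomogeneousBundles

/-! ### Tangent vectors as classes, and uniqueness of the vertical part. -/

section HomogeneousBundles

open Bundle

variable {E : Type*} [NormedAddCommGroup E] [NormedSpace ℝ E]
  {G : Type*} [TopologicalSpace G] [ChartedSpace E G] [Group G] [LieGroup 𝓘(ℝ, E) ∞ G]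
  {EB : Type*} [NormedAddCommGroup EB] [NormedSpace ℝ EB]
  {Z : Type*} [TopologicalSpace Z] [ChartedSpace EB Z] [IsManifold 𝓘(ℝ, EB) ∞ Z]
  {H : Type*} [NormedAddCommGroup H] [InnerProductSpace ℂ H] [CompleteSpace H]
  {S : Submodule ℂ H} [CompleteSpace S]
  {D : Z → Type*} [∀ z, NormedAddCommGroup (D z)] [∀ z, NormedSpace ℂ (D z)]
  [TopologicalSpace (TotalSpace S D)] [FiberBundle S D] [VectorBundle ℝ S D]
  [ContMDiffVectorBundle ∞ S D 𝓘(ℝ, EB)]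

namespace IsHomogeneousBundle

variable {U : G →* unitary (H →L[ℂ] H)} {p : G → Z} {q : G × S → TotalSpace S D}
  {ev : ∀ z, D z →ₗ[ℂ] H} (h : IsHomogeneousBundle E EB U p q ev)

/-- The derivative of the representation at a point. -/
noncomputable def repDeriv (E : Type*) [NormedAddCommGroup E] [NormedSpace ℝ E] [ChartedSpace E G]
    (U : G →* unitary (H →L[ℂ] H)) (g : G) (X : TangentSpace 𝓘(ℝ, E) g) : H →L[ℂ] H :=
  mfderiv 𝓘(ℝ, E) 𝓘(ℝ, H →L[ℂ] H) (fun g => (U g : H →L[ℂ] H)) g X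

/-- The tangent map of the quotient map. -/
noncomputable abbrev tq (E EB : Type*) [NormedAddCommGroup E] [NormedSpace ℝ E] [ChartedSpace E G]
    [NormedAddCommGroup EB] [NormedSpace ℝ EB] [ChartedSpace EB Z]
    (q : G × S → TotalSpace S D) (g : G) (f : S) (X : TangentSpace 𝓘(ℝ, E) g) (y : S) :
    TangentTotal EB S D :=
  tangentMap (𝓘(ℝ, E).prod 𝓘(ℝ, S)) (𝓘(ℝ, EB).prod 𝓘(ℝ, S)) q (prodTangent g f X y)

include h

theorem mdifferentiable_q : MDifferentiable (𝓘(ℝ, E).prod 𝓘(ℝ, S)) (𝓘(ℝ, EB).prod 𝓘(ℝ, S)) q :=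
  h.contMDiff_q.mdifferentiable (by simp)

theorem mdifferentiable_totalEval :
    MDifferentiable (𝓘(ℝ, EB).prod 𝓘(ℝ, S)) 𝓘(ℝ, H) (totalEval (S := S) ev) :=
  h.contMDiff_totalEval.mdifferentiable (by simp)

/-- The Leibniz rule for `ev ∘ q`, which is the map `(g, f) ↦ U(g)f`. -/
theorem evalDeriv_tq (g : G) (f : S) (X : TangentSpace 𝓘(ℝ, E) g) (y : S) :
    evalDeriv EB ev (tq E EB q g f X y) = repDeriv E U g X f + (U g : H →L[ℂ] H) y := by
  have hU : MDifferentiableAt 𝓘(ℝ, E) 𝓘(ℝ, H →L[ℂ] H) (fun g => (U g : H →L[ℂ] H)) g :=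
    h.contMDiff_U.mdifferentiable (by simp) g
  have h1 := mfderiv_comp (I := 𝓘(ℝ, E).prod 𝓘(ℝ, S)) (I' := 𝓘(ℝ, EB).prod 𝓘(ℝ, S))
    (I'' := 𝓘(ℝ, H)) (g, f) (h.mdifferentiable_totalEval _) (h.mdifferentiable_q (g, f))
  have h2 : evalDeriv EB ev (tq E EB q g f X y) =
      mfderiv (𝓘(ℝ, E).prod 𝓘(ℝ, S)) 𝓘(ℝ, H) (totalEval ev ∘ q) (g, f) (X, y) := by
    rw [h1]; rfl
  have h3 : totalEval ev ∘ q = fun x : G × S => (U x.1 : H →L[ℂ] H) x.2 := funext h.totalEval_q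
  have h5 : MDifferentiable (𝓘(ℝ, E).prod 𝓘(ℝ, S)) 𝓘(ℝ, H)
      (fun x : G × S => (U x.1 : H →L[ℂ] H) x.2) := by
    rw [← h3]; exact h.mdifferentiable_totalEval.comp h.mdifferentiable_q
  rw [h2, h3]
  refine (mfderiv_prod_eq_add_apply (v := (prodTangent g f X y).2) (h5 (g, f))).trans ?_
  · congr 1
    · have := mfderiv_comp (I := 𝓘(ℝ, E)) (I' := 𝓘(ℝ, H →L[ℂ] H)) (I'' := 𝓘(ℝ, H))
        (g := fun A : H →L[ℂ] H => A (f : H)) g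
        ((ContinuousLinearMap.apply ℂ H (f : H)).restrictScalars ℝ).mdifferentiableAt hU
      have h4 : mfderiv 𝓘(ℝ, H →L[ℂ] H) 𝓘(ℝ, H) (fun A : H →L[ℂ] H => A (f : H))
          (U g : H →L[ℂ] H) = (ContinuousLinearMap.apply ℂ H (f : H)).restrictScalars ℝ :=
        ContinuousLinearMap.mfderiv_eq ((ContinuousLinearMap.apply ℂ H (f : H)).restrictScalars ℝ)
      rw [h4] at this
      exact congrArg (fun L => L X) this
    · have := ContinuousLinearMap.mfderiv_eq (x := f)
        (((U g : H →L[ℂ] H).comp S.subtypeL).restrictScalars ℝ)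
      exact congrArg (fun L => L y) this

/-- Because `π ∘ q = p ∘ fst`, the projection sees only the component along the group. -/
theorem isVertical_tq_zero (g : G) (f y : S) : IsVertical EB (tq E EB q g f 0 y) := by
  have hπ : MDifferentiable (𝓘(ℝ, EB).prod 𝓘(ℝ, S)) 𝓘(ℝ, EB)
      (TotalSpace.proj : TotalSpace S D → Z) :=
    (Bundle.contMDiff_proj D (n := 1)).mdifferentiable (by simp)
  have h1 := mfderiv_comp (I := 𝓘(ℝ, E).prod 𝓘(ℝ, S)) (I' := 𝓘(ℝ, EB).prod 𝓘(ℝ, S))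
    (I'' := 𝓘(ℝ, EB)) (g, f) (hπ _) (h.mdifferentiable_q (g, f))
  have h2 : (TotalSpace.proj : TotalSpace S D → Z) ∘ q = p ∘ Prod.fst := funext h.proj_q
  have h3 := mfderiv_comp (I := 𝓘(ℝ, E).prod 𝓘(ℝ, S)) (I' := 𝓘(ℝ, E))
    (I'' := 𝓘(ℝ, EB)) (f := (Prod.fst : G × S → G)) (g, f)
    (h.contMDiff_p.mdifferentiable (by simp) g) mdifferentiableAt_fst
  rw [h2, h3, mfderiv_fst] at h1
  refine (congrArg (fun L => L ((0 : E), y)) h1).symm.trans ?_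
  exact map_zero (mfderiv 𝓘(ℝ, E) 𝓘(ℝ, EB) p g)

/-- Every tangent vector of the total space is a class, and it is a class without first component
if it is vertical. -/
theorem exists_eq_tq (w : TangentTotal EB S D) :
    ∃ (g : G) (X : TangentSpace 𝓘(ℝ, E) g) (f y : S), w = tq E EB q g f X y ∧
      (IsVertical EB w → X = 0) := by
  obtain ⟨ξ₀, v⟩ := w
  obtain ⟨σ, u, hu, hσ, hσ'⟩ := h.exists_local_section ξ₀.1
  have hπ : ContMDiffAt (𝓘(ℝ, EB).prod 𝓘(ℝ, S)) 𝓘(ℝ, EB) ∞ (TotalSpace.proj : TotalSpace S D → Z)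
    ξ₀ := Bundle.contMDiffAt_proj D
  have hσd := hσ.contMDiffAt hu
  have h1 : ContMDiffAt (𝓘(ℝ, EB).prod 𝓘(ℝ, S)) 𝓘(ℝ, E) ∞ (fun ξ : TotalSpace S D => σ ξ.1) ξ₀ :=
    hσd.comp ξ₀ hπ
  have h2 := contMDiffAt_proj (S := S) (ContMDiffAt.complex_clm_apply
    ((h.contMDiff_U_inv _).comp ξ₀ h1) (h.contMDiff_totalEval ξ₀))
  set s : TotalSpace S D → G × S := fun ξ => (σ ξ.1,
    S.orthogonalProjectionOnto ((U (σ ξ.1)⁻¹ : H →L[ℂ] H) (totalEval ev ξ))) with hs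
  have h3 : MDifferentiableAt (𝓘(ℝ, EB).prod 𝓘(ℝ, S)) (𝓘(ℝ, E).prod 𝓘(ℝ, S)) s ξ₀ :=
    (h1.prodMk h2).mdifferentiableAt (by simp)
  -- `s` is a smooth local section of `q`, so a tangent vector is the image under `Tq` of its image
  -- under `Ts`; the components of the latter are the required `X` and `y`.
  have h4 : q ∘ s =ᶠ[𝓝 ξ₀] id := by
    filter_upwards [hπ.continuousAt.preimage_mem_nhds hu] with ξ hξ
    exact h.q_coord (σ ξ.1) ξ (hσ' _ hξ)
  have h5 : tangentMap (𝓘(ℝ, EB).prod 𝓘(ℝ, S)) (𝓘(ℝ, EB).prod 𝓘(ℝ, S)) (q ∘ s) ⟨ξ₀, v⟩ =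
      ⟨ξ₀, v⟩ := by
    have e1 : q (s ξ₀) = ξ₀ := h4.self_of_nhds
    have e2 : mfderiv (𝓘(ℝ, EB).prod 𝓘(ℝ, S)) (𝓘(ℝ, EB).prod 𝓘(ℝ, S)) (q ∘ s) ξ₀ =
      ContinuousLinearMap.id ℝ (TangentSpace (𝓘(ℝ, EB).prod 𝓘(ℝ, S)) ξ₀) :=
      h4.mfderiv_eq.trans mfderiv_id
    rw [tangentMap, e2]
    exact congrArg (fun ξ => (⟨ξ, v⟩ : TangentTotal EB S D)) e1
  rw [tangentMap_comp_at _ (h.mdifferentiable_q _) h3] at h5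
  refine ⟨σ ξ₀.1, (mfderiv (𝓘(ℝ, EB).prod 𝓘(ℝ, S)) (𝓘(ℝ, E).prod 𝓘(ℝ, S)) s ξ₀ v).1, (s ξ₀).2,
    (mfderiv (𝓘(ℝ, EB).prod 𝓘(ℝ, S)) (𝓘(ℝ, E).prod 𝓘(ℝ, S)) s ξ₀ v).2, h5.symm, fun hv => ?_⟩
  -- The first component of `s` is `σ ∘ π`, so its derivative annihilates vertical vectors.
  have h6 := mfderiv_prodMk (I := 𝓘(ℝ, EB).prod 𝓘(ℝ, S)) (I' := 𝓘(ℝ, E)) (I'' := 𝓘(ℝ, S))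
    (h1.mdifferentiableAt (by simp)) (h2.mdifferentiableAt (by simp))
  have h7 := mfderiv_comp (I := 𝓘(ℝ, EB).prod 𝓘(ℝ, S)) (I' := 𝓘(ℝ, EB)) (I'' := 𝓘(ℝ, E)) ξ₀
    (hσd.mdifferentiableAt (by simp)) (hπ.mdifferentiableAt (by simp))
  have h8 : (mfderiv (𝓘(ℝ, EB).prod 𝓘(ℝ, S)) (𝓘(ℝ, E).prod 𝓘(ℝ, S)) s ξ₀ v).1 =
      mfderiv (𝓘(ℝ, EB).prod 𝓘(ℝ, S)) 𝓘(ℝ, E) (fun ξ : TotalSpace S D => σ ξ.1) ξ₀ v :=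
    congrArg (fun L => (L v).1) h6
  rw [h8]
  refine (congrArg (fun L => L v) h7).trans ?_
  refine (congrArg (mfderiv 𝓘(ℝ, EB) 𝓘(ℝ, E) σ ξ₀.1) hv).trans ?_
  exact map_zero _

/-- A vertical vector is a class `[((g, 0), (f, y))]`, and its image `U(g)y` is the evaluation of
`q(g, y)`. -/
theorem exists_ev_eq_evalDeriv {w : TangentTotal EB S D} (hw : IsVertical EB w) :
    ∃ η : D w.1.1, ev _ η = evalDeriv EB ev w := by
  obtain ⟨g, X, f, y, rfl, hX⟩ := h.exists_eq_tq w
  obtain rfl := hX hw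
  have : p g = (q (g, f)).1 := (h.proj_q (g, f)).symm
  -- `q(g, y)` and `q(g, f)` lie over the same point `p g`, but only propositionally, hence the
  -- transport between fibres.
  refine ⟨(q (g, y)).2 |> cast (congrArg D ((h.proj_q (g, y)).trans this)), ?_⟩
  rw [h.evalDeriv_tq]
  have h0 : repDeriv E U g 0 = 0 := map_zero (mfderiv 𝓘(ℝ, E) 𝓘(ℝ, H →L[ℂ] H)
    (fun g => (U g : H →L[ℂ] H)) g)
  rw [h0, ← h.ev_q g y]
  simp only [zero_apply, zero_add]
  generalize_proofs hh
  have key : ∀ (z z' : Z) (hz : z = z') (x : D z) (hd : D z = D z'), ev z' (cast hd x) = ev z x := by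
    rintro z _ rfl x hd; rfl
  exact key _ _ ((h.proj_q (g, y)).trans this) _ _

/-- A vertical tangent vector is determined by its base point and its image under the derivative
of the evaluation map. -/
theorem ext_vertical {w w' : TangentTotal EB S D} (hb : w.1 = w'.1) (hw : IsVertical EB w)
    (hw' : IsVertical EB w') (hd : evalDeriv EB ev w = evalDeriv EB ev w') : w = w' := by
  obtain ⟨ξ, v⟩ := w
  obtain ⟨ξ', v'⟩ := w'
  obtain rfl : ξ = ξ' := hb
  have hs : IsVertical EB (⟨ξ, v - v'⟩ : TangentTotal EB S D) := by
    refine (map_sub (mfderiv (𝓘(ℝ, EB).prod 𝓘(ℝ, S)) 𝓘(ℝ, EB)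
      (TotalSpace.proj : TotalSpace S D → Z) ξ) v v').trans ?_
    exact sub_eq_zero.2 (hw.trans hw'.symm)
  have hs' : evalDeriv EB ev (⟨ξ, v - v'⟩ : TangentTotal EB S D) = 0 :=
    (map_sub (mfderiv (𝓘(ℝ, EB).prod 𝓘(ℝ, S)) 𝓘(ℝ, H) (totalEval (S := S) ev) ξ) v v').trans
      (sub_eq_zero.2 hd)
  -- The difference is vertical, hence a class with `X = 0`. Its image `U(g)y` vanishes, so `y = 0`,
  -- and the class itself is zero.
  have h0 : v - v' = 0 := by
    generalize hx : v - v' = x at hs hs'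
    obtain ⟨g, X, f, y, hw, hX⟩ := h.exists_eq_tq (⟨ξ, x⟩ : TangentTotal EB S D)
    obtain rfl := hX hs
    rw [hw, h.evalDeriv_tq] at hs'
    have h0 : repDeriv E U g 0 = 0 := map_zero (mfderiv 𝓘(ℝ, E) 𝓘(ℝ, H →L[ℂ] H)
      (fun g => (U g : H →L[ℂ] H)) g)
    rw [h0, zero_apply, zero_add] at hs'
    have hy : y = 0 := by
      have := Unitary.coe_inv_apply_apply (U g) (y : H)
      rw [hs', map_zero] at this
      exact Subtype.ext this.symm
    subst hy
    have h9 : tq E EB q g f 0 0 = (⟨q (g, f), 0⟩ : TangentTotal EB S D) :=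
      congrArg (fun v => (⟨q (g, f), v⟩ : TangentTotal EB S D))
        (map_zero (mfderiv (𝓘(ℝ, E).prod 𝓘(ℝ, S)) (𝓘(ℝ, EB).prod 𝓘(ℝ, S)) q (g, f)))
    rw [h9] at hw
    -- The two vectors sit over base points which are only propositionally equal, so the vanishing
    -- is transported in the model space `EB × S`.
    have key : ∀ (a b : TangentTotal EB S D), a = b → (b.2 : EB × S) = 0 → (a.2 : EB × S) = 0 := by
      rintro a _ rfl; exact id
    exact key _ _ hw rfl
  rw [sub_eq_zero.1 h0]

/-- The images of two vertical parts lie in the evaluated fibre and differ from the image of `w` by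
vectors orthogonal to it. Their difference therefore lies in this fibre and is orthogonal to it, so
it is zero, and `ext_vertical` applies. -/
theorem isVerticalPart_unique {w w₁ w₂ : TangentTotal EB S D} (h1 : IsVerticalPart EB ev w w₁)
    (h2 : IsVerticalPart EB ev w w₂) : w₁ = w₂ := by
  refine h.ext_vertical (h1.base.trans h2.base.symm) h1.vertical h2.vertical ?_
  obtain ⟨η₁, e1⟩ := h.exists_ev_eq_evalDeriv h1.vertical
  obtain ⟨η₂, e2⟩ := h.exists_ev_eq_evalDeriv h2.vertical
  have key : ∀ w' : TangentTotal EB S D, w'.1 = w.1 → (∃ η : D w'.1.1, ev _ η = evalDeriv EB ev w') →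
      ∃ η : D w.1.1, ev _ η = evalDeriv EB ev w' := by
    rintro ⟨ξ, v⟩ hξ ⟨η, hη⟩
    obtain rfl : ξ = w.1 := hξ
    exact ⟨η, hη⟩
  obtain ⟨η₁, e1⟩ := key _ h1.base ⟨η₁, e1⟩
  obtain ⟨η₂, e2⟩ := key _ h2.base ⟨η₂, e2⟩
  have h3 := h1.orthogonal (η₁ - η₂)
  have h4 := h2.orthogonal (η₁ - η₂)
  rw [inner_sub_right, sub_eq_zero] at h3 h4
  have h5 := h3.trans h4.symm
  rw [← sub_eq_zero, ← inner_sub_right, map_sub, e1, e2, inner_self_eq_zero, sub_eq_zero] at h5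
  exact h5

theorem isVerticalPart_self {w : TangentTotal EB S D} (hw : IsVertical EB w) :
    IsVerticalPart EB ev w w :=
  ⟨rfl, hw, fun η => by rw [sub_self, inner_zero_right]⟩

/-- The vertical part of a class. -/
theorem isVerticalPart_tq (g : G) (f : S) (X : TangentSpace 𝓘(ℝ, E) g) (y : S) :
    IsVerticalPart EB ev (tq E EB q g f X y) (tq E EB q g f 0
      (S.orthogonalProjectionOnto ((U g⁻¹ : H →L[ℂ] H) (repDeriv E U g X f)) + y)) := by
  refine ⟨rfl, h.isVertical_tq_zero _ _ _, fun η => ?_⟩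
  have key : ∀ z, z = p g → ∀ η : D z, ∃ f : S, ev _ η = (U g : H →L[ℂ] H) f := by
    rintro z rfl η; exact h.exists_ev g η
  obtain ⟨f', hf'⟩ := key _ (h.proj_q (g, f)) η
  have h0 : repDeriv E U g 0 = 0 := map_zero (mfderiv 𝓘(ℝ, E) 𝓘(ℝ, H →L[ℂ] H)
    (fun g => (U g : H →L[ℂ] H)) g)
  rw [h.evalDeriv_tq, h.evalDeriv_tq]
  refine (congrArg (fun x => inner ℂ x _) hf').trans ?_
  rw [h0, zero_apply, zero_add, Submodule.coe_add, map_add, add_sub_add_right_eq_sub]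
  -- Writing the term outside the projection as `U(g)U(g)⁻¹` of itself lets the unitary `U(g)` be
  -- cancelled in the scalar product; what remains is `Px - x ⟂ S`.
  nth_rewrite 2 [← Unitary.coe_apply_inv_apply (U g) (repDeriv E U g X f)]
  rw [← map_sub, Unitary.inner_coe_apply, map_inv, inner_sub_right, sub_eq_zero]
  exact Submodule.inner_starProjection_left_eq_right S f' _ ▸ by
    rw [Submodule.starProjection_eq_self_iff.2 f'.2]

end IsHomogeneousBundle

end HomogeneousBundles

/-! ### The projection to the vertical part is a smooth connection. -/

section HomogeneousBundles

open Bundle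

variable {E : Type*} [NormedAddCommGroup E] [NormedSpace ℝ E]
  {G : Type*} [TopologicalSpace G] [ChartedSpace E G] [Group G] [LieGroup 𝓘(ℝ, E) ∞ G]
  {EB : Type*} [NormedAddCommGroup EB] [NormedSpace ℝ EB]
  {Z : Type*} [TopologicalSpace Z] [ChartedSpace EB Z] [IsManifold 𝓘(ℝ, EB) ∞ Z]
  {H : Type*} [NormedAddCommGroup H] [InnerProductSpace ℂ H] [CompleteSpace H]
  {S : Submodule ℂ H} [CompleteSpace S]
  {D : Z → Type*} [∀ z, NormedAddCommGroup (D z)] [∀ z, NormedSpace ℂ (D z)]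
  [TopologicalSpace (TotalSpace S D)] [FiberBundle S D] [VectorBundle ℝ S D]
  [ContMDiffVectorBundle ∞ S D 𝓘(ℝ, EB)]

open Classical in
variable (EB) in
/-- The map which sends a tangent vector to its vertical part. -/
noncomputable def verticalPart (ev : ∀ z, D z →ₗ[ℂ] H) (w : TangentTotal EB S D) :
    TangentTotal EB S D :=
  -- The default value is never taken on a homogeneous bundle, where `p` is surjective and so every
  -- tangent vector has a vertical part.
  if hw : ∃ w', IsVerticalPart EB ev w w' then hw.choose else w

/-- In the trivialization of the Whitney sum the fibre coordinate is the pair of the coordinates of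
the summands, and smoothness is read off from there. -/
theorem contMDiff_fibreFst : ContMDiff (𝓘(ℝ, EB).prod 𝓘(ℝ, S × S)) (𝓘(ℝ, EB).prod 𝓘(ℝ, S)) ∞
    (fibreFst : TotalSpace (S × S) (D ×ᵇ D) → TotalSpace S D) := by
  intro ξ₀
  have h0 := contMDiffAt_totalSpace.1
    (contMDiffAt_id (I := 𝓘(ℝ, EB).prod 𝓘(ℝ, S × S)) (n := ∞) (x := ξ₀))
  exact contMDiffAt_totalSpace.2 ⟨h0.1, ContMDiffAt.comp ξ₀ (g := (Prod.fst : S × S → S))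
    contDiff_fst.contMDiff.contMDiffAt h0.2⟩

theorem contMDiff_fibreSnd : ContMDiff (𝓘(ℝ, EB).prod 𝓘(ℝ, S × S)) (𝓘(ℝ, EB).prod 𝓘(ℝ, S)) ∞
    (fibreSnd : TotalSpace (S × S) (D ×ᵇ D) → TotalSpace S D) := by
  intro ξ₀
  have h0 := contMDiffAt_totalSpace.1
    (contMDiffAt_id (I := 𝓘(ℝ, EB).prod 𝓘(ℝ, S × S)) (n := ∞) (x := ξ₀))
  exact contMDiffAt_totalSpace.2 ⟨h0.1, ContMDiffAt.comp ξ₀ (g := (Prod.snd : S × S → S))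
    contDiff_snd.contMDiff.contMDiffAt h0.2⟩

namespace IsHomogeneousBundle

variable {U : G →* unitary (H →L[ℂ] H)} {p : G → Z} {q : G × S → TotalSpace S D}
  {ev : ∀ z, D z →ₗ[ℂ] H} (h : IsHomogeneousBundle E EB U p q ev)

/-- The vertical part of a tangent vector, described by means of a point `g` of the group over its
base point. -/
noncomputable def liftedPart (U : G →* unitary (H →L[ℂ] H)) (q : G × S → TotalSpace S D)
    (ev : ∀ z, D z →ₗ[ℂ] H) (E : Type*) [NormedAddCommGroup E] [NormedSpace ℝ E] [ChartedSpace E G]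
    (g : G) (w : TangentTotal EB S D) : TangentTotal EB S D :=
  tq E EB q g (S.orthogonalProjectionOnto ((U g⁻¹ : H →L[ℂ] H) (totalEval ev w.1))) 0
    (S.orthogonalProjectionOnto ((U g⁻¹ : H →L[ℂ] H) (evalDeriv EB ev w)))

include h

/-- Unlike the formula on classes, this one uses only the evaluations of `w` and of its base point.
It is therefore visibly linear in `w` for fixed `g` and base point, and smooth once `g` is replaced
by `σ(π w)`. -/
theorem isVerticalPart_liftedPart (g : G) (w : TangentTotal EB S D) (hg : p g = w.1.1) :
    IsVerticalPart EB ev w (liftedPart U q ev E g w) := by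
  refine ⟨h.q_coord g w.1 hg, h.isVertical_tq_zero _ _ _, fun η => ?_⟩
  have key : ∀ z, p g = z → ∀ η : D z, ∃ f : S, ev _ η = (U g : H →L[ℂ] H) f := by
    rintro _ rfl η; exact h.exists_ev g η
  obtain ⟨f', hf'⟩ := key _ hg η
  have h0 : repDeriv E U g 0 = 0 := map_zero (mfderiv 𝓘(ℝ, E) 𝓘(ℝ, H →L[ℂ] H)
    (fun g => (U g : H →L[ℂ] H)) g)
  rw [liftedPart, h.evalDeriv_tq, hf', h0, zero_apply, zero_add]
  nth_rewrite 2 [← Unitary.coe_apply_inv_apply (U g) (evalDeriv EB ev w)]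
  rw [← map_sub, Unitary.inner_coe_apply, map_inv, inner_sub_right, sub_eq_zero]
  exact Submodule.inner_starProjection_left_eq_right S f' _ ▸ by
    rw [Submodule.starProjection_eq_self_iff.2 f'.2]

theorem isVerticalPart_verticalPart (w : TangentTotal EB S D) :
    IsVerticalPart EB ev w (verticalPart EB ev w) := by
  obtain ⟨g, hg⟩ := h.surjective_p w.1.1
  have hw : ∃ w', IsVerticalPart EB ev w w' := ⟨_, h.isVerticalPart_liftedPart g w hg⟩
  rw [verticalPart, dif_pos hw]
  exact hw.choose_spec

/-- The properties of `verticalPart` below are obtained by checking that a candidate satisfies the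
three defining conditions. -/
theorem verticalPart_eq {w w' : TangentTotal EB S D} (hw : IsVerticalPart EB ev w w') :
    verticalPart EB ev w = w' :=
  h.isVerticalPart_unique (h.isVerticalPart_verticalPart w) hw

theorem verticalPart_tq (g : G) (f : S) (X : TangentSpace 𝓘(ℝ, E) g) (y : S) :
    verticalPart EB ev (tq E EB q g f X y) = tq E EB q g f 0
      (S.orthogonalProjectionOnto ((U g⁻¹ : H →L[ℂ] H) (repDeriv E U g X f)) + y) :=
  h.verticalPart_eq (h.isVerticalPart_tq g f X y)

theorem contMDiff_evalDeriv :
    ContMDiff (𝓘(ℝ, EB).prod 𝓘(ℝ, S)).tangent 𝓘(ℝ, H) ∞ (evalDeriv (S := S) EB ev) :=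
  (contMDiff_snd_tangentBundle_modelSpace H 𝓘(ℝ, H)).comp
    (h.contMDiff_totalEval.contMDiff_tangentMap (m := ∞) (by simp))

/-- Locally the map is `Tq` applied to the zero vector at `σ(π w)` paired with a tangent vector of
`S`, both of which depend smoothly on `w`. -/
theorem contMDiff_verticalPart :
    ContMDiff (𝓘(ℝ, EB).prod 𝓘(ℝ, S)).tangent (𝓘(ℝ, EB).prod 𝓘(ℝ, S)).tangent ∞
      (verticalPart (S := S) EB ev) := by
  intro w₀
  obtain ⟨σ, u, hu, hσ, hσ'⟩ := h.exists_local_section w₀.1.1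
  have hD : ContMDiffAt (𝓘(ℝ, EB).prod 𝓘(ℝ, S)).tangent (𝓘(ℝ, EB).prod 𝓘(ℝ, S)) ∞
      (fun w : TangentTotal EB S D => w.1) w₀ :=
    Bundle.contMDiffAt_proj (TangentSpace (𝓘(ℝ, EB).prod 𝓘(ℝ, S)) : TotalSpace S D → Type _)
  have hZ : ContMDiffAt (𝓘(ℝ, EB).prod 𝓘(ℝ, S)).tangent 𝓘(ℝ, EB) ∞
      (fun w : TangentTotal EB S D => w.1.1) w₀ := (Bundle.contMDiffAt_proj D).comp w₀ hD
  have h1 : ContMDiffAt (𝓘(ℝ, EB).prod 𝓘(ℝ, S)).tangent 𝓘(ℝ, E) ∞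
      (fun w : TangentTotal EB S D => σ w.1.1) w₀ := (hσ.contMDiffAt hu).comp w₀ hZ
  have hU := (h.contMDiff_U_inv _).comp w₀ h1
  have h2 := contMDiffAt_proj (S := S) (ContMDiffAt.complex_clm_apply hU
    ((h.contMDiff_totalEval _).comp w₀ hD))
  have h3 := contMDiffAt_proj (S := S) (ContMDiffAt.complex_clm_apply hU (h.contMDiff_evalDeriv w₀))
  have h4 : ContMDiffAt (𝓘(ℝ, EB).prod 𝓘(ℝ, S)).tangent 𝓘(ℝ, E).tangent ∞
      (fun w : TangentTotal EB S D => (⟨σ w.1.1, 0⟩ : TangentBundle 𝓘(ℝ, E) G)) w₀ :=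
    (contMDiff_zeroSection ℝ (TangentSpace 𝓘(ℝ, E) : G → Type _) _).comp w₀ h1
  have h5 : ContMDiffAt (𝓘(ℝ, EB).prod 𝓘(ℝ, S)).tangent 𝓘(ℝ, S).tangent ∞
      (fun w : TangentTotal EB S D =>
        (⟨S.orthogonalProjectionOnto ((U (σ w.1.1)⁻¹ : H →L[ℂ] H) (totalEval ev w.1)),
          S.orthogonalProjectionOnto ((U (σ w.1.1)⁻¹ : H →L[ℂ] H) (evalDeriv EB ev w))⟩ :
          TangentBundle 𝓘(ℝ, S) S)) w₀ := by
    refine contMDiffAt_totalSpace.2 ⟨h2, ?_⟩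
    simp only [trivializationAt_model_space_apply]
    exact h3
  -- The two tangent vectors are combined through the smooth identification of `TG × TS` with `T(G ×
  -- S)`.
  have h6 := (contMDiff_equivTangentBundleProd_symm (n := ∞) _).comp w₀ (h4.prodMk h5)
  refine (((h.contMDiff_q.contMDiff_tangentMap (m := ∞) (by simp)) _).comp w₀
    h6).congr_of_eventuallyEq ?_
  filter_upwards [hZ.continuousAt.preimage_mem_nhds hu] with w hw
  exact h.verticalPart_eq (h.isVerticalPart_liftedPart (σ w.1.1) w (hσ' _ hw))

/-- Idempotence and the description of the range both come from the fact that a vertical vector is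
its own vertical part. Boundedness is seen from `liftedPart` for a fixed `g` over the base point. -/
theorem isConnection_verticalPart : IsConnection EB S D (verticalPart EB ev) where
  contMDiff := h.contMDiff_verticalPart
  idempotent w := h.verticalPart_eq
    (h.isVerticalPart_self (h.isVerticalPart_verticalPart w).vertical)
  fibrewise x := by
    obtain ⟨g, hg⟩ := h.surjective_p x.1
    obtain ⟨f, hf⟩ : ∃ f, q (g, f) = x := ⟨_, h.q_coord g x hg⟩
    subst hf
    -- `A v` is the coordinate, in the frame `g`, of the projection of the image of `v`; on the
    -- tangent space at `q(g, f)` the connection is then `Tq ∘ (0, A)`.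
    let A : TangentSpace (𝓘(ℝ, EB).prod 𝓘(ℝ, S)) (q (g, f)) →L[ℝ] S :=
      ((S.orthogonalProjectionOnto.comp (U g⁻¹ : H →L[ℂ] H)).restrictScalars ℝ).comp
        (mfderiv (𝓘(ℝ, EB).prod 𝓘(ℝ, S)) 𝓘(ℝ, H) (totalEval (S := S) ev) (q (g, f)))
    let L : TangentSpace (𝓘(ℝ, EB).prod 𝓘(ℝ, S)) (q (g, f)) →L[ℝ]
        TangentSpace (𝓘(ℝ, EB).prod 𝓘(ℝ, S)) (q (g, f)) :=
      (mfderiv (𝓘(ℝ, E).prod 𝓘(ℝ, S)) (𝓘(ℝ, EB).prod 𝓘(ℝ, S)) q (g, f)).comp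
        ((ContinuousLinearMap.inr ℝ E S).comp A)
    have hL : ∀ v, verticalPart EB ev (⟨q (g, f), v⟩ : TangentTotal EB S D) =
        (⟨q (g, f), L v⟩ : TangentTotal EB S D) := by
      intro v
      refine h.verticalPart_eq ?_
      have h1 := h.isVerticalPart_liftedPart g (⟨q (g, f), v⟩ : TangentTotal EB S D) hg
      -- The coordinate of the base point becomes `f` itself, so the lifted part literally sits over
      -- `q(g, f)` and can be compared with `L v`.
      rw [liftedPart, h.coord_q g f] at h1
      exact h1
    refine ⟨L, hL, ?_⟩
    ext v
    constructor
    · rintro ⟨v', rfl⟩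
      exact h.isVertical_tq_zero g f (A v')
    · intro hv
      have h1 := hL v
      rw [h.verticalPart_eq (h.isVerticalPart_self
        (show IsVertical EB (⟨q (g, f), v⟩ : TangentTotal EB S D) from hv))] at h1
      exact ⟨v, (eq_of_heq (TotalSpace.mk.inj h1).2).symm⟩

/-- The bundle structure is a real one, so complex scalars are handled upstairs: multiplication by
`c` is covered by `(g, f) ↦ (g, c • f)`, and smoothness descends along `q`. -/
theorem contMDiff_fibreSMul (c : ℂ) : ContMDiff (𝓘(ℝ, EB).prod 𝓘(ℝ, S)) (𝓘(ℝ, EB).prod 𝓘(ℝ, S)) ∞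
    (fibreSMul c : TotalSpace S D → TotalSpace S D) := by
  refine h.contMDiff_of_comp_q ?_
  have h1 : fibreSMul c ∘ q = q ∘ fun x : G × S => (x.1, c • x.2) := by
    funext x
    refine h.ext ((h.proj_q x).trans (h.proj_q (x.1, c • x.2)).symm) ?_
    have h2 : totalEval ev (fibreSMul c (q x)) = c • totalEval ev (q x) := map_smul _ _ _
    simp only [Function.comp_apply]
    rw [h2, h.totalEval_q, h.totalEval_q]
    simp
  rw [h1]
  refine h.contMDiff_q.comp (contMDiff_fst.prodMk ?_)
  exact (((c • ContinuousLinearMap.id ℂ S).restrictScalars ℝ).contDiff.contMDiff).comp contMDiff_snd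

/-- Over a local section `σ`, the coordinate of a sum is the projection of `U(σ)⁻¹` of the sum of
the two evaluations. -/
theorem contMDiff_fibreAdd : ContMDiff (𝓘(ℝ, EB).prod 𝓘(ℝ, S × S)) (𝓘(ℝ, EB).prod 𝓘(ℝ, S)) ∞
    (fibreAdd : TotalSpace (S × S) (D ×ᵇ D) → TotalSpace S D) := by
  intro ξ₀
  obtain ⟨σ, u, hu, hσ, hσ'⟩ := h.exists_local_section ξ₀.1
  have hZ : ContMDiffAt (𝓘(ℝ, EB).prod 𝓘(ℝ, S × S)) 𝓘(ℝ, EB) ∞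
      (TotalSpace.proj : TotalSpace (S × S) (D ×ᵇ D) → Z) ξ₀ := Bundle.contMDiffAt_proj _
  have h1 : ContMDiffAt (𝓘(ℝ, EB).prod 𝓘(ℝ, S × S)) 𝓘(ℝ, E) ∞
      (fun ξ : TotalSpace (S × S) (D ×ᵇ D) => σ ξ.1) ξ₀ := (hσ.contMDiffAt hu).comp ξ₀ hZ
  have h2 := contMDiffAt_proj (S := S) (ContMDiffAt.complex_clm_apply
    ((h.contMDiff_U_inv _).comp ξ₀ h1)
    (((h.contMDiff_totalEval _).comp ξ₀ (contMDiff_fibreFst ξ₀)).add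
      ((h.contMDiff_totalEval _).comp ξ₀ (contMDiff_fibreSnd ξ₀))))
  refine ((h.contMDiff_q _).comp ξ₀ (h1.prodMk h2)).congr_of_eventuallyEq ?_
  filter_upwards [hZ.continuousAt.preimage_mem_nhds hu] with ξ hξ
  have h3 := h.q_coord (σ ξ.1) (fibreAdd ξ) (hσ' _ hξ)
  have h4 : totalEval ev (fibreAdd ξ) = totalEval ev (fibreFst ξ) + totalEval ev (fibreSnd ξ) :=
    map_add _ _ _
  rw [h4] at h3
  exact h3.symm

end IsHomogeneousBundle

end HomogeneousBundles

/-! ### Naturality of vertical parts: linearity, the formula on classes, and pull-backs. -/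

section HomogeneousBundles

open Bundle

variable {E : Type*} [NormedAddCommGroup E] [NormedSpace ℝ E]
  {G : Type*} [TopologicalSpace G] [ChartedSpace E G] [Group G] [LieGroup 𝓘(ℝ, E) ∞ G]
  {EB : Type*} [NormedAddCommGroup EB] [NormedSpace ℝ EB]
  {Z : Type*} [TopologicalSpace Z] [ChartedSpace EB Z] [IsManifold 𝓘(ℝ, EB) ∞ Z]
  {H : Type*} [NormedAddCommGroup H] [InnerProductSpace ℂ H] [CompleteSpace H]
  {S : Submodule ℂ H} [CompleteSpace S]
  {D : Z → Type*} [∀ z, NormedAddCommGroup (D z)] [∀ z, NormedSpace ℂ (D z)]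
  [TopologicalSpace (TotalSpace S D)] [FiberBundle S D] [VectorBundle ℝ S D]
  [ContMDiffVectorBundle ∞ S D 𝓘(ℝ, EB)]

section Morphisms

variable {EB' : Type*} [NormedAddCommGroup EB'] [NormedSpace ℝ EB']
  {Z' : Type*} [TopologicalSpace Z'] [ChartedSpace EB' Z'] [IsManifold 𝓘(ℝ, EB') ∞ Z']
  {H' : Type*} [NormedAddCommGroup H'] [InnerProductSpace ℂ H'] [CompleteSpace H']
  {S' : Submodule ℂ H'} [CompleteSpace S']
  {D' : Z' → Type*} [∀ z, NormedAddCommGroup (D' z)] [∀ z, NormedSpace ℂ (D' z)]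
  [TopologicalSpace (TotalSpace S' D')] [FiberBundle S' D'] [VectorBundle ℝ S' D']
  [ContMDiffVectorBundle ∞ S' D' 𝓘(ℝ, EB')]
  {ev : ∀ z, D z →ₗ[ℂ] H} {ev' : ∀ z, D' z →ₗ[ℂ] H'}
  {δ : TotalSpace S D → TotalSpace S' D'} {ζ : Z → Z'} {V : H →L[ℝ] H'}

/-- The chain rule for `ev' ∘ δ = V ∘ ev`, where the linear map `V` is its own derivative. -/
theorem evalDeriv_tangentMap
    (hδ : MDifferentiable (𝓘(ℝ, EB).prod 𝓘(ℝ, S)) (𝓘(ℝ, EB').prod 𝓘(ℝ, S')) δ)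
    (hev : MDifferentiable (𝓘(ℝ, EB).prod 𝓘(ℝ, S)) 𝓘(ℝ, H) (totalEval (S := S) ev))
    (hev' : MDifferentiable (𝓘(ℝ, EB').prod 𝓘(ℝ, S')) 𝓘(ℝ, H') (totalEval (S := S') ev'))
    (hV : ∀ ξ, totalEval ev' (δ ξ) = V (totalEval ev ξ)) (w : TangentTotal EB S D) :
    evalDeriv EB' ev' (tangentMap (𝓘(ℝ, EB).prod 𝓘(ℝ, S)) (𝓘(ℝ, EB').prod 𝓘(ℝ, S')) δ w) =
      V (evalDeriv EB ev w) := by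
  have h1 := mfderiv_comp w.1 (hev' (δ w.1)) (hδ w.1)
  have h2 := mfderiv_comp (g := V) w.1 V.mdifferentiableAt (hev w.1)
  have h3 : totalEval ev' ∘ δ = V ∘ totalEval ev := funext hV
  rw [h3, h2, V.mfderiv_eq] at h1
  exact (congrArg (fun L => L w.2) h1).symm

/-- The chain rule for `π' ∘ δ = ζ ∘ π`. -/
theorem IsVertical.tangentMap
    (hδ : MDifferentiable (𝓘(ℝ, EB).prod 𝓘(ℝ, S)) (𝓘(ℝ, EB').prod 𝓘(ℝ, S')) δ)
    (hζ : MDifferentiable 𝓘(ℝ, EB) 𝓘(ℝ, EB') ζ) (hδζ : ∀ ξ, (δ ξ).1 = ζ ξ.1)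
    {w : TangentTotal EB S D} (hw : IsVertical EB w) :
    IsVertical EB' (tangentMap (𝓘(ℝ, EB).prod 𝓘(ℝ, S)) (𝓘(ℝ, EB').prod 𝓘(ℝ, S')) δ w) := by
  have hπ : MDifferentiable (𝓘(ℝ, EB).prod 𝓘(ℝ, S)) 𝓘(ℝ, EB)
      (TotalSpace.proj : TotalSpace S D → Z) :=
    (Bundle.contMDiff_proj D (n := 1)).mdifferentiable (by simp)
  have hπ' : MDifferentiable (𝓘(ℝ, EB').prod 𝓘(ℝ, S')) 𝓘(ℝ, EB')
      (TotalSpace.proj : TotalSpace S' D' → Z') :=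
    (Bundle.contMDiff_proj D' (n := 1)).mdifferentiable (by simp)
  have h1 := mfderiv_comp w.1 (hπ' (δ w.1)) (hδ w.1)
  have h2 := mfderiv_comp w.1 (hζ w.1.1) (hπ w.1)
  have h3 : TotalSpace.proj ∘ δ = ζ ∘ TotalSpace.proj := funext hδζ
  rw [h3, h2] at h1
  refine (congrArg (fun L => L w.2) h1).symm.trans ?_
  refine (congrArg (mfderiv 𝓘(ℝ, EB) 𝓘(ℝ, EB') ζ w.1.1) hw).trans ?_
  exact map_zero _

/-- `V` sends the defect `d(ev)w' - d(ev)w` to the corresponding defect for the images. Preservation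
of orthogonality to the fibres is a separate hypothesis, instead of isometry of `V`, so that scalar
multiples of the identity are covered too. -/
theorem IsVerticalPart.tangentMap
    (hδ : MDifferentiable (𝓘(ℝ, EB).prod 𝓘(ℝ, S)) (𝓘(ℝ, EB').prod 𝓘(ℝ, S')) δ)
    (hζ : MDifferentiable 𝓘(ℝ, EB) 𝓘(ℝ, EB') ζ)
    (hev : MDifferentiable (𝓘(ℝ, EB).prod 𝓘(ℝ, S)) 𝓘(ℝ, H) (totalEval (S := S) ev))
    (hev' : MDifferentiable (𝓘(ℝ, EB').prod 𝓘(ℝ, S')) 𝓘(ℝ, H') (totalEval (S := S') ev'))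
    (hδζ : ∀ ξ, (δ ξ).1 = ζ ξ.1) (hV : ∀ ξ, totalEval ev' (δ ξ) = V (totalEval ev ξ))
    (horth : ∀ z x, (∀ η : D z, inner ℂ (ev z η) x = 0) →
      ∀ η' : D' (ζ z), inner ℂ (ev' _ η') (V x) = 0)
    {w w' : TangentTotal EB S D} (hw : IsVerticalPart EB ev w w') :
    IsVerticalPart EB' ev'
      (tangentMap (𝓘(ℝ, EB).prod 𝓘(ℝ, S)) (𝓘(ℝ, EB').prod 𝓘(ℝ, S')) δ w)
      (tangentMap (𝓘(ℝ, EB).prod 𝓘(ℝ, S)) (𝓘(ℝ, EB').prod 𝓘(ℝ, S')) δ w') := by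
  refine ⟨congrArg δ hw.base, hw.vertical.tangentMap hδ hζ hδζ, fun η => ?_⟩
  rw [evalDeriv_tangentMap hδ hev hev' hV, evalDeriv_tangentMap hδ hev hev' hV, ← map_sub]
  have key : ∀ z, z = ζ w.1.1 → ∀ η : D' z,
      inner ℂ (ev' _ η) (V (evalDeriv EB ev w' - evalDeriv EB ev w)) = 0 := by
    rintro z rfl η
    exact horth _ _ hw.orthogonal η
  exact key _ (hδζ w.1) η

end Morphisms

namespace IsHomogeneousBundle

variable {U : G →* unitary (H →L[ℂ] H)} {p : G → Z} {q : G × S → TotalSpace S D}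
  {ev : ∀ z, D z →ₗ[ℂ] H} (h : IsHomogeneousBundle E EB U p q ev)

include h

/-- Naturality for `V = c · id` over the identity of the base; it preserves orthogonality for every
`c`, including `0`. -/
theorem isVerticalPart_fibreSMul (c : ℂ) {w w' : TangentTotal EB S D}
    (hw : IsVerticalPart EB ev w w') : IsVerticalPart EB ev
      (tangentMap (𝓘(ℝ, EB).prod 𝓘(ℝ, S)) (𝓘(ℝ, EB).prod 𝓘(ℝ, S)) (fibreSMul c) w)
      (tangentMap (𝓘(ℝ, EB).prod 𝓘(ℝ, S)) (𝓘(ℝ, EB).prod 𝓘(ℝ, S)) (fibreSMul c) w') := by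
  refine hw.tangentMap (ζ := id) (V := (c • ContinuousLinearMap.id ℂ H).restrictScalars ℝ)
    ((h.contMDiff_fibreSMul c).mdifferentiable (by simp)) mdifferentiable_id
    h.mdifferentiable_totalEval h.mdifferentiable_totalEval (fun _ => rfl)
    (fun ξ => map_smul _ _ _) fun z x hx η => ?_
  change inner ℂ (ev z η) (c • x) = 0
  rw [inner_smul_right, hx, mul_zero]

/-- The derivative of the identity `ev(x + y) = ev x + ev y` on the Whitney sum. -/
theorem evalDeriv_fibreAdd
    (w : TangentBundle (𝓘(ℝ, EB).prod 𝓘(ℝ, S × S)) (TotalSpace (S × S) (D ×ᵇ D))) :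
    evalDeriv EB ev
        (tangentMap (𝓘(ℝ, EB).prod 𝓘(ℝ, S × S)) (𝓘(ℝ, EB).prod 𝓘(ℝ, S)) fibreAdd w) =
      evalDeriv EB ev
        (tangentMap (𝓘(ℝ, EB).prod 𝓘(ℝ, S × S)) (𝓘(ℝ, EB).prod 𝓘(ℝ, S)) fibreFst w) +
      evalDeriv EB ev
        (tangentMap (𝓘(ℝ, EB).prod 𝓘(ℝ, S × S)) (𝓘(ℝ, EB).prod 𝓘(ℝ, S)) fibreSnd w) := by
  have hA := h.contMDiff_fibreAdd.mdifferentiable (by simp) w.1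
  have hF := (contMDiff_fibreFst (EB := EB) (S := S) (D := D)).mdifferentiable (by simp) w.1
  have hS := (contMDiff_fibreSnd (EB := EB) (S := S) (D := D)).mdifferentiable (by simp) w.1
  have h1 := mfderiv_comp w.1 (h.mdifferentiable_totalEval _) hA
  have h2 := mfderiv_comp w.1 (h.mdifferentiable_totalEval _) hF
  have h3 := mfderiv_comp w.1 (h.mdifferentiable_totalEval _) hS
  have h4 : totalEval ev ∘ (fibreAdd : TotalSpace (S × S) (D ×ᵇ D) → TotalSpace S D) =
      totalEval ev ∘ fibreFst + totalEval ev ∘ fibreSnd := funext fun ξ => map_add _ _ _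
  have h5 := mfderiv_add ((h.mdifferentiable_totalEval _).comp _ hF)
    ((h.mdifferentiable_totalEval _).comp _ hS)
  rw [← h4, h1, h2, h3] at h5
  exact congrArg (fun L => L w.2) h5

/-- The defect of the sum is the sum of the two defects, each orthogonal to the common fibre. The
base points agree because a point of the Whitney sum is determined by its two projections. -/
theorem isVerticalPart_fibreAdd
    {w w' : TangentBundle (𝓘(ℝ, EB).prod 𝓘(ℝ, S × S)) (TotalSpace (S × S) (D ×ᵇ D))}
    (h1 : IsVerticalPart EB ev
      (tangentMap (𝓘(ℝ, EB).prod 𝓘(ℝ, S × S)) (𝓘(ℝ, EB).prod 𝓘(ℝ, S)) fibreFst w)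
      (tangentMap (𝓘(ℝ, EB).prod 𝓘(ℝ, S × S)) (𝓘(ℝ, EB).prod 𝓘(ℝ, S)) fibreFst w'))
    (h2 : IsVerticalPart EB ev
      (tangentMap (𝓘(ℝ, EB).prod 𝓘(ℝ, S × S)) (𝓘(ℝ, EB).prod 𝓘(ℝ, S)) fibreSnd w)
      (tangentMap (𝓘(ℝ, EB).prod 𝓘(ℝ, S × S)) (𝓘(ℝ, EB).prod 𝓘(ℝ, S)) fibreSnd w')) :
    IsVerticalPart EB ev
      (tangentMap (𝓘(ℝ, EB).prod 𝓘(ℝ, S × S)) (𝓘(ℝ, EB).prod 𝓘(ℝ, S)) fibreAdd w)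
      (tangentMap (𝓘(ℝ, EB).prod 𝓘(ℝ, S × S)) (𝓘(ℝ, EB).prod 𝓘(ℝ, S)) fibreAdd w') := by
  refine ⟨?_, ?_, fun η => ?_⟩
  · have hb : ∀ ξ ξ' : TotalSpace (S × S) (D ×ᵇ D), (fibreFst ξ : TotalSpace S D) = fibreFst ξ' →
        (fibreSnd ξ : TotalSpace S D) = fibreSnd ξ' →
        (fibreAdd ξ : TotalSpace S D) = fibreAdd ξ' := by
      rintro ⟨z, x, y⟩ ⟨z', x', y'⟩ e1 e2
      obtain rfl : z = z' := congrArg TotalSpace.proj e1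
      obtain rfl : x = x' := eq_of_heq (TotalSpace.mk.inj e1).2
      obtain rfl : y = y' := eq_of_heq (TotalSpace.mk.inj e2).2
      rfl
    exact hb _ _ h1.base h2.base
  · have hπ : MDifferentiable (𝓘(ℝ, EB).prod 𝓘(ℝ, S)) 𝓘(ℝ, EB)
        (TotalSpace.proj : TotalSpace S D → Z) :=
      (Bundle.contMDiff_proj D (n := 1)).mdifferentiable (by simp)
    have hA := mfderiv_comp w'.1 (hπ _) (h.contMDiff_fibreAdd.mdifferentiable (by simp) w'.1)
    have hF := mfderiv_comp w'.1 (hπ _)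
      ((contMDiff_fibreFst (EB := EB) (S := S) (D := D)).mdifferentiable (by simp) w'.1)
    -- `fibreAdd` and `fibreFst` have the same composite with the projection to the base, by
    -- definition; so verticality of the first component gives that of the sum.
    have hAF := hA.symm.trans hF
    refine (congrArg (fun L => L w'.2) hAF).trans ?_
    exact h1.vertical
  · rw [h.evalDeriv_fibreAdd, h.evalDeriv_fibreAdd, add_sub_add_comm, inner_add_right]
    exact (congrArg₂ (· + ·) (h1.orthogonal η) (h2.orthogonal η)).trans (add_zero 0)

theorem isLinearConnection_verticalPart : IsLinearConnection EB S D (verticalPart EB ev) where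
  toIsConnection := h.isConnection_verticalPart
  smul c w := h.verticalPart_eq (h.isVerticalPart_fibreSMul c (h.isVerticalPart_verticalPart w))
  add _ _ h1 h2 := h.verticalPart_eq (h.isVerticalPart_fibreAdd
    (h1 ▸ h.isVerticalPart_verticalPart _) (h2 ▸ h.isVerticalPart_verticalPart _))

/-- Differentiate `U(gx) = U(g)U(x)` at `x = 1`. -/
theorem repDeriv_mulInvariantVectorField (g : G) (X : GroupLieAlgebra 𝓘(ℝ, E) G) (x : H) :
    repDeriv E U g (mulInvariantVectorField X g) x = (U g : H →L[ℂ] H) (repDeriv E U 1 X x) := by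
  have hU : MDifferentiable 𝓘(ℝ, E) 𝓘(ℝ, H →L[ℂ] H) (fun g => (U g : H →L[ℂ] H)) :=
    h.contMDiff_U.mdifferentiable (by simp)
  have hm : MDifferentiable 𝓘(ℝ, E) 𝓘(ℝ, E) (fun x : G => g * x) :=
    (contMDiff_mul_left (I := 𝓘(ℝ, E)) (n := ∞) (a := g)).mdifferentiable (by simp)
  have h1 := mfderiv_comp (1 : G) (hU (g * 1)) (hm 1)
  let A : (H →L[ℂ] H) →L[ℝ] (H →L[ℂ] H) := ContinuousLinearMap.mul ℝ (H →L[ℂ] H) (U g : H →L[ℂ] H)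
  have h2 := mfderiv_comp (g := A) (1 : G) A.mdifferentiableAt (hU 1)
  have h3 : (fun g => (U g : H →L[ℂ] H)) ∘ (fun x => g * x) =
      A ∘ (fun g => (U g : H →L[ℂ] H)) := by
    funext x
    simp [A]
  rw [h3, h2, A.mfderiv_eq] at h1
  -- The chain rule yields the derivative at `g * 1`, which has to be moved to `g`.
  have h4 : ∀ g', g' = g → ∀ v : E, repDeriv E U g' v = repDeriv E U g v := by
    rintro _ rfl v; rfl
  refine (congrArg (fun A : H →L[ℂ] H => A x) (h4 _ (mul_one g) _)).symm.trans ?_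
  exact (congrArg (fun L : E →L[ℝ] (H →L[ℂ] H) => L X x) h1).symm

omit h in
-- The tangent map of left translation by `g⁻¹` inverts that of translation by `g`. Consequently the
-- classes with `X` in the Lie algebra exhaust the tangent bundle of the total space.
theorem exists_mulInvariantVectorField_eq (g : G) (X : TangentSpace 𝓘(ℝ, E) g) :
    ∃ Y : GroupLieAlgebra 𝓘(ℝ, E) G, mulInvariantVectorField Y g = X := by
  have hm : ∀ g : G, MDifferentiable 𝓘(ℝ, E) 𝓘(ℝ, E) (fun x : G => g * x) := fun g =>
    (contMDiff_mul_left (I := 𝓘(ℝ, E)) (n := ∞) (a := g)).mdifferentiable (by simp)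
  have h1 := mfderiv_comp g (hm g (g⁻¹ * g)) (hm g⁻¹ g)
  have h2 : (fun x : G => g * x) ∘ (fun x => g⁻¹ * x) = id := by funext x; simp
  rw [h2, mfderiv_id] at h1
  have h3 : ∀ g', g' = 1 → ∀ v : E, (mfderiv 𝓘(ℝ, E) 𝓘(ℝ, E) (fun x : G => g * x) g' v : E) =
      mfderiv 𝓘(ℝ, E) 𝓘(ℝ, E) (fun x : G => g * x) 1 v := by
    rintro _ rfl v; rfl
  refine ⟨mfderiv 𝓘(ℝ, E) 𝓘(ℝ, E) (fun x : G => g⁻¹ * x) g X, ?_⟩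
  refine (h3 _ (inv_mul_cancel g) _).symm.trans ?_
  exact (congrArg (fun L : E →L[ℝ] E => L X) h1).symm

/-- The formula for the vertical part in terms of the derived representation determines it. -/
theorem eq_verticalPart_iff (Φ : TangentTotal EB S D → TangentTotal EB S D) :
    (∀ g (X : GroupLieAlgebra 𝓘(ℝ, E) G) f y,
      Φ (tq E EB q g f (mulInvariantVectorField X g) y) =
        tq E EB q g f (mulInvariantVectorField (0 : GroupLieAlgebra 𝓘(ℝ, E) G) g)
          (S.orthogonalProjectionOnto (repDeriv E U 1 X f) + y)) ↔
      Φ = verticalPart EB ev := by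
  have h0 : ∀ g, mulInvariantVectorField (0 : GroupLieAlgebra 𝓘(ℝ, E) G) g = 0 := fun g =>
    map_zero (mfderiv 𝓘(ℝ, E) 𝓘(ℝ, E) (fun x : G => g * x) 1)
  have key : ∀ g (X : GroupLieAlgebra 𝓘(ℝ, E) G) f y,
      verticalPart EB ev (tq E EB q g f (mulInvariantVectorField X g) y) =
        tq E EB q g f (mulInvariantVectorField (0 : GroupLieAlgebra 𝓘(ℝ, E) G) g)
          (S.orthogonalProjectionOnto (repDeriv E U 1 X f) + y) := by
    intro g X f y
    rw [h.verticalPart_tq, h.repDeriv_mulInvariantVectorField, map_inv,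
      Unitary.coe_inv_apply_apply, h0]
  constructor
  -- Uniqueness: every tangent vector is a class. The converse implication is existence, that is,
  -- independence of the formula from the chosen representatives.
  · intro hΦ
    funext w
    obtain ⟨g, X, f, y, rfl, -⟩ := h.exists_eq_tq w
    obtain ⟨Y, rfl⟩ := exists_mulInvariantVectorField_eq g X
    rw [hΦ, key]
  · rintro rfl
    exact key

variable {E' : Type*} [NormedAddCommGroup E'] [NormedSpace ℝ E']
  {G' : Type*} [TopologicalSpace G'] [ChartedSpace E' G'] [Group G'] [LieGroup 𝓘(ℝ, E') ∞ G']
  {EB' : Type*} [NormedAddCommGroup EB'] [NormedSpace ℝ EB']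
  {Z' : Type*} [TopologicalSpace Z'] [ChartedSpace EB' Z'] [IsManifold 𝓘(ℝ, EB') ∞ Z']
  {H' : Type*} [NormedAddCommGroup H'] [InnerProductSpace ℂ H'] [CompleteSpace H']
  {S' : Submodule ℂ H'} [CompleteSpace S']
  {D' : Z' → Type*} [∀ z, NormedAddCommGroup (D' z)] [∀ z, NormedSpace ℂ (D' z)]
  [TopologicalSpace (TotalSpace S' D')] [FiberBundle S' D'] [VectorBundle ℝ S' D']
  [ContMDiffVectorBundle ∞ S' D' 𝓘(ℝ, EB')]
  {U' : G' →* unitary (H' →L[ℂ] H')} {p' : G' → Z'} {q' : G' × S' → TotalSpace S' D'}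
  {ev' : ∀ z, D' z →ₗ[ℂ] H'}

/-- The projections to the vertical parts correspond to each other under smooth morphisms of
homogeneous bundles which intertwine the evaluation maps through an isometry. -/
theorem isPullbackConnection (h' : IsHomogeneousBundle E' EB' U' p' q' ev') (V : H →ₗᵢ[ℂ] H')
    {δ : TotalSpace S D → TotalSpace S' D'} {ζ : Z → Z'}
    (hδ : ContMDiff (𝓘(ℝ, EB).prod 𝓘(ℝ, S)) (𝓘(ℝ, EB').prod 𝓘(ℝ, S')) ∞ δ)
    (hζ : ContMDiff 𝓘(ℝ, EB) 𝓘(ℝ, EB') ∞ ζ)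
    (hA : ∀ s, ∃ A : D s ≃L[ℂ] D' (ζ s), ∀ x, δ ⟨s, x⟩ = ⟨ζ s, A x⟩)
    (hV : ∀ ξ, totalEval ev' (δ ξ) = V (totalEval ev ξ)) :
    IsPullbackConnection EB S D EB' S' D' δ ζ (verticalPart EB' ev') (verticalPart EB ev) := by
  have hδd := hδ.mdifferentiable (by simp)
  have hV' : ∀ ξ, totalEval ev' (δ ξ) = V.toContinuousLinearMap.restrictScalars ℝ (totalEval ev ξ) :=
    hV
  have hcomm : ∀ w : TangentTotal EB S D,
      tangentMap (𝓘(ℝ, EB).prod 𝓘(ℝ, S)) (𝓘(ℝ, EB').prod 𝓘(ℝ, S')) δ (verticalPart EB ev w) =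
        verticalPart EB' ev'
          (tangentMap (𝓘(ℝ, EB).prod 𝓘(ℝ, S)) (𝓘(ℝ, EB').prod 𝓘(ℝ, S')) δ w) := by
    intro w
    refine (h'.verticalPart_eq ((h.isVerticalPart_verticalPart w).tangentMap hδd
      (hζ.mdifferentiable (by simp)) h.mdifferentiable_totalEval h'.mdifferentiable_totalEval
      (fun ξ => ?_) hV' fun z x hx η' => ?_)).symm
    · obtain ⟨A, hA⟩ := hA ξ.1
      exact congrArg TotalSpace.proj (hA ξ.2)
    -- Every vector of the target fibre is `A η`, with evaluation `V(ev η)`, so orthogonality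
    -- follows from the isometry of `V`.
    · obtain ⟨A, hA⟩ := hA z
      obtain ⟨η, rfl⟩ := A.surjective η'
      have h1 : ev' _ (A η) = V (ev z η) := by
        have := hV ⟨z, η⟩
        rwa [hA] at this
      rw [h1]
      exact (V.inner_map_map _ _).trans (hx η)
  refine ⟨hδ, hζ, hA, h.isConnection_verticalPart, h'.isConnection_verticalPart, hcomm,
    fun Ψ hΨ hc => funext fun w => ?_⟩
  -- Uniqueness of the pull-back: `Ψ w` is vertical over the base point of `w`, and the intertwining
  -- relation fixes `V` of its image in `H`. As `V` is injective, `ext_vertical` identifies it with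
  -- the vertical part.
  obtain ⟨L, hL, hr⟩ := hΨ.fibrewise w.1
  have hw : Ψ w = ⟨w.1, L w.2⟩ := hL w.2
  have hp := h.isVerticalPart_verticalPart w
  refine h.ext_vertical ((congrArg TotalSpace.proj hw).trans hp.base.symm) ?_ hp.vertical ?_
  · rw [hw]
    exact hr.le ⟨w.2, rfl⟩
  · have h1 := congrArg (evalDeriv EB' ev') ((hc w).trans (hcomm w).symm)
    rw [evalDeriv_tangentMap hδd h.mdifferentiable_totalEval h'.mdifferentiable_totalEval hV',
      evalDeriv_tangentMap hδd h.mdifferentiable_totalEval h'.mdifferentiable_totalEval hV'] at h1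
    exact V.injective h1

end IsHomogeneousBundle

end HomogeneousBundles

/-! ### The two homogeneous bundles: `G ×_B HB` and the tautological bundle. -/

theorem contMDiff_quotientGroup_mk {E : Type*} [NormedAddCommGroup E] [NormedSpace ℝ E]
    [CompleteSpace E] {G : Type*} [TopologicalSpace G] [ChartedSpace E G] [Group G]
    [LieGroup 𝓘(ℝ, E) ∞ G] (B : Subgroup G) [IsBanachLieSubgroup (E := E) B] :
    ContMDiff 𝓘(ℝ, E) 𝓘(ℝ, QuotientModel E B) ∞ (fun g : G => (g : G ⧸ B)) := by
  intro g₀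
  rw [contMDiffAt_iff_target]
  refine ⟨QuotientGroup.continuous_mk.continuousAt, ?_⟩
  set s : G ⧸ B := (g₀ : G ⧸ B)
  -- The chart at the class of `g₀` is based at the chosen representative `s.out`, which may differ
  -- from `g₀`; right invariance of `Ω` makes up for this.
  have h1 : s.out⁻¹ * g₀ ∈ (quotientSlice E B).Ω :=
    ((quotientSlice E B).out_mem_iff s.out g₀).1 (mem_chart_source (QuotientModel E B) s)
  have h2 : ContMDiffAt 𝓘(ℝ, E) 𝓘(ℝ, QuotientModel E B) ∞
      (fun g : G => (quotientSlice E B).r (s.out⁻¹ * g)) g₀ :=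
    ContMDiffAt.comp g₀ (g := (quotientSlice E B).r) (f := fun g : G => s.out⁻¹ * g)
      ((quotientSlice E B).contMDiffOn_r.contMDiffAt ((quotientSlice E B).isOpen_Ω.mem_nhds h1))
      (contMDiff_mul_left (a := s.out⁻¹)).contMDiffAt
  have h3 : ContinuousAt (fun g : G => s.out⁻¹ * g) g₀ :=
    (contMDiff_mul_left (I := 𝓘(ℝ, E)) (n := ∞) (a := s.out⁻¹)).continuous.continuousAt
  refine h2.congr_of_eventuallyEq ?_
  filter_upwards [h3.preimage_mem_nhds ((quotientSlice E B).isOpen_Ω.mem_nhds h1)] with g hg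
  -- In this chart the quotient map reads `g ↦ r(s.out⁻¹g)`, as `r` does not depend on the
  -- representative of the coset.
  exact (quotientSlice E B).r_out s.out g hg

namespace HomogeneousData

open Bundle

variable {E : Type*} {G : Type*} [TopologicalSpace G] [Group G] {B : Subgroup G}
  {HA : Type*} [NormedAddCommGroup HA] [InnerProductSpace ℂ HA] [CompleteSpace HA]
  (R : HomogeneousData E B HA)

theorem toHA_frame (s : G ⧸ B) (g : G) (hg : (g : G ⧸ B) = s) (f : R.HB) :
    R.toHA (R.frame s g hg f).1 = R.op g f := by
  rw [frame_apply]; rfl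

/-- The map `[(g, f)] ↦ ρ(g)f` on the fibres of the homogeneous bundle. -/
noncomputable def fiberEval (s : G ⧸ B) : R.Fiber s →ₗ[ℂ] HA where
  toFun ξ := R.toHA ξ.1
  map_add' x y := by
    obtain ⟨f, rfl⟩ := (R.frame s s.out (Quotient.out_eq' s)).surjective x
    obtain ⟨f', rfl⟩ := (R.frame s s.out (Quotient.out_eq' s)).surjective y
    have h := R.toHA_frame s s.out (Quotient.out_eq' s) (f + f')
    rw [map_add, Submodule.coe_add, map_add] at h
    rw [toHA_frame, toHA_frame]
    exact h
  map_smul' c x := by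
    obtain ⟨f, rfl⟩ := (R.frame s s.out (Quotient.out_eq' s)).surjective x
    have h := R.toHA_frame s s.out (Quotient.out_eq' s) (c • f)
    rw [map_smul, Submodule.coe_smul, map_smul] at h
    rw [toHA_frame]
    exact h

theorem fiberEval_frame (s : G ⧸ B) (g : G) (hg : (g : G ⧸ B) = s) (f : R.HB) :
    R.fiberEval s (R.frame s g hg f) = R.op g f := R.toHA_frame s g hg f

theorem quot_eq (s : G ⧸ B) (g : G) (hg : (g : G ⧸ B) = s) (f : R.HB) :
    R.quot (g, f) = ⟨s, R.frame s g hg f⟩ := by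
  subst hg
  exact congrArg (TotalSpace.mk _) (Subtype.ext (R.frame_apply _ g rfl f).symm)

variable [NormedAddCommGroup E] [NormedSpace ℝ E] [CompleteSpace E] [ChartedSpace E G]
  [LieGroup 𝓘(ℝ, E) ∞ G] [IsBanachLieSubgroup (E := E) B]

theorem trivializationAt_apply (s₀ s : G ⧸ B)
    (hs : s ∈ (trivializationAt R.HB R.Fiber s₀).baseSet) (ξ : R.Fiber s) :
    trivializationAt R.HB R.Fiber s₀ ⟨s, ξ⟩ =
      (s, (R.frame s (R.sec E s₀.out s) (R.mk_sec E s₀.out s hs)).symm ξ) :=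
  (R.frames E).pretriv_apply s₀.out s hs ξ

/-- The trivializations were built from the frames `f ↦ [(σ(s), f)]` of the local sections `sec`, so
these sections are adapted to them. Injectivity of the evaluation is that of `ρ(g)`. -/
theorem isHomogeneousBundle : IsHomogeneousBundle E (QuotientModel E B) R.ρ
    (fun g : G => (g : G ⧸ B)) R.quot R.fiberEval where
  contMDiff_U := R.contMDiff_op
  contMDiff_p := contMDiff_quotientGroup_mk B
  proj_q _ := rfl
  ev_q _ _ := rfl
  ev_injective s x y hxy := by
    obtain ⟨f, rfl⟩ := (R.frame s s.out (Quotient.out_eq' s)).surjective x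
    obtain ⟨f', rfl⟩ := (R.frame s s.out (Quotient.out_eq' s)).surjective y
    rw [fiberEval_frame, fiberEval_frame] at hxy
    congr 1
    exact Subtype.ext ((Unitary.linearIsometryEquiv (R.ρ s.out)).injective hxy)
  exists_ev g η := by
    obtain ⟨f, rfl⟩ := (R.frame g g rfl).surjective η
    exact ⟨f, R.fiberEval_frame _ g rfl f⟩
  exists_section s₀ := by
    refine ⟨R.sec E s₀.out, R.contMDiffOn_sec s₀.out, fun s hs => ⟨R.mk_sec E s₀.out s hs,
      fun y => ?_⟩⟩
    rw [R.quot_eq s _ (R.mk_sec E s₀.out s hs), R.trivializationAt_apply s₀ s hs,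
      LinearIsometryEquiv.symm_apply_apply]

end HomogeneousData

namespace Gr

open Bundle

variable {H : Type*} [NormedAddCommGroup H] [InnerProductSpace ℂ H] [CompleteSpace H]
  (S₀ : Submodule ℂ H)

theorem homeo_mk (u : unitary (H →L[ℂ] H)) :
    homeo S₀ (mk S₀ u) = (u : unitary (H →L[ℂ] H) ⧸ isotropy S₀) :=
  (equiv S₀).symm_apply_apply (u : unitary (H →L[ℂ] H) ⧸ isotropy S₀)

variable [CompleteSpace S₀]

/-- The charts of the Grassmannian are those of `U(H) ⧸ U(p)` transported by `homeo`, so in charts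
this is the quotient map. -/
theorem contMDiff_mk : ContMDiff 𝓘(ℝ, Skew (H →L[ℂ] H))
    𝓘(ℝ, QuotientModel (Skew (H →L[ℂ] H)) (isotropy S₀)) ∞ (mk S₀) := by
  intro u
  have h := contMDiff_quotientGroup_mk (E := Skew (H →L[ℂ] H)) (isotropy S₀) u
  rw [contMDiffAt_iff_target] at h ⊢
  have hc : mk S₀ = (homeo S₀).symm ∘ fun u : unitary (H →L[ℂ] H) =>
      (u : unitary (H →L[ℂ] H) ⧸ isotropy S₀) := by
    funext u
    exact ((homeo S₀).symm_apply_eq.2 (homeo_mk S₀ u).symm).symm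
  refine ⟨?_, ?_⟩
  · rw [hc]; exact (homeo S₀).symm.continuous.continuousAt.comp h.1
  · refine h.2.congr_of_eventuallyEq (Eventually.of_forall fun v => ?_)
    change chart S₀ (homeo S₀ (mk S₀ u)).out (mk S₀ v) = _
    rw [homeo_mk]
    exact congrArg ((quotientSlice (Skew (H →L[ℂ] H)) (isotropy S₀)).chart _) (homeo_mk S₀ v)

/-- The inclusion of the fibres of the tautological bundle. -/
noncomputable def fiberEval (S : Gr S₀) : Fiber S₀ S →ₗ[ℂ] H := S.1.subtype

theorem quot_eq (S : Gr S₀) (u : unitary (H →L[ℂ] H)) (hu : unitaryImage u S₀ = S.1) (x : S₀) :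
    quot S₀ (u, x) = ⟨S, frame S₀ S u hu x⟩ := by
  obtain rfl : mk S₀ u = S := Subtype.ext hu
  rfl

theorem trivializationAt_apply (S₁ S : Gr S₀)
    (hS : S ∈ (trivializationAt S₀ (Fiber S₀) S₁).baseSet) (x : Fiber S₀ S) :
    trivializationAt S₀ (Fiber S₀) S₁ ⟨S, x⟩ =
      (S, (frame S₀ S (sec S₀ (homeo S₀ S₁).out S) (unitaryImage_sec S₀ _ S hS)).symm x) :=
  (frames S₀).pretriv_apply (homeo S₀ S₁).out S hS x

/-- Here the group is `U(H)` in its identity representation, and a fibre is evaluated by its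
inclusion in `H`. -/
theorem isHomogeneousBundle : IsHomogeneousBundle (Skew (H →L[ℂ] H))
    (QuotientModel (Skew (H →L[ℂ] H)) (isotropy S₀)) (MonoidHom.id (unitary (H →L[ℂ] H)))
    (mk S₀) (quot S₀) (fiberEval S₀) where
  contMDiff_U := contMDiff_coe_unitary (H →L[ℂ] H)
  contMDiff_p := contMDiff_mk S₀
  proj_q _ := rfl
  ev_q _ _ := rfl
  ev_injective _ := Subtype.val_injective
  exists_ev g η := by
    obtain ⟨_, f, hf, rfl⟩ := η
    exact ⟨⟨f, hf⟩, rfl⟩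
  exists_section S₁ := by
    refine ⟨sec S₀ (homeo S₀ S₁).out, contMDiffOn_sec S₀ _, fun S hS =>
      ⟨Subtype.ext (unitaryImage_sec S₀ _ S hS), fun y => ?_⟩⟩
    rw [quot_eq S₀ S (sec S₀ (homeo S₀ S₁).out S) (unitaryImage_sec S₀ _ S hS), trivializationAt_apply S₀ S₁ S hS,
      LinearIsometryEquiv.symm_apply_apply]

end Gr

/-! ### The universal connection as a projection to vertical parts. -/

open Bundle in
/-- The universal connection on the tautological bundle. -/
noncomputable def Gr.universalConnection {H : Type*} [NormedAddCommGroup H] [InnerProductSpace ℂ H]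
    [CompleteSpace H] (S₀ : Submodule ℂ H) [CompleteSpace S₀] :
    TangentTotal (QuotientModel (Skew (H →L[ℂ] H)) (isotropy S₀)) S₀ (Gr.Fiber S₀) →
      TangentTotal (QuotientModel (Skew (H →L[ℂ] H)) (isotropy S₀)) S₀ (Gr.Fiber S₀) :=
  verticalPart (QuotientModel (Skew (H →L[ℂ] H)) (isotropy S₀)) (Gr.fiberEval S₀)

-- For `x ∈ S₀` one has `(1 - p)x = 0` and `px = x`, whence `E_p(X)x = pXx`. The formula thus
-- becomes the one on classes for the identity representation of `U(H)`, whose derivative at the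
-- unit is `unitaryLieOp`.
open Bundle in
theorem isUniversalConnection_iff {H : Type*} [NormedAddCommGroup H] [InnerProductSpace ℂ H]
    [CompleteSpace H] (S₀ : Submodule ℂ H) [CompleteSpace S₀]
    (Φ : TangentTotal (QuotientModel (Skew (H →L[ℂ] H)) (isotropy S₀)) S₀ (Gr.Fiber S₀) →
      TangentTotal (QuotientModel (Skew (H →L[ℂ] H)) (isotropy S₀)) S₀ (Gr.Fiber S₀)) :
    IsUniversalConnection S₀ Φ ↔ Φ = Gr.universalConnection S₀ := by
  rw [Gr.universalConnection, ← (Gr.isHomogeneousBundle S₀).eq_verticalPart_iff]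
  have h : ∀ X (x : S₀), (⟨expectation S₀ (unitaryLieOp X) x, expectation_apply_mem S₀ _ x⟩ : S₀) =
      S₀.orthogonalProjectionOnto (unitaryLieOp X x) := by
    intro X x
    refine Subtype.ext ?_
    have h1 : (1 - S₀.starProjection) (x : H) = 0 := by
      rw [sub_apply, Submodule.starProjection_eq_self_iff.2 x.2]
      exact sub_self _
    have h2 : expectation S₀ (unitaryLieOp X) x =
        S₀.starProjection (unitaryLieOp X (S₀.starProjection x)) +
        (1 - S₀.starProjection) (unitaryLieOp X ((1 - S₀.starProjection) x)) := rfl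
    change expectation S₀ (unitaryLieOp X) x = _
    rw [h2, h1, map_zero, map_zero, add_zero, Submodule.starProjection_eq_self_iff.2 x.2]
    rfl
  simp only [IsUniversalConnection, h]
  exact Iff.rfl

namespace HomogeneousData

open Bundle

variable {E : Type*} {G : Type*} [TopologicalSpace G] [Group G] {B : Subgroup G}
  {HA : Type*} [NormedAddCommGroup HA] [InnerProductSpace ℂ HA] [CompleteSpace HA]
  (R : HomogeneousData E B HA)

/-! ### The reproducing kernel Hilbert space of `K_ρ` is `HA`. -/

section KernelSpace

/-- Tested against `HB`, the projection `P` in `K_ρ` disappears, and the unitary `ρ(u⁻¹)` moves to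
the other side. So `K_ρ` is the Gram kernel of the evaluation, which is the reason why `H^K` is a
copy of `HA`. -/
theorem inner_kernel (s t : G ⧸ B) (ξ : R.Fiber s) (η : R.Fiber t) :
    inner ℂ ξ (R.kernel.K s t η) = inner ℂ (R.fiberEval s ξ) (R.fiberEval t η) := by
  refine (R.inner_kernelOp s t ξ η).trans ?_
  rw [← R.fiberEval_frame s s.out (Quotient.out_eq' s), ← R.fiberEval_frame t t.out
    (Quotient.out_eq' t), LinearIsometryEquiv.apply_symm_apply, LinearIsometryEquiv.apply_symm_apply]

/-- The linear map with `K_ξ ↦ ρ(u)f` for `ξ = [(u, f)]`. -/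
noncomputable def spanEval : R.kernel.Span →ₗ[ℂ] HA :=
  Finsupp.linearCombination ℂ (fun x : Σ s, R.Fiber s => R.fiberEval x.1 x.2)

theorem inner_spanEval (c d : R.kernel.Span) :
    inner ℂ (R.spanEval c) (R.spanEval d) = inner ℂ c d := by
  -- Stated on finitely supported functions, of which `Span` is a synonym, so that both sides expand
  -- into the same double sum.
  have key : ∀ c d : (Σ s, R.Fiber s) →₀ ℂ,
      inner ℂ (Finsupp.linearCombination ℂ (fun x : Σ s, R.Fiber s => R.fiberEval x.1 x.2) c)
        (Finsupp.linearCombination ℂ (fun x : Σ s, R.Fiber s => R.fiberEval x.1 x.2) d) =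
        R.kernel.form c d := by
    intro c d
    rw [Finsupp.linearCombination_apply, Finsupp.linearCombination_apply, Finsupp.sum_inner]
    simp only [PosDefKernel.form, inner_kernel, Finsupp.sum, mul_assoc, inner_smul_left, inner_sum,
      inner_smul_right]
    exact Finset.sum_congr rfl fun ξ _ => Finset.sum_congr rfl fun η _ => by ring
  exact key c d

/-- `Span` is only seminormed, since distinct formal combinations may be at distance zero;
preservation of the seminorm is what lets the map extend to the completion and be isometric there.
-/
theorem norm_spanEval (c : R.kernel.Span) : ‖R.spanEval c‖ = ‖c‖ := by
  rw [@norm_eq_sqrt_re_inner ℂ, @norm_eq_sqrt_re_inner ℂ, inner_spanEval]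

/-- The bounded operator on the reproducing kernel Hilbert space with `K_ξ ↦ ρ(u)f` for
`ξ = [(u, f)]`. -/
noncomputable def spaceMap : R.kernel.Space →L[ℂ] HA :=
  (R.spanEval.mkContinuous 1 fun c => by rw [norm_spanEval, one_mul]).extend
    (UniformSpace.Completion.toComplL (𝕜 := ℂ) (E := R.kernel.Span))

theorem spaceMap_coe (c : R.kernel.Span) :
    R.spaceMap (UniformSpace.Completion.coe' c) = R.spanEval c :=
  ContinuousLinearMap.extend_eq _ (e := UniformSpace.Completion.toComplL (𝕜 := ℂ)
    (E := R.kernel.Span)) UniformSpace.Completion.denseRange_coe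
    (UniformSpace.Completion.isUniformInducing_coe _) c

/-- The isometry from the reproducing kernel Hilbert space with `K_ξ ↦ ρ(u)f` for
`ξ = [(u, f)]`. -/
noncomputable def spaceIsometry : R.kernel.Space →ₗᵢ[ℂ] HA where
  toLinearMap := R.spaceMap.toLinearMap
  norm_map' x := by
    induction x using UniformSpace.Completion.induction_on with
    | hp => exact isClosed_eq (R.spaceMap.continuous.norm) continuous_norm
    | ih c =>
      refine (congrArg norm (R.spaceMap_coe c)).trans ?_
      rw [norm_spanEval, UniformSpace.Completion.norm_coe]

theorem spaceIsometry_hat (s : G ⧸ B) (ξ : R.Fiber s) :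
    R.spaceIsometry (R.kernel.hat s ξ) = R.fiberEval s ξ := by
  refine (R.spaceMap_coe _).trans ((Finsupp.linearCombination_single ℂ (1 : ℂ)
    (⟨s, ξ⟩ : Σ s, R.Fiber s)).trans (one_smul ℂ _))

/-- The range of an isometry on a complete space is closed, and it contains all `ρ(g)f` with `f ∈
HB`, which span a dense subspace. -/
theorem surjective_spaceIsometry : Function.Surjective R.spaceIsometry := by
  refine (LinearMap.range_eq_top (f := R.spaceIsometry.toLinearMap)).1 ?_
  rw [← top_le_iff, ← R.dense_span]
  refine Submodule.topologicalClosure_minimal _ ?_ ?_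
  · rw [Submodule.span_le]
    rintro _ ⟨g, f, hf, rfl⟩
    exact ⟨R.kernel.hat g (R.frame g g rfl ⟨f, hf⟩),
      (R.spaceIsometry_hat _ _).trans (R.fiberEval_frame _ g rfl ⟨f, hf⟩)⟩
  · exact R.spaceIsometry.isometry.isClosedEmbedding.isClosed_range

/-- The unitary map from `HA` to the reproducing kernel Hilbert space with `ρ(u)f ↦ K_ξ` for
`ξ = [(u, f)]`. -/
noncomputable def spaceEquiv : HA ≃ₗᵢ[ℂ] R.kernel.Space :=
  (LinearIsometryEquiv.ofSurjective R.spaceIsometry R.surjective_spaceIsometry).symm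

theorem spaceEquiv_fiberEval (s : G ⧸ B) (ξ : R.Fiber s) :
    R.spaceEquiv (R.fiberEval s ξ) = R.kernel.hat s ξ := by
  rw [← spaceIsometry_hat]
  exact (LinearIsometryEquiv.ofSurjective R.spaceIsometry
    R.surjective_spaceIsometry).symm_apply_apply _

/-- `K̂` maps the fibre over `gB` onto `W(ρ(g)HB)`, with `W` the map `spaceEquiv`. This is already a
closed subspace, so neither the span nor the closure in the definition of `ζ_K` adds anything. -/
theorem kernel_ζ_mk (g : G) : R.kernel.ζ (g : G ⧸ B) =
    (unitaryImage (R.ρ g) R.HB).map (R.spaceEquiv.toLinearEquiv : HA →ₗ[ℂ] R.kernel.Space) := by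
  have hmem : ∀ x, x ∈ range (R.kernel.hat (g : G ⧸ B)) ↔ x ∈ (unitaryImage (R.ρ g) R.HB).map
      (R.spaceEquiv.toLinearEquiv : HA →ₗ[ℂ] R.kernel.Space) := by
    intro x
    constructor
    · rintro ⟨ξ, rfl⟩
      obtain ⟨f, rfl⟩ := (R.frame g g rfl).surjective ξ
      refine ⟨_, ⟨f, f.2, rfl⟩, ?_⟩
      rw [← spaceEquiv_fiberEval, fiberEval_frame]
      rfl
    · rintro ⟨_, ⟨f, hf, rfl⟩, rfl⟩
      refine ⟨R.frame g g rfl ⟨f, hf⟩, ?_⟩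
      rw [← spaceEquiv_fiberEval, fiberEval_frame]
      rfl
  have hspan : Submodule.span ℂ (range (R.kernel.hat (g : G ⧸ B))) =
      (unitaryImage (R.ρ g) R.HB).map
        (R.spaceEquiv.toLinearEquiv : HA →ₗ[ℂ] R.kernel.Space) := by
    rw [show range (R.kernel.hat (g : G ⧸ B)) = _ from Set.ext hmem]
    exact Submodule.span_eq _
  rw [PosDefKernel.ζ, hspan]
  refine IsClosed.submodule_topologicalClosure_eq ?_
  have h1 := ((Unitary.linearIsometryEquiv (R.ρ g)).trans
    R.spaceEquiv).toHomeomorph.isClosedMap _ R.isClosed_HB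
  convert h1 using 1
  ext x
  constructor
  · rintro ⟨_, ⟨f, hf, rfl⟩, rfl⟩
    exact ⟨f, hf, rfl⟩
  · rintro ⟨f, hf, rfl⟩
    exact ⟨_, ⟨f, hf, rfl⟩, rfl⟩

end KernelSpace

/-! ### Morphisms to a tautological bundle induced by a unitary map `W`. -/

section Isometry

variable {H : Type*} [NormedAddCommGroup H] [InnerProductSpace ℂ H] [CompleteSpace H]

/-- The unitary operator `W u W⁻¹`. -/
noncomputable def _root_.conjUnitary (W : HA ≃ₗᵢ[ℂ] H) (u : unitary (HA →L[ℂ] HA)) :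
    unitary (H →L[ℂ] H) :=
  Unitary.linearIsometryEquiv.symm ((W.symm.trans (Unitary.linearIsometryEquiv u)).trans W)

theorem _root_.conjUnitary_apply (W : HA ≃ₗᵢ[ℂ] H) (u : unitary (HA →L[ℂ] HA)) (x : H) :
    (conjUnitary W u : H →L[ℂ] H) x = W ((u : HA →L[ℂ] HA) (W.symm x)) := rfl

theorem _root_.unitaryImage_conjUnitary (W : HA ≃ₗᵢ[ℂ] H) (u : unitary (HA →L[ℂ] HA))
    (S : Submodule ℂ HA) : unitaryImage (conjUnitary W u) (S.map (W.toLinearEquiv : HA →ₗ[ℂ] H)) =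
      (unitaryImage u S).map (W.toLinearEquiv : HA →ₗ[ℂ] H) := by
  ext x
  constructor
  · rintro ⟨_, ⟨y, hy, rfl⟩, rfl⟩
    refine ⟨_, ⟨y, hy, rfl⟩, ?_⟩
    change _ = W ((u : HA →L[ℂ] HA) (W.symm (W y)))
    rw [W.symm_apply_apply]
    rfl
  · rintro ⟨_, ⟨y, hy, rfl⟩, rfl⟩
    refine ⟨_, ⟨y, hy, rfl⟩, ?_⟩
    change W ((u : HA →L[ℂ] HA) (W.symm (W y))) = _
    rw [W.symm_apply_apply]
    rfl

variable [NormedAddCommGroup E] [NormedSpace ℝ E] [CompleteSpace E] [ChartedSpace E G]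
  [LieGroup 𝓘(ℝ, E) ∞ G] [IsBanachLieSubgroup (E := E) B]
  (W : HA ≃ₗᵢ[ℂ] H) {S₀ : Submodule ℂ H} [CompleteSpace S₀] {v : unitary (H →L[ℂ] H)}
  (hv : unitaryImage v S₀ = R.HB.map (W.toLinearEquiv : HA →ₗ[ℂ] H))
  {ζ : G ⧸ B → Gr S₀} (hζ : ∀ g : G, (ζ g).1 = (unitaryImage (R.ρ g) R.HB).map (W.toLinearEquiv : HA →ₗ[ℂ] H))
  {δ : TotalSpace R.HB R.Fiber → TotalSpace S₀ (Gr.Fiber S₀)} (hδ : ∀ ξ, (δ ξ).1 = ζ ξ.1)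
  (hδ' : ∀ ξ, totalEval (Gr.fiberEval S₀) (δ ξ) = W (totalEval R.fiberEval ξ))

/-- This lifts `gB ↦ W(ρ(g)HB)` to the unitary group. The factor `v` is needed because the base
point `S₀` need not be `W(HB)` but only a subspace in its unitary orbit. The lift is a bounded
linear function of `ρ(g)`, and smoothness into the unitary group can be tested in `B(H)`. -/
theorem contMDiff_conjUnitary_mul :
    ContMDiff 𝓘(ℝ, E) 𝓘(ℝ, Skew (H →L[ℂ] H)) ∞ fun g => conjUnitary W (R.ρ g) * v :=
  contMDiff_of_coe_unitary <| (contDiff_sandwich (W.toContinuousLinearEquiv : HA →L[ℂ] H)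
    ((W.symm.toContinuousLinearEquiv : H →L[ℂ] HA) ∘L (v : H →L[ℂ] H))).contMDiff.comp R.contMDiff_op

include hv hζ

theorem unitaryImage_conjUnitary_mul (g : G) :
    unitaryImage (conjUnitary W (R.ρ g) * v) S₀ = (ζ g).1 := by
  rw [unitaryImage_mul, hv, unitaryImage_conjUnitary, hζ]

/-- Smoothness is tested on `G`, where `ζ` is covered by the smooth lift to the unitary group. -/
theorem contMDiff_of_isometry :
    ContMDiff 𝓘(ℝ, QuotientModel E B)
      𝓘(ℝ, QuotientModel (Skew (H →L[ℂ] H)) (isotropy S₀)) ∞ ζ := by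
  refine R.isHomogeneousBundle.contMDiff_of_comp_p ?_
  have h : ζ ∘ (fun g : G => (g : G ⧸ B)) =
      Gr.mk S₀ ∘ fun g => conjUnitary W (R.ρ g) * v :=
    funext fun g => Subtype.ext (R.unitaryImage_conjUnitary_mul W hv hζ g).symm
  rw [h]
  exact (Gr.contMDiff_mk S₀).comp (R.contMDiff_conjUnitary_mul W)

include hδ hδ'

/-- The projection to the vertical parts on the homogeneous bundle is the pull-back of the one on a
tautological bundle, through a morphism given by an isometry of the Hilbert spaces. -/
theorem isPullbackConnection_of_isometry :
    IsPullbackConnection (QuotientModel E B) R.HB R.Fiber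
      (QuotientModel (Skew (H →L[ℂ] H)) (isotropy S₀)) S₀ (Gr.Fiber S₀) δ ζ
      (Gr.universalConnection S₀) (verticalPart (QuotientModel E B) R.fiberEval) := by
  -- `k = v⁻¹W` identifies the typical fibres. It is chosen so that `(Wρ(g)W⁻¹v)(k f) = Wρ(g)f`.
  let k : R.HB ≃ₗᵢ[ℂ] S₀ := (W.submoduleMap R.HB).trans
    (Gr.frame S₀ ⟨_, v, hv⟩ v hv).symm
  have hk : ∀ f, (v : H →L[ℂ] H) (k f) = W f := fun f =>
    Unitary.coe_apply_inv_apply v (W f)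
  have hu : ∀ g (f : R.HB), ((conjUnitary W (R.ρ g) * v : unitary (H →L[ℂ] H)) : H →L[ℂ] H) (k f) =
      W (R.op g f) := by
    intro g f
    change (conjUnitary W (R.ρ g) : H →L[ℂ] H) ((v : H →L[ℂ] H) (k f)) = _
    rw [hk, conjUnitary_apply, W.symm_apply_apply]
    rfl
  refine R.isHomogeneousBundle.isPullbackConnection (Gr.isHomogeneousBundle S₀)
    W.toLinearIsometry ?_ (R.contMDiff_of_isometry W hv hζ) (fun s => ?_) hδ'
  · refine R.isHomogeneousBundle.contMDiff_of_comp_q ?_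
    -- The lift of `δ` to `G × HB` is `(g, f) ↦ (Wρ(g)W⁻¹v, k f)`; the identity is checked on base
    -- points and evaluations.
    have h : δ ∘ R.quot = Gr.quot S₀ ∘ fun x => (conjUnitary W (R.ρ x.1) * v, k x.2) := by
      funext x
      refine (Gr.isHomogeneousBundle S₀).ext ?_ ?_
      · exact (hδ _).trans (Subtype.ext (R.unitaryImage_conjUnitary_mul W hv hζ x.1).symm)
      · exact (hδ' _).trans (hu x.1 x.2).symm
    rw [h]
    refine (Gr.isHomogeneousBundle S₀).contMDiff_q.comp
      (((R.contMDiff_conjUnitary_mul W).comp contMDiff_fst).prodMk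
        (ContMDiff.comp (g := k) ?_ contMDiff_snd))
    exact ((k.toContinuousLinearEquiv : R.HB →L[ℂ] S₀).restrictScalars ℝ).contDiff.contMDiff
  · obtain ⟨g, rfl⟩ := QuotientGroup.mk_surjective s
    -- On the fibre over `gB` the morphism is `k`, read in the frame `g` of the source and the frame
    -- `Wρ(g)W⁻¹v` of the target.
    refine ⟨(((R.frame g g rfl).symm.trans k).trans (Gr.frame S₀ (ζ g) _
      (R.unitaryImage_conjUnitary_mul W hv hζ g))).toContinuousLinearEquiv, fun x => ?_⟩
    obtain ⟨f, rfl⟩ := (R.frame g g rfl).surjective x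
    refine (Gr.isHomogeneousBundle S₀).ext (hδ _) ((hδ' _).trans ?_)
    change W (R.fiberEval _ (R.frame g g rfl f)) =
      ((conjUnitary W (R.ρ g) * v : unitary (H →L[ℂ] H)) : H →L[ℂ] H)
        (k ((R.frame g g rfl).symm (R.frame g g rfl f)))
    rw [LinearIsometryEquiv.symm_apply_apply, hu, fiberEval_frame]

end Isometry

end HomogeneousData

/-! ### Admissibility of `K_ρ` and the comparison of the connections. -/

namespace HomogeneousData

open Bundle

variable {E : Type*} [NormedAddCommGroup E] [NormedSpace ℝ E] [CompleteSpace E]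
  {G : Type*} [TopologicalSpace G] [ChartedSpace E G] [Group G] [LieGroup 𝓘(ℝ, E) ∞ G]
  {B : Subgroup G} [IsBanachLieSubgroup (E := E) B]
  {HA : Type*} [NormedAddCommGroup HA] [InnerProductSpace ℂ HA] [CompleteSpace HA]
  (R : HomogeneousData E B HA)

/-- Up to unfolding, `tangentCls` and `dρ` are the classes and the derivative at the unit of the
general theory, so this contains the independence of the natural connection from representatives. -/
theorem isNaturalConnection_iff (Φ : TangentTotal (QuotientModel E B) R.HB R.Fiber →
    TangentTotal (QuotientModel E B) R.HB R.Fiber) :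
    R.IsNaturalConnection Φ ↔ Φ = verticalPart (QuotientModel E B) R.fiberEval := by
  rw [← R.isHomogeneousBundle.eq_verticalPart_iff]
  exact Iff.rfl

theorem symmL_trivializationAt (s₀ s : G ⧸ B)
    (hs : s ∈ (trivializationAt R.HB R.Fiber s₀).baseSet) (f : R.HB) :
    (trivializationAt R.HB R.Fiber s₀).symmL ℝ s f =
      R.frame s (R.sec E s₀.out s) (R.mk_sec E s₀.out s hs) f := by
  rw [← (trivializationAt R.HB R.Fiber s₀).symmL_continuousLinearMapAt (R := ℝ) hs
    (R.frame s (R.sec E s₀.out s) (R.mk_sec E s₀.out s hs) f),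
    Trivialization.continuousLinearMapAt_apply, Trivialization.coe_linearMapAt_of_mem _ hs]
  refine congrArg _ ((congrArg Prod.snd (R.trivializationAt_apply s₀ s hs _)).trans ?_).symm
  exact LinearIsometryEquiv.symm_apply_apply _ f

/-- The reproducing kernel of a homogeneous bundle is a smooth section. -/
theorem contMDiffAt_kernel (s₀ t₀ : G ⧸ B) :
    ContMDiffAt (𝓘(ℝ, QuotientModel E B).prod 𝓘(ℝ, QuotientModel E B)) 𝓘(ℝ, R.HB →L[ℝ] R.HB) ∞
      (fun p : (G ⧸ B) × (G ⧸ B) =>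
        ContinuousLinearMap.inCoordinates R.HB R.Fiber R.HB R.Fiber t₀ p.2 s₀ p.1
          ((R.kernel.K p.1 p.2).restrictScalars ℝ)) (s₀, t₀) := by
  have hs : ∀ s₀ : G ⧸ B, (trivializationAt R.HB R.Fiber s₀).baseSet ∈ 𝓝 s₀ := fun s₀ =>
    (trivializationAt R.HB R.Fiber s₀).open_baseSet.mem_nhds
      (FiberBundle.mem_baseSet_trivializationAt R.HB R.Fiber s₀)
  have h1 : ∀ s₀ : G ⧸ B, ContMDiffAt 𝓘(ℝ, QuotientModel E B) 𝓘(ℝ, E) ∞ (R.sec E s₀.out) s₀ :=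
    fun s₀ => (R.contMDiffOn_sec s₀.out).contMDiffAt (hs s₀)
  have h2 : ContMDiffAt (𝓘(ℝ, QuotientModel E B).prod 𝓘(ℝ, QuotientModel E B)) 𝓘(ℝ, E) ∞
      (fun p : (G ⧸ B) × (G ⧸ B) => (R.sec E s₀.out p.1)⁻¹ * R.sec E t₀.out p.2) (s₀, t₀) :=
    (((h1 s₀).comp (s₀, t₀) contMDiffAt_fst).inv).mul ((h1 t₀).comp (s₀, t₀) contMDiffAt_snd)
  have h3 : ContDiff ℝ ∞ fun A : HA →L[ℂ] HA =>
      (sandwich R.HB.orthogonalProjectionOnto R.HB.subtypeL A).restrictScalars ℝ :=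
    ContDiff.comp (g := ContinuousLinearMap.restrictScalarsL ℂ R.HB R.HB ℝ ℝ)
      (ContinuousLinearMap.contDiff _)
      (contDiff_sandwich R.HB.orthogonalProjectionOnto R.HB.subtypeL)
  -- In the frames of two local sections the kernel at `(s, t)` is the compression to `HB` of
  -- `ρ(σ(s)⁻¹σ'(t))`, a bounded linear function of a smooth one.
  refine ((h3.contMDiff.comp R.contMDiff_op).contMDiffAt.comp (s₀, t₀) h2).congr_of_eventuallyEq ?_
  filter_upwards [prod_mem_nhds (hs s₀) (hs t₀)] with p hp
  refine ContinuousLinearMap.ext fun f => ?_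
  change (trivializationAt R.HB R.Fiber s₀).continuousLinearMapAt ℝ p.1
    (R.kernel.K p.1 p.2 ((trivializationAt R.HB R.Fiber t₀).symmL ℝ p.2 f)) =
    R.HB.orthogonalProjectionOnto (R.op ((R.sec E s₀.out p.1)⁻¹ * R.sec E t₀.out p.2) f)
  rw [R.symmL_trivializationAt t₀ p.2 hp.2,
    R.kernel_apply p.1 p.2 _ _ (R.mk_sec E s₀.out p.1 hp.1) (R.mk_sec E t₀.out p.2 hp.2),
    ← R.symmL_trivializationAt s₀ p.1 hp.1, Trivialization.continuousLinearMapAt_symmL _ hp.1,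
    op_mul_apply]

/-- With the same representative on both sides, `P(ρ(u⁻¹)ρ(u)f) = Pf = f`. -/
theorem kernel_self (s : G ⧸ B) : R.kernel.K s s = 1 := by
  refine ContinuousLinearMap.ext fun ξ => ?_
  obtain ⟨f, rfl⟩ := (R.frame s s.out (Quotient.out_eq' s)).surjective ξ
  rw [R.kernel_apply s s _ _ (Quotient.out_eq' s) (Quotient.out_eq' s), ← op_mul_apply,
    inv_mul_cancel, op_one_apply, Submodule.orthogonalProjectionOnto_mem_subspace_eq_self]
  rfl

/-- At the base point `1B` the value of `ζ_K` is `W(HB)`, so a unitary carrying `S₀` to it serves as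
the `v` of the isometry argument. -/
theorem unitaryImage_spaceEquiv {S₀ : Submodule ℂ R.kernel.Space}
    {v : unitary (R.kernel.Space →L[ℂ] R.kernel.Space)}
    (hv : unitaryImage v S₀ = R.kernel.ζ ((1 : G) : G ⧸ B)) :
    unitaryImage v S₀ =
      R.HB.map (R.spaceEquiv.toLinearEquiv : HA →ₗ[ℂ] R.kernel.Space) := by
  rw [hv, kernel_ζ_mk, map_one, unitaryImage_one]

theorem isAdmissible_kernel (S₀ : Submodule ℂ R.kernel.Space) [CompleteSpace S₀]
    (h : ∀ s, ∃ u, unitaryImage u S₀ = R.kernel.ζ s) :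
    R.kernel.IsAdmissible (QuotientModel E B) R.HB S₀ h where
  smooth := R.contMDiffAt_kernel
  isUnit s := by rw [kernel_self]; exact isUnit_one
  isSmooth_ζ := by
    obtain ⟨v, hv⟩ := h ((1 : G) : G ⧸ B)
    exact R.contMDiff_of_isometry R.spaceEquiv (R.unitaryImage_spaceEquiv hv) R.kernel_ζ_mk

theorem isPullbackConnection_kernel (S₀ : Submodule ℂ R.kernel.Space) [CompleteSpace S₀]
    (h : ∀ s, ∃ u, unitaryImage u S₀ = R.kernel.ζ s) :
    IsPullbackConnection (QuotientModel E B) R.HB R.Fiber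
      (QuotientModel (Skew (R.kernel.Space →L[ℂ] R.kernel.Space)) (isotropy S₀)) S₀ (Gr.Fiber S₀)
      (R.kernel.δ S₀ h) (R.kernel.ζGr S₀ h) (Gr.universalConnection S₀)
      (verticalPart (QuotientModel E B) R.fiberEval) := by
  obtain ⟨v, hv⟩ := h ((1 : G) : G ⧸ B)
  exact R.isPullbackConnection_of_isometry R.spaceEquiv (R.unitaryImage_spaceEquiv hv)
    R.kernel_ζ_mk (fun _ => rfl) fun ξ => (R.spaceEquiv_fiberEval ξ.1 ξ.2).symm

/-- The case `W = id`, `S₀ = HB`, `v = 1`. -/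
theorem isPullbackConnection_δ : IsPullbackConnection (QuotientModel E B) R.HB R.Fiber
    (QuotientModel (Skew (HA →L[ℂ] HA)) (isotropy R.HB)) R.HB (Gr.Fiber R.HB) R.δ R.ζ (Gr.universalConnection R.HB)
    (verticalPart (QuotientModel E B) R.fiberEval) :=
  R.isPullbackConnection_of_isometry (LinearIsometryEquiv.refl ℂ HA) (v := 1)
    ((unitaryImage_one _).trans (Submodule.map_id _).symm) (fun _ => (Submodule.map_id _).symm)
    (fun _ => rfl) fun _ => rfl

theorem exists_unitaryImage_eq_kernel_ζ : ∃ S₀ : Submodule ℂ R.kernel.Space,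
    IsClosed (S₀ : Set R.kernel.Space) ∧ ∀ s, ∃ u, unitaryImage u S₀ = R.kernel.ζ s := by
  -- The value of `ζ_K` at the base point serves as `S₀`, since the unitaries `Wρ(g)W⁻¹` carry it to
  -- all other values.
  refine ⟨R.kernel.ζ ((1 : G) : G ⧸ B), Submodule.isClosed_topologicalClosure _, fun s => ?_⟩
  obtain ⟨g, rfl⟩ := QuotientGroup.mk_surjective s
  refine ⟨conjUnitary R.spaceEquiv (R.ρ g), ?_⟩
  rw [kernel_ζ_mk, kernel_ζ_mk, map_one, unitaryImage_one, unitaryImage_conjUnitary]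

end HomogeneousData

theorem proposition5p4
    {E : Type*} [NormedAddCommGroup E] [NormedSpace ℝ E] [CompleteSpace E]
    {G : Type*} [TopologicalSpace G] [ChartedSpace E G] [Group G] [LieGroup 𝓘(ℝ, E) ∞ G]
    (B : Subgroup G) [IsBanachLieSubgroup (E := E) B]
    {HA : Type*} [NormedAddCommGroup HA] [InnerProductSpace ℂ HA] [CompleteSpace HA]
    (R : HomogeneousData E B HA) :
    ∃ Φρ : TangentTotal (QuotientModel E B) R.HB R.Fiber →
        TangentTotal (QuotientModel E B) R.HB R.Fiber,
      -- `Φρ` is the natural connection, i.e. the unique map given by the formula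
      (∀ Φ, R.IsNaturalConnection Φ ↔ Φ = Φρ) ∧
      IsLinearConnection (QuotientModel E B) R.HB R.Fiber Φρ ∧
      -- it is the pull-back of the universal connection through `(δ_ρ, ζ_ρ)`
      (∃ ΦP, (∀ Φ, IsUniversalConnection R.HB Φ ↔ Φ = ΦP) ∧
        IsLinearConnection (QuotientModel (Skew (HA →L[ℂ] HA)) (isotropy R.HB)) R.HB
          (Gr.Fiber R.HB) ΦP ∧
        IsPullbackConnection (QuotientModel E B) R.HB R.Fiber
          (QuotientModel (Skew (HA →L[ℂ] HA)) (isotropy R.HB)) R.HB (Gr.Fiber R.HB)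
          R.δ R.ζ ΦP Φρ) ∧
      -- it is the connection induced by the admissible reproducing kernel `K_ρ`
      (∃ S₀ : Submodule ℂ R.kernel.Space, IsClosed (S₀ : Set R.kernel.Space) ∧
        ∀ s, ∃ u, unitaryImage u S₀ = R.kernel.ζ s) ∧
      ∀ (S₀ : Submodule ℂ R.kernel.Space) [CompleteSpace S₀]
        (h : ∀ s, ∃ u, unitaryImage u S₀ = R.kernel.ζ s),
        R.kernel.IsAdmissible (QuotientModel E B) R.HB S₀ h ∧
        ∃ Φ₀, (∀ Φ, IsUniversalConnection S₀ Φ ↔ Φ = Φ₀) ∧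
          IsLinearConnection (QuotientModel (Skew (R.kernel.Space →L[ℂ] R.kernel.Space))
            (isotropy S₀)) S₀ (Gr.Fiber S₀) Φ₀ ∧
          IsPullbackConnection (QuotientModel E B) R.HB R.Fiber
            (QuotientModel (Skew (R.kernel.Space →L[ℂ] R.kernel.Space)) (isotropy S₀)) S₀
            (Gr.Fiber S₀) (R.kernel.δ S₀ h) (R.kernel.ζGr S₀ h) Φ₀ Φρ := by
  -- All the connections here are projections to vertical parts, so the witnesses are determined by
  -- the characterisations.
  refine ⟨_, R.isNaturalConnection_iff, R.isHomogeneousBundle.isLinearConnection_verticalPart,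
    ⟨_, isUniversalConnection_iff R.HB,
      (Gr.isHomogeneousBundle R.HB).isLinearConnection_verticalPart, R.isPullbackConnection_δ⟩,
    R.exists_unitaryImage_eq_kernel_ζ, fun S₀ _ h => ⟨R.isAdmissible_kernel S₀ h,
      _, isUniversalConnection_iff S₀, (Gr.isHomogeneousBundle S₀).isLinearConnection_verticalPart,
      R.isPullbackConnection_kernel S₀ h⟩⟩
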